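/- Let $-3<\gamma\le 1$ and let $b:[0,\pi]\to\mathbb R$ be measurable with $0\le b(\theta)\le C|\cos\theta|$ for some constant $C>0$. For $v,u\in\mathbb R^3$, $\omega\in\mathbb S^2$ put $$v'=v-[(v-u)\cdot\omega]\omega,\quad u'=u+[(v-u)\cdot\omega]\omega,\quad B(v-u,\theta)=|v-u|^\gamma b(\theta),\quad \cos\theta=\frac{\omega\cdot(v-u)}{|v-u|}.$$ Let $\mu(v)=(2\pi)^{-3/2}e^{-|v|^2/2}$, $w_k(v)=(1+|v|)^k$, and $$\nu(v)=\int_{\mathbb R^3}\int_{\mathbb S^2}B(v-u,\theta)\,\mu(u)\,d\omega du,\qquad Q(G,F)(v)=\int_{\mathbb R^3}\int_{\mathbb S^2}B(v-u,\theta)\,[G(u')F(v')-G(u)F(v)]\,d\omega du,$$ $$\mathcal Kf(v)=\int_{\mathbb R^3}\int_{\mathbb S^2}B(v-u,\theta)\,[\mu(u')f(v')+\mu(v')f(u')-\mu(v)f(u)]\,d\omega du .$$ For $f=f(x,v)$ on $\mathbb R^3\times\mathbb R^3$ let $\|f\|_{L^\infty_vL^p_x}=\operatorname{ess\,sup}_v\|f(\cdot,v)\|_{L^p_x}$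 and $\|f\|_{L^\infty_{x,v}}=\|f\|_{L^\infty_vL^\infty_x}$. For $T>0$ and $k\ge j>0$ let $\mathcal X_{T,k,j}$ be the set of measurable $g=g(t,x,v)$ on $[0,T]\times\mathbb R^3\times\mathbb R^3$ (with every $g(t)$ measurable) such that $$\sup_{0\le t\le T}\|w_kg(t)\|_{L^\infty_{x,v}}+\sup_{0\le t\le T}\|w_jg(t)\|_{L^\infty_vL^2_x}<\infty .$$ A mild solution on $[0,T]$ of the Boltzmann equation $\partial_tF+v\cdot\nabla_xF=Q(F,F)$ with initial datum $F_0=\mu+g_0$ is $F=\mu+g$ such that, for every $t\in[0,T]$ and almost every $(x,v)$, all integrals converge absolutely (those in $(u,\omega)$ for almost every $s\in[0,t]$) and $$g(t,x,v)=e^{-\nu(v)t}g_0(x-vt,v)+\int_0^te^{-\nu(v)(t-s)}(\mathcal Kg)(s,x-v(t-s),v)\,ds+\int_0^te^{-\nu(v)(t-s)}Q(g,g)(s,x-v(t-s),v)\,ds .$$ **Theorem.** There is $k_0>0$ such that for all real $k\ge j\ge k_0$ there are $\epsilon_1>0$ and $T_*>0$ with the following property. Let $g_0=g_0(x,v)$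 be measurable with $F_0=\mu+g_0\ge 0$ almost everywhere, $$\|w_kg_0\|_{L^\infty_{x,v}}<\epsilon_1\quad\text{and}\quad \|w_jg_0\|_{L^\infty_vL^2_x}<\infty .$$ Then there is a mild solution $F=\mu+g$ on $[0,T_*]$ with initial datum $F_0$ such that $g\in\mathcal X_{T_*,k,j}$, such that for every $t\in[0,T_*]$ one has $F(t,x,v)\ge 0$ for almost every $(x,v)$, and such that $$\sup_{0\le t\le T_*}\|w_kg(t)\|_{L^\infty_{x,v}}+\sup_{0\le t\le T_*}\|w_jg(t)\|_{L^\infty_vL^2_x}\le 2\big(\|w_kg_0\|_{L^\infty_{x,v}}+\|w_jg_0\|_{L^\infty_vL^2_x}\big).$$ It is unique: if $\mu+h$ is any mild solution on $[0,T_*]$ with the same initial datum, with $h\in\mathcal X_{T_*,k,j}$ and with $\mu+h(t)\ge 0$ almost everywhere for every $t\in[0,T_*]$, then for every $t\in[0,T_*]$ one has $h(t)=g(t)$ almost everywhere. -/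

import Mathlib

open MeasureTheory Set
open scoped ENNReal

noncomputable section

namespace Boltzmann

/-- The space `ℝ³` with its Euclidean norm (used both for positions and for velocities). -/
abbrev R3 : Type := EuclideanSpace ℝ (Fin 3)

/-- The unit sphere `S²` of `ℝ³`. -/
abbrev S2 : Type := Metric.sphere (0 : R3) 1

/-- The measure `du dω` on `ℝ³ × S²`: Lebesgue measure times surface measure
(`Measure.toSphere` of Lebesgue measure is the surface measure of total mass `4π`). -/
abbrev duDω : Measure (R3 × S2) :=
  (volume : Measure R3).prod (volume : Measure R3).toSphere

/-- The velocity weight `w_k(v) = (1 + |v|) ^ k`. -/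
def weight (k : ℝ) (v : R3) : ℝ := (1 + ‖v‖) ^ k

/-- The normalized global Maxwellian `μ(v) = (2π)^(-3/2) exp (-|v|²/2)`. -/
def maxwellian (v : R3) : ℝ :=
  (2 * Real.pi) ^ (-(3 / 2) : ℝ) * Real.exp (-‖v‖ ^ 2 / 2)

/-- `v' = v - [(v - u) · ω] ω`. -/
def vPost (v u : R3) (ω : S2) : R3 := v - (inner ℝ (v - u) (ω : R3)) • (ω : R3)

/-- `u' = u + [(v - u) · ω] ω`. -/
def uPost (v u : R3) (ω : S2) : R3 := u + (inner ℝ (v - u) (ω : R3)) • (ω : R3)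

/-- The collision kernel `B(v - u, θ) = |v - u|^γ b(θ)`, where `θ ∈ [0, π]` is the angle between
`v - u` and `ω`, i.e. `cos θ = ω · (v - u) / |v - u|`. -/
def kernel (γ : ℝ) (b : ℝ → ℝ) (v u : R3) (ω : S2) : ℝ :=
  ‖v - u‖ ^ γ * b (InnerProductGeometry.angle (v - u) (ω : R3))

/-- The collision frequency `ν(v) = ∫∫ B(v - u, θ) μ(u) dω du`. -/
def nu (γ : ℝ) (b : ℝ → ℝ) (v : R3) : ℝ :=
  ∫ p : R3 × S2, kernel γ b v p.1 p.2 * maxwellian p.1 ∂duDω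

/-- The integrand, at `(u, ω)`, of the collision operator `Q(G, F)(v)`. -/
def collisionIntegrand (γ : ℝ) (b : ℝ → ℝ) (G F : R3 → ℝ) (v : R3) (p : R3 × S2) : ℝ :=
  kernel γ b v p.1 p.2 *
    (G (uPost v p.1 p.2) * F (vPost v p.1 p.2) - G p.1 * F v)

/-- The Boltzmann collision operator
`Q(G, F)(v) = ∫∫ B(v - u, θ) [G(u') F(v') - G(u) F(v)] dω du`. -/
def collision (γ : ℝ) (b : ℝ → ℝ) (G F : R3 → ℝ) (v : R3) : ℝ :=
  ∫ p : R3 × S2, collisionIntegrand γ b G F v p ∂duDω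

/-- The integrand, at `(u, ω)`, of the operator `𝒦 f (v)`. -/
def linearIntegrand (γ : ℝ) (b : ℝ → ℝ) (f : R3 → ℝ) (v : R3) (p : R3 × S2) : ℝ :=
  kernel γ b v p.1 p.2 *
    (maxwellian (uPost v p.1 p.2) * f (vPost v p.1 p.2)
      + maxwellian (vPost v p.1 p.2) * f (uPost v p.1 p.2)
      - maxwellian v * f p.1)

/-- The operator
`𝒦 f (v) = ∫∫ B(v - u, θ) [μ(u') f(v') + μ(v') f(u') - μ(v) f(u)] dω du`. -/
def linearK (γ : ℝ) (b : ℝ → ℝ) (f : R3 → ℝ) (v : R3) : ℝ :=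
  ∫ p : R3 × S2, linearIntegrand γ b f v p ∂duDω

/-- The mixed norm `‖f‖_{L^q_v L^p_x}` of `f = f(x, v)`, with values in `[0, ∞]`:
first the `L^p` norm in `x`, then the `L^q` norm in `v` (essential suprema for `∞`). -/
def mixedNorm (q p : ℝ≥0∞) (f : R3 → R3 → ℝ) : ℝ≥0∞ :=
  eLpNorm (fun v => eLpNorm (fun x => f x v) p volume) q volume

/-- `‖w_k f‖_{L^∞_{x,v}}`. -/
def normInf (k : ℝ) (f : R3 → R3 → ℝ) : ℝ≥0∞ :=
  mixedNorm ∞ ∞ (fun x v => weight k v * f x v)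

/-- `‖w_j f‖_{L^∞_v L^2_x}`. -/
def normL2 (j : ℝ) (f : R3 → R3 → ℝ) : ℝ≥0∞ :=
  mixedNorm ∞ 2 (fun x v => weight j v * f x v)

/-- `sup_{0 ≤ t ≤ T} ‖w_k g(t)‖_{L^∞_{x,v}}`. -/
def supNormInf (T k : ℝ) (g : ℝ → R3 → R3 → ℝ) : ℝ≥0∞ :=
  ⨆ t ∈ Icc (0 : ℝ) T, normInf k (g t)

/-- `sup_{0 ≤ t ≤ T} ‖w_j g(t)‖_{L^∞_v L^2_x}`. -/
def supNormL2 (T j : ℝ) (g : ℝ → R3 → R3 → ℝ) : ℝ≥0∞ :=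
  ⨆ t ∈ Icc (0 : ℝ) T, normL2 j (g t)

/-- Membership of `g = g(t, x, v)` in the space `𝒳_{T,k,j}`. Functions are Lebesgue measurable,
and both weighted norms are bounded on `[0, T]`. For `k, j ≥ 0` the weights are at least `1`, so
that `g ∈ L^∞(0, T; L^∞_{x,v} ∩ L^∞_v L^2_x)` is contained in the two bounds. -/
structure MemX (T k j : ℝ) (g : ℝ → R3 → R3 → ℝ) : Prop where
  aesm : AEStronglyMeasurable (fun p : ℝ × R3 × R3 => g p.1 p.2.1 p.2.2)
    ((volume.restrict (Icc (0 : ℝ) T)).prod (volume : Measure (R3 × R3)))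
  aesm_slice : ∀ t ∈ Icc (0 : ℝ) T,
    AEStronglyMeasurable (fun z : R3 × R3 => g t z.1 z.2) volume
  bound_inf : supNormInf T k g < ∞
  bound_L2 : supNormL2 T j g < ∞

/-- `g` is a mild solution on `[0, T]` of the perturbed Boltzmann equation with initial datum `g₀`:
for every `t ∈ [0, T]` and almost every `(x, v)`, all the integrals below converge absolutely and
`g(t,x,v) = e^{-ν(v)t} g₀(x-vt,v) + ∫₀ᵗ e^{-ν(v)(t-s)} (𝒦g)(s,x-v(t-s),v) ds
  + ∫₀ᵗ e^{-ν(v)(t-s)} Q(g,g)(s,x-v(t-s),v) ds`. -/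
def IsMildSolution (γ : ℝ) (b : ℝ → ℝ) (T : ℝ) (g₀ : R3 → R3 → ℝ) (g : ℝ → R3 → R3 → ℝ) : Prop :=
  ∀ t ∈ Icc (0 : ℝ) T, ∀ᵐ z : R3 × R3,
    let x := z.1
    let v := z.2
    (∀ᵐ s ∂(volume.restrict (Icc (0 : ℝ) t)),
      Integrable (linearIntegrand γ b (g s (x - (t - s) • v)) v) duDω ∧
      Integrable (collisionIntegrand γ b (g s (x - (t - s) • v)) (g s (x - (t - s) • v)) v) duDω) ∧
    IntervalIntegrable (fun s => Real.exp (-nu γ b v * (t - s)) *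
      linearK γ b (g s (x - (t - s) • v)) v) volume 0 t ∧
    IntervalIntegrable (fun s => Real.exp (-nu γ b v * (t - s)) *
      collision γ b (g s (x - (t - s) • v)) (g s (x - (t - s) • v)) v) volume 0 t ∧
    g t x v = Real.exp (-nu γ b v * t) * g₀ (x - t • v) v
      + (∫ s in (0 : ℝ)..t, Real.exp (-nu γ b v * (t - s)) *
          linearK γ b (g s (x - (t - s) • v)) v)
      + ∫ s in (0 : ℝ)..t, Real.exp (-nu γ b v * (t - s)) *
          collision γ b (g s (x - (t - s) • v)) (g s (x - (t - s) • v)) v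

/-- `F(t, ·, ·) = μ + g(t, ·, ·) ≥ 0` almost everywhere, for every `t ∈ [0, T]`. -/
def IsNonneg (T : ℝ) (g : ℝ → R3 → R3 → ℝ) : Prop :=
  ∀ t ∈ Icc (0 : ℝ) T, ∀ᵐ z : R3 × R3, 0 ≤ maxwellian z.2 + g t z.1 z.2

end Boltzmann

end

/-! The solution is a fixed point of the Duhamel map, found by Picard iteration in the pointwise
norm sup |g(t,x,v)| (1+|v|)^k. The obstacle is that for γ > 0 the operators 𝒦 and Q grow in v like
the unbounded collision frequency ν. Two facts remove it. One is that ∫₀ᵗ ν e^{-ν(t-s)} ds ≤ 1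
whatever ν is (`integral_exp_mul_le`): growth like ν is harmless provided its coefficient is small,
while the part without ν is made small by a short time T. The other is that the coefficient is
indeed small (`exists_weightBound`): for large l, 𝒦 sends functions of size (1+|v|)^{-l} to
functions of size (ν/8 + K)(1+|v|)^{-l}, and Q, whose coefficient K(ν+1) need not be small, is
quadratic and acts on small functions.

The weighted bounds rest on the geometry of a collision. In an orthonormal frame with first vector
ω, v and u merely exchange their first coordinates, and the cutoff b ≤ C|cos θ| allows the kernel to
be dominated by a product of powers of the three coordinate differences (`kernel_le`). For fixed ω
the integral in u is then a product of one-dimensional integrals. It loses one or two powers of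
1+|v|, and integration over the sphere regains exactly these (`lintegral_gain_weights`). The small
coefficient comes from `ratio_le`: if a Maxwellian at one outgoing velocity forces the other to
carry most of the energy of v, the ratio of the weights is at most a factor absorbed by that
Maxwellian times (1+z/|v|²)^{-l/4}, with z the energy taken over from u. Per coordinate this
integrates to O(|v|/√l), so a large l gives any desired smallness relative to (1+|v|)^γ, which is
comparable with ν+1 unless the kernel vanishes (`exists_nu_lower`).

The L² bound travels along the iteration: by Minkowski's inequality the same constants govern the L²
norm in x, because each quadratic term has one factor bounded in the sup norm
(`eLpNorm_mildMap_le`). For nonnegativity, if F = μ+g ≥ -Z(1+|v|)^{-k} then, along a characteristic,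
F can decrease below zero only at a rate proportional to Z, which improves Z to Z/2
(`fixedPoint_lower_bound`); iteration gives F ≥ 0. For uniqueness the competitor h may be large.
After a time up to which h = g, it leaves g at most linearly in time in the weaker weight k-1, since
ν ≤ K(1+|v|); hence for a uniform time step it stays so close to g that the contraction in weight
k-1 forces equality (`mildSolution_unique`). -/

namespace Boltzmann

/-! ### Product integration in orthonormal frames and decay of integrals over the sphere -/

theorem lintegral_inv_one_add_sq {a : ℝ} (ha : 0 < a) :
    ∫⁻ p : ℝ, ENNReal.ofReal ((1 + (a * p) ^ 2)⁻¹) = ENNReal.ofReal (Real.pi / a) := by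
  rw [← ofReal_integral_eq_lintegral_ofReal]
  · rw [Measure.integral_comp_mul_left (fun p : ℝ => (1 + p ^ 2)⁻¹) a,
      integral_univ_inv_one_add_sq, abs_of_pos (inv_pos.2 ha), smul_eq_mul]
    congr 1; field_simp
  · exact (integrable_inv_one_add_sq).comp_mul_left' ha.ne'
  · exact Filter.Eventually.of_forall fun p => by positivity

theorem lintegral_three (f g h : ℝ → ℝ≥0∞) (hf : Measurable f) (hg : Measurable g)
    (hh : Measurable h) :
    ∫⁻ x : Fin 3 → ℝ, f (x 0) * (g (x 1) * h (x 2)) = (∫⁻ x, f x) * ((∫⁻ x, g x) * ∫⁻ x, h x) := by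
  have h1 := (volume_preserving_piFinSuccAbove (fun _ : Fin 3 => ℝ) 0).symm
  have h2 := (volume_preserving_finTwoArrow ℝ).symm
  rw [← h1.lintegral_comp_emb (MeasurableEquiv.measurableEmbedding _)]
  have : ∀ p : ℝ × (Fin 2 → ℝ), (f (((MeasurableEquiv.piFinSuccAbove (fun _ : Fin 3 => ℝ) 0).symm p) 0) *
      (g (((MeasurableEquiv.piFinSuccAbove (fun _ : Fin 3 => ℝ) 0).symm p) 1) *
       h (((MeasurableEquiv.piFinSuccAbove (fun _ : Fin 3 => ℝ) 0).symm p) 2)))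
      = f p.1 * (g (p.2 0) * h (p.2 1)) := fun p => rfl
  simp only [this]
  rw [Measure.volume_eq_prod]
  rw [lintegral_prod_mul (f := f) (g := fun q : Fin 2 → ℝ => g (q 0) * h (q 1)) hf.aemeasurable
    (by fun_prop)]
  rw [← h2.lintegral_comp_emb (MeasurableEquiv.measurableEmbedding _)]
  have : ∀ p : ℝ × ℝ, (g ((MeasurableEquiv.finTwoArrow.symm p) 0) *
      h ((MeasurableEquiv.finTwoArrow.symm p) 1)) = g p.1 * h p.2 := fun p => rfl
  simp only [this]
  rw [Measure.volume_eq_prod, lintegral_prod_mul hg.aemeasurable hh.aemeasurable]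

theorem lintegral_orthonormalBasis (e : OrthonormalBasis (Fin 3) ℝ R3) (f g h : ℝ → ℝ≥0∞)
    (hf : Measurable f) (hg : Measurable g) (hh : Measurable h) :
    ∫⁻ u : R3, f (inner ℝ (e 0) u) * (g (inner ℝ (e 1) u) * h (inner ℝ (e 2) u))
      = (∫⁻ x, f x) * ((∫⁻ x, g x) * ∫⁻ x, h x) := by
  rw [← lintegral_three f g h hf hg hh]
  have h1 := e.measurePreserving_repr
  have h2 := (PiLp.volume_preserving_ofLp (Fin 3)).comp h1
  rw [← h2.lintegral_comp (f := fun x : Fin 3 → ℝ => f (x 0) * (g (x 1) * h (x 2))) (by fun_prop)]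
  simp [OrthonormalBasis.repr_apply_apply]

theorem exists_orthonormalBasis (v : R3) :
    ∃ e : OrthonormalBasis (Fin 3) ℝ R3, v = ‖v‖ • e 0 := by
  have key : ∀ w : R3, ‖w‖ = 1 → ∃ e : OrthonormalBasis (Fin 3) ℝ R3, e 0 = w := by
    intro w hw
    obtain ⟨e, he⟩ := Orthonormal.exists_orthonormalBasis_extension_of_card_eq (𝕜 := ℝ) (E := R3)
      (ι := Fin 3) (by simp) (v := fun _ => w) (s := {0}) (by
        constructor
        · intro i; simpa using hw
        · intro i j hij; exact absurd (Subsingleton.elim i j) hij)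
    exact ⟨e, he 0 (by simp)⟩
  by_cases hv : v = 0
  · exact ⟨EuclideanSpace.basisFun (Fin 3) ℝ, by simp [hv]⟩
  · obtain ⟨e, he⟩ := key (‖v‖⁻¹ • v) (norm_smul_inv_norm hv)
    refine ⟨e, ?_⟩
    rw [he, smul_smul, mul_inv_cancel₀ (norm_ne_zero_iff.2 hv), one_smul]

theorem exists_orthonormalBasis_sphere (ω : S2) :
    ∃ e : OrthonormalBasis (Fin 3) ℝ R3, e 0 = ω := by
  obtain ⟨e, he⟩ := exists_orthonormalBasis ω
  refine ⟨e, ?_⟩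
  rw [norm_eq_of_mem_sphere, one_smul] at he
  exact he.symm

theorem norm_sq_eq_basis (e : OrthonormalBasis (Fin 3) ℝ R3) (v : R3) :
    ‖v‖ ^ 2 = (inner ℝ (e 0) v) ^ 2 + (inner ℝ (e 1) v) ^ 2 + (inner ℝ (e 2) v) ^ 2 := by
  have := e.sum_sq_norm_inner_right v
  rw [Fin.sum_univ_three] at this
  simp only [Real.norm_eq_abs, sq_abs] at this
  exact this.symm

/-- The radial projection of `ℝ³ \ {0}` to the sphere. -/
noncomputable def dir (x : R3) : S2 :=
  if h : x = 0 then ⟨EuclideanSpace.single 0 1, by simp⟩ else ⟨‖x‖⁻¹ • x, by simp [norm_smul, h]⟩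

theorem coe_dir {x : R3} (h : x ≠ 0) : (dir x : R3) = ‖x‖⁻¹ • x := by simp [dir, h]

theorem measurable_dir : Measurable dir := by
  rw [← (MeasurableEmbedding.subtype_coe Metric.isClosed_sphere.measurableSet).measurable_comp_iff]
  have : (Subtype.val ∘ dir : R3 → R3)
      = fun x => if x = 0 then EuclideanSpace.single 0 1 else ‖x‖⁻¹ • x := by
    ext1 x
    by_cases h : x = 0 <;> simp [dir, h]
  rw [this]
  exact Measurable.ite (measurableSet_singleton 0) measurable_const (by fun_prop)

-- Surface measure is three times the volume of the cone in the unit ball. Integrals over the sphere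
-- thereby become volume integrals, to which Fubini in a suitable orthonormal frame applies.
open scoped Pointwise in
theorem toSphere_eq_map_dir : (volume : Measure R3).toSphere
    = (3 : ℝ≥0∞) • ((volume : Measure R3).restrict (Metric.ball 0 1 \ {0})).map dir := by
  ext s hs
  rw [Measure.toSphere_apply' _ hs, Measure.smul_apply, Measure.map_apply measurable_dir hs,
    Measure.restrict_apply (measurable_dir hs)]
  have : Ioo (0 : ℝ) 1 • ((↑) '' s : Set R3) = dir ⁻¹' s ∩ (Metric.ball 0 1 \ {0}) := by
    ext x
    simp only [Set.mem_smul, mem_inter_iff, mem_preimage]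
    constructor
    · rintro ⟨r, hr, _, ⟨ω, hω, rfl⟩, rfl⟩
      have hω1 : ‖(ω : R3)‖ = 1 := norm_eq_of_mem_sphere ω
      have hne : r • (ω : R3) ≠ 0 := by
        intro h
        have := congrArg norm h
        rw [norm_smul, hω1] at this
        simp at this
        exact hr.1.ne' this
      have : dir (r • (ω : R3)) = ω := by
        apply Subtype.ext
        rw [coe_dir hne, norm_smul, hω1, smul_smul, Real.norm_of_nonneg hr.1.le]
        have := hr.1.ne'
        field_simp
        simp
      refine ⟨by rw [this]; exact hω, ?_, by simpa using hne⟩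
      rw [mem_ball_zero_iff, norm_smul, hω1, Real.norm_of_nonneg hr.1.le]
      simpa using hr.2
    · rintro ⟨h1, h2, h3⟩
      have hx : x ≠ 0 := h3
      refine ⟨‖x‖, ⟨norm_pos_iff.2 hx, by simpa using h2⟩, _, ⟨_, h1, rfl⟩, ?_⟩
      rw [coe_dir hx, smul_smul, mul_inv_cancel₀ (norm_ne_zero_iff.2 hx), one_smul]
  rw [this]
  simp

theorem lintegral_sphere {f : S2 → ℝ≥0∞} (hf : Measurable f) :
    ∫⁻ ω, f ω ∂(volume : Measure R3).toSphere
      = 3 * ∫⁻ x in Metric.ball (0 : R3) 1 \ {0}, f (dir x) := by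
  rw [toSphere_eq_map_dir, lintegral_smul_measure, lintegral_map hf measurable_dir]
  simp

theorem sphere_univ_ne_top : (volume : Measure R3).toSphere univ ≠ ∞ := measure_ne_top _ _

/-- Comparison of a sphere integral with an integral over the ball. -/
theorem lintegral_sphere_le {f : S2 → ℝ≥0∞} (hf : Measurable f) {F : R3 → ℝ≥0∞}
    (h : ∀ x : R3, ‖x‖ < 1 → x ≠ 0 → f (dir x) ≤ F x) :
    ∫⁻ ω, f ω ∂(volume : Measure R3).toSphere ≤ 3 * ∫⁻ x in Metric.ball (0 : R3) 1, F x := by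
  rw [lintegral_sphere hf]
  gcongr 3 * ?_
  calc _ ≤ ∫⁻ x in Metric.ball (0 : R3) 1 \ {0}, F x :=
        setLIntegral_mono' (measurableSet_ball.diff (measurableSet_singleton _)) fun x hx =>
          h x (by simpa using hx.1) hx.2
    _ ≤ _ := lintegral_mono_set sdiff_subset

/-- `∫_{S²} (1 + (v·ω)²)⁻¹ dω ≤ C / (1 + |v|)`. -/
theorem sphere_decay_parallel : ∃ C : ℝ, 0 < C ∧ ∀ v : R3,
    ∫⁻ ω : S2, ENNReal.ofReal ((1 + (inner ℝ (ω : R3) v) ^ 2)⁻¹) ∂(volume : Measure R3).toSphere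
      ≤ ENNReal.ofReal (C / (1 + ‖v‖)) := by
  obtain ⟨m, hm⟩ : ∃ m : ℝ, (volume : Measure R3).toSphere univ = ENNReal.ofReal m ∧ 0 ≤ m :=
    ⟨_, (ENNReal.ofReal_toReal sphere_univ_ne_top).symm, ENNReal.toReal_nonneg⟩
  refine ⟨2 * m + 24 * Real.pi + 1, by have := hm.2; positivity, fun v => ?_⟩
  rcases le_or_gt ‖v‖ 1 with hv | hv
  · calc _ ≤ ∫⁻ ω : S2, 1 ∂(volume : Measure R3).toSphere := by
          refine lintegral_mono fun ω => ?_
          rw [ENNReal.ofReal_le_one]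
          exact inv_le_one_of_one_le₀ (by nlinarith [sq_nonneg (inner ℝ (ω : R3) v)])
      _ = ENNReal.ofReal m := by rw [lintegral_one, hm.1]
      _ ≤ _ := by
          apply ENNReal.ofReal_le_ofReal
          rw [le_div_iff₀ (by positivity)]
          nlinarith [hm.2, Real.pi_pos]
  · obtain ⟨e, he⟩ := exists_orthonormalBasis v
    have hv0 : 0 < ‖v‖ := by linarith
    have hcoord : ∀ (i : Fin 3) (x : R3), ‖x‖ < 1 → inner ℝ (e i) x ∈ Icc (-1 : ℝ) 1 := by
      intro i x hx
      have h1 := abs_real_inner_le_norm (e i) x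
      rw [e.norm_eq_one, one_mul] at h1
      exact abs_le.1 (h1.trans hx.le)
    -- The directions with |v·ω| of order one form a band of width 1/|v|. Replacing x/|x| by x with
    -- |x| < 1 only decreases the inner product, hence increases the integrand; the ball is then
    -- enlarged to the strip bounded in the other two coordinates.
    calc _ ≤ 3 * ∫⁻ x in Metric.ball (0 : R3) 1, (ENNReal.ofReal ((1 + (‖v‖ * (inner ℝ (e 0) x)) ^ 2)⁻¹) *
              ((Icc (-1 : ℝ) 1).indicator 1 (inner ℝ (e 1) x) *
                (Icc (-1 : ℝ) 1).indicator 1 (inner ℝ (e 2) x))) := by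
          refine lintegral_sphere_le (by fun_prop) fun x hx hx0 => ?_
          rw [indicator_of_mem (hcoord 1 x hx), indicator_of_mem (hcoord 2 x hx)]
          simp only [Pi.one_apply, mul_one]
          apply ENNReal.ofReal_le_ofReal
          apply inv_anti₀ (by positivity)
          rw [coe_dir hx0]
          conv_rhs => rw [he]
          rw [inner_smul_left, inner_smul_right, real_inner_comm]
          have : 1 ≤ ‖x‖⁻¹ := (one_le_inv₀ (norm_pos_iff.2 hx0)).2 hx.le
          have h2 : (1:ℝ) ≤ (‖x‖⁻¹) ^ 2 := one_le_pow₀ this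
          simp only [conj_trivial]
          have h3 := sq_nonneg (‖v‖ * inner ℝ (e 0) x)
          nlinarith [mul_le_mul_of_nonneg_right h2 h3]
      _ ≤ 3 * ∫⁻ x : R3, (ENNReal.ofReal ((1 + (‖v‖ * (inner ℝ (e 0) x)) ^ 2)⁻¹) *
              ((Icc (-1 : ℝ) 1).indicator 1 (inner ℝ (e 1) x) *
                (Icc (-1 : ℝ) 1).indicator 1 (inner ℝ (e 2) x))) := by
          gcongr; exact Measure.restrict_le_self
      _ = 3 * (ENNReal.ofReal (Real.pi / ‖v‖) * (2 * 2)) := by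
          rw [lintegral_orthonormalBasis e (fun p => ENNReal.ofReal ((1 + (‖v‖ * p) ^ 2)⁻¹))
            _ _ (by fun_prop) (measurable_one.indicator measurableSet_Icc)
            (measurable_one.indicator measurableSet_Icc), lintegral_inv_one_add_sq hv0,
            lintegral_indicator_one measurableSet_Icc, Real.volume_Icc]
          norm_num
      _ = ENNReal.ofReal (12 * (Real.pi / ‖v‖)) := by
          rw [ENNReal.ofReal_mul (by norm_num)]
          rw [show ENNReal.ofReal 12 = 12 by simp]
          ring_nf
      _ ≤ _ := by
          apply ENNReal.ofReal_le_ofReal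
          rw [le_div_iff₀ (by positivity), ← mul_div_assoc, div_mul_eq_mul_div, div_le_iff₀ hv0]
          nlinarith [hm.2, Real.pi_pos, mul_nonneg hm.2 hv0.le]

/-- `∫_{S²} (1 + |v|² - (v·ω)²)⁻² dω ≤ C / (1 + |v|)²`. -/
theorem sphere_decay_perp : ∃ C : ℝ, 0 < C ∧ ∀ v : R3,
    ∫⁻ ω : S2, ENNReal.ofReal (((1 + (‖v‖ ^ 2 - (inner ℝ (ω : R3) v) ^ 2)) ^ 2)⁻¹)
      ∂(volume : Measure R3).toSphere ≤ ENNReal.ofReal (C / (1 + ‖v‖) ^ 2) := by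
  obtain ⟨m, hm⟩ : ∃ m : ℝ, (volume : Measure R3).toSphere univ = ENNReal.ofReal m ∧ 0 ≤ m :=
    ⟨_, (ENNReal.ofReal_toReal sphere_univ_ne_top).symm, ENNReal.toReal_nonneg⟩
  have hpos : ∀ (v : R3) (ω : S2), 0 ≤ ‖v‖ ^ 2 - (inner ℝ (ω : R3) v) ^ 2 := by
    intro v ω
    have h1 := abs_real_inner_le_norm (ω : R3) v
    rw [norm_eq_of_mem_sphere, one_mul] at h1
    have := sq_le_sq' (by linarith [neg_abs_le (inner ℝ (ω : R3) v), abs_nonneg (inner ℝ (ω : R3) v), norm_nonneg v]) ((le_abs_self _).trans h1)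
    linarith
  refine ⟨4 * m + 24 * Real.pi ^ 2 + 1, by have := hm.2; positivity, fun v => ?_⟩
  rcases le_or_gt ‖v‖ 1 with hv | hv
  · calc _ ≤ ∫⁻ ω : S2, 1 ∂(volume : Measure R3).toSphere := by
          refine lintegral_mono fun ω => ?_
          rw [ENNReal.ofReal_le_one]
          exact inv_le_one_of_one_le₀ (one_le_pow₀ (by linarith [hpos v ω]))
      _ = ENNReal.ofReal m := by rw [lintegral_one, hm.1]
      _ ≤ _ := by
          apply ENNReal.ofReal_le_ofReal
          rw [le_div_iff₀ (by positivity)]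
          have : (1 + ‖v‖) ^ 2 ≤ 4 := by nlinarith [norm_nonneg v]
          nlinarith [hm.2, sq_nonneg Real.pi]
  · obtain ⟨e, he⟩ := exists_orthonormalBasis v
    have hv0 : 0 < ‖v‖ := by linarith
    have hcoord : ∀ (i : Fin 3) (x : R3), ‖x‖ < 1 → inner ℝ (e i) x ∈ Icc (-1 : ℝ) 1 := by
      intro i x hx
      have h1 := abs_real_inner_le_norm (e i) x
      rw [e.norm_eq_one, one_mul] at h1
      exact abs_le.1 (h1.trans hx.le)
    -- Now only directions within 1/|v| of ±v count. The square in the integrand is used through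
    -- (1+p²+q²)² ≥ (1+p²)(1+q²), which separates the two transversal coordinates; each contributes
    -- π/|v|.
    calc _ ≤ 3 * ∫⁻ x in Metric.ball (0 : R3) 1, ((Icc (-1 : ℝ) 1).indicator 1 (inner ℝ (e 0) x) *
              (ENNReal.ofReal ((1 + (‖v‖ * (inner ℝ (e 1) x)) ^ 2)⁻¹) *
                ENNReal.ofReal ((1 + (‖v‖ * (inner ℝ (e 2) x)) ^ 2)⁻¹))) := by
          refine lintegral_sphere_le (by fun_prop) fun x hx hx0 => ?_
          rw [indicator_of_mem (hcoord 0 x hx), ← ENNReal.ofReal_mul (by positivity)]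
          simp only [Pi.one_apply, one_mul]
          apply ENNReal.ofReal_le_ofReal
          rw [← mul_inv]
          apply inv_anti₀ (by positivity)
          have hx1 : 0 < ‖x‖ := norm_pos_iff.2 hx0
          have h1 : ‖v‖ ^ 2 - (inner ℝ (dir x : R3) v) ^ 2
              = ‖v‖ ^ 2 * (‖x‖⁻¹) ^ 2 * ((inner ℝ (e 1) x) ^ 2 + (inner ℝ (e 2) x) ^ 2) := by
            have h2 := norm_sq_eq_basis e x
            have h3 : inner ℝ (dir x : R3) v = ‖x‖⁻¹ * (‖v‖ * inner ℝ (e 0) x) := by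
              rw [coe_dir hx0]
              conv_lhs => rw [he]
              rw [inner_smul_left, inner_smul_right, real_inner_comm]
              simp
            rw [h3]
            have h4 : (inner ℝ (e 0) x) ^ 2 = ‖x‖ ^ 2 - ((inner ℝ (e 1) x) ^ 2 + (inner ℝ (e 2) x) ^ 2) := by
              rw [h2]; ring
            rw [mul_pow, mul_pow, h4]
            field_simp
            ring
          rw [h1]
          have : 1 ≤ ‖x‖⁻¹ := (one_le_inv₀ (norm_pos_iff.2 hx0)).2 hx.le
          have h2 : (1:ℝ) ≤ (‖x‖⁻¹) ^ 2 := one_le_pow₀ this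
          set r := (‖x‖⁻¹) ^ 2
          set p := inner ℝ (e 1) x
          set q := inner ℝ (e 2) x
          have h5 : ‖v‖ ^ 2 * (p ^ 2 + q ^ 2) ≤ ‖v‖ ^ 2 * r * (p ^ 2 + q ^ 2) := by
            have : 0 ≤ ‖v‖ ^ 2 * (p ^ 2 + q ^ 2) := by positivity
            nlinarith
          have h6 : (1 + ‖v‖ ^ 2 * (p ^ 2 + q ^ 2)) ^ 2 ≤ (1 + ‖v‖ ^ 2 * r * (p ^ 2 + q ^ 2)) ^ 2 := by
            gcongr
          refine le_trans ?_ h6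
          have h7 : 0 ≤ (‖v‖ * p) ^ 2 := by positivity
          have h8 : 0 ≤ (‖v‖ * q) ^ 2 := by positivity
          have h9 : ‖v‖ ^ 2 * (p ^ 2 + q ^ 2) = (‖v‖ * p) ^ 2 + (‖v‖ * q) ^ 2 := by ring
          rw [h9]
          nlinarith [mul_nonneg h7 h8]
      _ ≤ 3 * ∫⁻ x : R3, ((Icc (-1 : ℝ) 1).indicator 1 (inner ℝ (e 0) x) *
              (ENNReal.ofReal ((1 + (‖v‖ * (inner ℝ (e 1) x)) ^ 2)⁻¹) *
                ENNReal.ofReal ((1 + (‖v‖ * (inner ℝ (e 2) x)) ^ 2)⁻¹))) := by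
          gcongr; exact Measure.restrict_le_self
      _ = 3 * (2 * (ENNReal.ofReal (Real.pi / ‖v‖) * ENNReal.ofReal (Real.pi / ‖v‖))) := by
          rw [lintegral_orthonormalBasis e _ (fun p => ENNReal.ofReal ((1 + (‖v‖ * p) ^ 2)⁻¹))
            (fun p => ENNReal.ofReal ((1 + (‖v‖ * p) ^ 2)⁻¹))
            (measurable_one.indicator measurableSet_Icc) (by fun_prop) (by fun_prop),
            lintegral_inv_one_add_sq hv0,
            lintegral_indicator_one measurableSet_Icc, Real.volume_Icc]
          norm_num
      _ = ENNReal.ofReal (6 * (Real.pi / ‖v‖ * (Real.pi / ‖v‖))) := by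
          rw [ENNReal.ofReal_mul (by norm_num), ENNReal.ofReal_mul (by positivity)]
          rw [show ENNReal.ofReal 6 = 6 by simp]
          ring_nf
      _ ≤ _ := by
          apply ENNReal.ofReal_le_ofReal
          have : 6 * (Real.pi / ‖v‖ * (Real.pi / ‖v‖)) = (6 * Real.pi ^ 2) / ‖v‖ ^ 2 := by
            field_simp
          rw [this, div_le_div_iff₀ (by positivity) (by positivity)]
          have h1 : (1 + ‖v‖) ^ 2 ≤ 4 * ‖v‖ ^ 2 := by nlinarith
          have h2 : 0 ≤ Real.pi ^ 2 := sq_nonneg _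
          nlinarith [mul_le_mul_of_nonneg_left h1 h2, hm.2, mul_nonneg hm.2 (sq_nonneg ‖v‖), sq_nonneg ‖v‖]

end Boltzmann

/-! ### One-dimensional singular integrals against polynomial weights -/

namespace Boltzmann

theorem enn_rpow_le_rpow_of_nonpos {x y : ℝ≥0∞} {z : ℝ} (h : x ≤ y) (hz : z ≤ 0) :
    y ^ z ≤ x ^ z := by
  rw [← neg_neg z, ENNReal.rpow_neg y, ENNReal.rpow_neg x, ENNReal.inv_le_inv]
  exact ENNReal.rpow_le_rpow h (by linarith)

/-- The one-dimensional power `|y| ^ α`, equal to `∞` at the origin for `α < 0`. -/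
noncomputable def absPow (α y : ℝ) : ℝ≥0∞ := ENNReal.ofReal |y| ^ α

@[fun_prop]
theorem measurable_absPow (α : ℝ) : Measurable (absPow α) := by
  unfold absPow
  exact (ENNReal.measurable_ofReal.comp measurable_norm).pow_const α

theorem absPow_of_ne {α y : ℝ} (hy : y ≠ 0) : absPow α y = ENNReal.ofReal (|y| ^ α) :=
  ENNReal.ofReal_rpow_of_pos (abs_pos.2 hy)

theorem lintegral_absPow_near {α : ℝ} (hα : -1 < α) :
    ∫⁻ y : ℝ, (Metric.ball (0 : ℝ) 1).indicator (absPow α) y ≠ ∞ := by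
  have h : IntegrableOn (fun x : ℝ => ‖x‖ ^ α) (Metric.ball 0 1) volume := by
    refine (integrableOn_fun_norm_addHaar volume (f := fun y : ℝ => y ^ α)).2 ?_
    simp only [Module.finrank_self, tsub_self, pow_zero, one_smul]
    have := intervalIntegral.intervalIntegrable_rpow' (a := 0) (b := 1) hα
    rw [intervalIntegrable_iff_integrableOn_Ioo_of_le zero_le_one] at this
    exact this
  rw [lintegral_indicator measurableSet_ball]
  have h2 := h.lintegral_lt_top.ne
  convert h2 using 1
  apply lintegral_congr_ae
  have : ∀ᵐ x : ℝ ∂(volume.restrict (Metric.ball 0 1)), x ≠ 0 := ae_restrict_of_ae (by simp [ae_iff])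
  filter_upwards [this] with x hx
  rw [absPow_of_ne hx]; rfl

/-- Within distance 1 of the singularity the weight is at most X^{-m} and local integrability of the
power suffices. Farther away the power grows at most linearly in r = (X+|p|)/X because α ≤ 1, and m
≥ 3 still leaves r^{-2}, integrable at scale X. -/
theorem absPow_weight_le {α m X : ℝ} (hα1 : α ≤ 1) (hm : 3 ≤ m) (hX : 1 ≤ X)
    (y p : ℝ) :
    absPow α (y - p) * ENNReal.ofReal ((X + |p|) ^ (-m)) ≤
      ENNReal.ofReal (X ^ (-m)) * (Metric.ball (0 : ℝ) 1).indicator (absPow α) (y - p)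
      + ENNReal.ofReal ((X + |y|) ^ (max α 0) * X ^ (-m)) *
        ENNReal.ofReal ((1 + (X⁻¹ * p) ^ 2)⁻¹) := by
  have hX0 : 0 < X := by linarith
  by_cases h : y - p ∈ Metric.ball (0 : ℝ) 1
  · rw [indicator_of_mem h, mul_comm]
    refine le_trans ?_ le_self_add
    gcongr ENNReal.ofReal ?_ * _
    exact Real.rpow_le_rpow_of_nonpos hX0 (by linarith [abs_nonneg p]) (by linarith)
  · rw [indicator_of_notMem h, mul_zero, zero_add]
    have h1 : 1 ≤ |y - p| := by simpa using h
    have hne : y - p ≠ 0 := by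
      intro h0; rw [h0] at h1; simp at h1; linarith
    rw [absPow_of_ne hne, ← ENNReal.ofReal_mul (by positivity), ← ENNReal.ofReal_mul (by positivity)]
    apply ENNReal.ofReal_le_ofReal
    set r : ℝ := (X + |p|) / X with hr
    have hr1 : 1 ≤ r := by rw [hr, one_le_div hX0]; linarith [abs_nonneg p]
    have hr0 : 0 < r := by linarith
    have hXr : X + |p| = X * r := by rw [hr]; field_simp
    have h2 : |y - p| ^ α ≤ (X + |y|) ^ (max α 0) * r := by
      calc |y - p| ^ α ≤ |y - p| ^ (max α 0) := Real.rpow_le_rpow_of_exponent_le h1 (le_max_left _ _)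
        _ ≤ ((X + |y|) * r) ^ (max α 0) := by
            apply Real.rpow_le_rpow (abs_nonneg _) _ (le_max_right _ _)
            have h3 : |y - p| ≤ |y| + |p| := abs_sub _ _
            have h4 : (X + |y|) * r = X + |p| + |y| * r := by rw [add_mul, ← hXr]
            rw [h4]
            nlinarith [abs_nonneg y]
        _ = (X + |y|) ^ (max α 0) * r ^ (max α 0) := Real.mul_rpow (by positivity) hr0.le
        _ ≤ (X + |y|) ^ (max α 0) * r := by
            gcongr
            calc r ^ (max α 0) ≤ r ^ (1 : ℝ) :=
                  Real.rpow_le_rpow_of_exponent_le hr1 (max_le hα1 zero_le_one)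
              _ = r := Real.rpow_one r
    have h5 : r * (X + |p|) ^ (-m) ≤ X ^ (-m) * (1 + (X⁻¹ * p) ^ 2)⁻¹ := by
      rw [hXr, Real.mul_rpow hX0.le hr0.le]
      have h6 : r * r ^ (-m) ≤ (1 + (X⁻¹ * p) ^ 2)⁻¹ := by
        calc r * r ^ (-m) = r ^ (1 + -m) := by rw [Real.rpow_add hr0, Real.rpow_one]
          _ ≤ r ^ (-2 : ℝ) := Real.rpow_le_rpow_of_exponent_le hr1 (by linarith)
          _ = (r ^ 2)⁻¹ := by rw [Real.rpow_neg hr0.le]; norm_cast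
          _ ≤ _ := by
            apply inv_anti₀ (by positivity)
            have : r = 1 + X⁻¹ * |p| := by rw [hr]; field_simp
            rw [this, mul_pow, ← sq_abs p]
            have : 0 ≤ X⁻¹ * |p| := by positivity
            nlinarith
      calc _ = X ^ (-m) * (r * r ^ (-m)) := by ring
        _ ≤ _ := by gcongr
    calc |y - p| ^ α * (X + |p|) ^ (-m) ≤ ((X + |y|) ^ (max α 0) * r) * (X + |p|) ^ (-m) := by gcongr
      _ = (X + |y|) ^ (max α 0) * (r * (X + |p|) ^ (-m)) := by ring
      _ ≤ (X + |y|) ^ (max α 0) * (X ^ (-m) * (1 + (X⁻¹ * p) ^ 2)⁻¹) := by gcongr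
      _ = _ := by ring

/-- The factor X^{1-m} is the size X^{-m} of the weight times its width X. The constant depends on α
only, so one constant serves all exponents and all scales. -/
theorem lintegral_absPow_weight {α : ℝ} (hα : -1 < α) (hα1 : α ≤ 1) :
    ∃ C : ℝ, 1 ≤ C ∧ ∀ m X y : ℝ, 3 ≤ m → 1 ≤ X →
      ∫⁻ p : ℝ, absPow α (y - p) * ENNReal.ofReal ((X + |p|) ^ (-m))
        ≤ ENNReal.ofReal (C * X ^ (1 - m) * (X + |y|) ^ (max α 0)) := by
  set c := (∫⁻ y : ℝ, (Metric.ball (0 : ℝ) 1).indicator (absPow α) y).toReal with hc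
  have hcr : ∫⁻ y : ℝ, (Metric.ball (0 : ℝ) 1).indicator (absPow α) y = ENNReal.ofReal c :=
    (ENNReal.ofReal_toReal (lintegral_absPow_near hα)).symm
  have hc0 : 0 ≤ c := ENNReal.toReal_nonneg
  refine ⟨c + Real.pi + 1, by linarith [Real.pi_pos], fun m X y hm hX => ?_⟩
  have hX0 : 0 < X := by linarith
  have hmeas : Measurable ((Metric.ball (0 : ℝ) 1).indicator (absPow α)) :=
    (measurable_absPow α).indicator measurableSet_ball
  calc _ ≤ _ := lintegral_mono fun p => absPow_weight_le (y := y) hα1 hm hX p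
    _ = ENNReal.ofReal (X ^ (-m)) * ENNReal.ofReal c +
        ENNReal.ofReal ((X + |y|) ^ (max α 0) * X ^ (-m)) * ENNReal.ofReal (Real.pi / X⁻¹) := by
      rw [lintegral_add_right _ (by fun_prop), lintegral_const_mul _ (by fun_prop),
        lintegral_const_mul _ (by fun_prop),
        lintegral_sub_left_eq_self (fun x => (Metric.ball (0 : ℝ) 1).indicator (absPow α) x), hcr,
        lintegral_inv_one_add_sq (inv_pos.2 hX0)]
    _ = ENNReal.ofReal (X ^ (-m) * c + (X + |y|) ^ (max α 0) * X ^ (-m) * (Real.pi / X⁻¹)) := by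
      have := Real.pi_pos
      rw [← ENNReal.ofReal_mul (by positivity), ← ENNReal.ofReal_mul (by positivity),
        ← ENNReal.ofReal_add (by positivity) (by positivity)]
    _ ≤ _ := by
      apply ENNReal.ofReal_le_ofReal
      have h1 : X ^ (1 - m) = X * X ^ (-m) := by
        rw [sub_eq_add_neg, Real.rpow_add hX0, Real.rpow_one]
      have h2 : (1 : ℝ) ≤ (X + |y|) ^ (max α 0) :=
        Real.one_le_rpow (by linarith [abs_nonneg y]) (le_max_right _ _)
      rw [h1, div_inv_eq_mul]
      set P := X ^ (-m) with hP
      have hP0 : 0 ≤ P := by positivity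
      set Y := (X + |y|) ^ (max α 0)
      have h3 : P * c ≤ c * (X * P) * Y := by
        have : 1 ≤ X * Y := by nlinarith
        nlinarith [mul_nonneg hP0 hc0]
      have h4 : 0 ≤ (X * P) * Y := by positivity
      nlinarith

end Boltzmann

/-! ### The collision kernel in a frame adapted to ω -/

namespace Boltzmann

/-- The Grad cutoff hypothesis `0 ≤ b(θ) ≤ C |cos θ|` on the angular part of the kernel. -/
structure IsCutoff (b : ℝ → ℝ) (C : ℝ) : Prop where
  meas : Measurable b
  pos : 0 < C
  nonneg : ∀ θ ∈ Icc (0 : ℝ) Real.pi, 0 ≤ b θ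
  le : ∀ θ ∈ Icc (0 : ℝ) Real.pi, b θ ≤ C * |Real.cos θ|

theorem angle_mem (x y : R3) : InnerProductGeometry.angle x y ∈ Icc (0 : ℝ) Real.pi :=
  ⟨InnerProductGeometry.angle_nonneg _ _, InnerProductGeometry.angle_le_pi _ _⟩

theorem kernel_nonneg {b : ℝ → ℝ} {C : ℝ} (hb : IsCutoff b C) (γ : ℝ) (v u : R3) (ω : S2) :
    0 ≤ kernel γ b v u ω :=
  mul_nonneg (Real.rpow_nonneg (norm_nonneg _) _) (hb.nonneg _ (angle_mem _ _))

@[fun_prop]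
theorem measurable_angle : Measurable fun q : R3 × R3 => InnerProductGeometry.angle q.1 q.2 := by
  unfold InnerProductGeometry.angle
  exact Real.measurable_arccos.comp (by fun_prop)

theorem measurable_kernel {b : ℝ → ℝ} (hb : Measurable b) (γ : ℝ) :
    Measurable fun q : R3 × R3 × S2 => kernel γ b q.1 q.2.1 q.2.2 := by
  unfold kernel
  refine Measurable.mul (by fun_prop) (hb.comp ?_)
  exact measurable_angle.comp (f := fun q : R3 × R3 × S2 => (q.1 - q.2.1, (q.2.2 : R3)))
    (by fun_prop)

theorem measurable_kernel_comp {b : ℝ → ℝ} (hb : Measurable b) (γ : ℝ) {α : Type*}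
    [MeasurableSpace α] {f g : α → R3} {h : α → S2} (hf : Measurable f) (hg : Measurable g)
    (hh : Measurable h) : Measurable fun a => kernel γ b (f a) (g a) (h a) := by
  unfold kernel
  exact Measurable.mul (by fun_prop) (hb.comp (measurable_angle.comp
    (f := fun a => (f a - g a, (h a : R3))) (by fun_prop)))

@[fun_prop]
theorem measurable_vPost {α : Type*}
    [MeasurableSpace α] {f g : α → R3} {h : α → S2} (hf : Measurable f) (hg : Measurable g)
    (hh : Measurable h) : Measurable fun a => vPost (f a) (g a) (h a) := by
  unfold vPost; fun_prop

@[fun_prop]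
theorem measurable_uPost {α : Type*}
    [MeasurableSpace α] {f g : α → R3} {h : α → S2} (hf : Measurable f) (hg : Measurable g)
    (hh : Measurable h) : Measurable fun a => uPost (f a) (g a) (h a) := by
  unfold uPost; fun_prop

@[fun_prop]
theorem measurable_weight (k : ℝ) : Measurable (weight k) := by
  unfold weight; fun_prop

@[fun_prop]
theorem measurable_maxwellian : Measurable maxwellian := by
  unfold maxwellian; fun_prop

theorem weight_pos (k : ℝ) (v : R3) : 0 < weight k v := by unfold weight; positivity

theorem maxwellian_pos (v : R3) : 0 < maxwellian v := by unfold maxwellian; positivity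

theorem weight_add (k l : ℝ) (v : R3) : weight (k + l) v = weight k v * weight l v :=
  Real.rpow_add (by positivity) _ _

theorem weight_neg (k : ℝ) (v : R3) : weight (-k) v = (weight k v)⁻¹ :=
  Real.rpow_neg (by positivity) _

theorem weight_mono {k l : ℝ} (h : k ≤ l) (v : R3) : weight k v ≤ weight l v :=
  Real.rpow_le_rpow_of_exponent_le (by linarith [norm_nonneg v]) h

theorem weight_one (v : R3) : weight 1 v = 1 + ‖v‖ := Real.rpow_one _

theorem lintegral_duDω {F : R3 × S2 → ℝ≥0∞} (hF : Measurable F) :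
    ∫⁻ p, F p ∂duDω = ∫⁻ ω, ∫⁻ u, F (u, ω) ∂volume ∂(volume : Measure R3).toSphere :=
  lintegral_prod_symm' _ hF

/-- In a frame with first vector ω, v' = (u₀, v₁, v₂) and u' = (v₀, u₁, u₂): a collision exchanges
first coordinates. All later separation of variables rests on this. -/
theorem inner_vPost {e : OrthonormalBasis (Fin 3) ℝ R3} {ω : S2} (he : e 0 = ω) (v u : R3)
    (i : Fin 3) :
    inner ℝ (e i) (vPost v u ω) = if i = 0 then inner ℝ (e 0) u else inner ℝ (e i) v := by
  unfold vPost
  rw [← he, inner_sub_right, inner_smul_right, real_inner_comm (e 0), inner_sub_right]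
  have := orthonormal_iff_ite.1 e.orthonormal i 0
  rw [this]
  split_ifs with h
  · rw [h]; ring
  · ring

theorem inner_uPost {e : OrthonormalBasis (Fin 3) ℝ R3} {ω : S2} (he : e 0 = ω) (v u : R3)
    (i : Fin 3) :
    inner ℝ (e i) (uPost v u ω) = if i = 0 then inner ℝ (e 0) v else inner ℝ (e i) u := by
  unfold uPost
  rw [← he, inner_add_right, inner_smul_right, real_inner_comm (e 0), inner_sub_right]
  have := orthonormal_iff_ite.1 e.orthonormal i 0
  rw [this]
  split_ifs with h
  · rw [h]; ring
  · ring

theorem norm_vPost_sq {e : OrthonormalBasis (Fin 3) ℝ R3} {ω : S2} (he : e 0 = ω) (v u : R3) :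
    ‖vPost v u ω‖ ^ 2 = inner ℝ (e 0) u ^ 2 + inner ℝ (e 1) v ^ 2 + inner ℝ (e 2) v ^ 2 := by
  rw [norm_sq_eq_basis e, inner_vPost he, inner_vPost he, inner_vPost he]; simp

theorem norm_uPost_sq {e : OrthonormalBasis (Fin 3) ℝ R3} {ω : S2} (he : e 0 = ω) (v u : R3) :
    ‖uPost v u ω‖ ^ 2 = inner ℝ (e 0) v ^ 2 + inner ℝ (e 1) u ^ 2 + inner ℝ (e 2) u ^ 2 := by
  rw [norm_sq_eq_basis e, inner_uPost he, inner_uPost he, inner_uPost he]; simp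

theorem norm_post_sq (v u : R3) (ω : S2) :
    ‖vPost v u ω‖ ^ 2 + ‖uPost v u ω‖ ^ 2 = ‖v‖ ^ 2 + ‖u‖ ^ 2 := by
  obtain ⟨e, he⟩ := exists_orthonormalBasis_sphere ω
  rw [norm_vPost_sq he, norm_uPost_sq he, norm_sq_eq_basis e v, norm_sq_eq_basis e u]; ring

theorem maxwellian_post (v u : R3) (ω : S2) :
    maxwellian (uPost v u ω) * maxwellian (vPost v u ω) = maxwellian u * maxwellian v := by
  unfold maxwellian
  have h := norm_post_sq v u ω
  have : Real.exp (-‖uPost v u ω‖ ^ 2 / 2) * Real.exp (-‖vPost v u ω‖ ^ 2 / 2)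
      = Real.exp (-‖u‖ ^ 2 / 2) * Real.exp (-‖v‖ ^ 2 / 2) := by
    rw [← Real.exp_add, ← Real.exp_add]; congr 1; linarith
  linear_combination ((2 * Real.pi) ^ (-(3 / 2) : ℝ)) ^ 2 * this

/-- Pointwise bound of the collision kernel by a product of one-dimensional powers. -/
theorem kernel_le {b : ℝ → ℝ} {C : ℝ} (hb : IsCutoff b C) {γ α β : ℝ} (hα : α ≤ 1) (hβ : β ≤ 0)
    (hγ : α + β + β = γ) {e : OrthonormalBasis (Fin 3) ℝ R3} {ω : S2} (he : e 0 = ω) (v u : R3) :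
    ENNReal.ofReal (kernel γ b v u ω) ≤ ENNReal.ofReal C *
      (absPow α (inner ℝ (e 0) v - inner ℝ (e 0) u) *
        (absPow β (inner ℝ (e 1) v - inner ℝ (e 1) u) *
          absPow β (inner ℝ (e 2) v - inner ℝ (e 2) u))) := by
  set s := inner ℝ (e 0) v - inner ℝ (e 0) u with hs
  have hω : ‖(ω : R3)‖ = 1 := norm_eq_of_mem_sphere ω
  have hs' : inner ℝ (v - u) (ω : R3) = s := by
    rw [← he, real_inner_comm, inner_sub_right]
  have hcos : Real.cos (InnerProductGeometry.angle (v - u) (ω : R3)) = s / ‖v - u‖ := by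
    rw [InnerProductGeometry.cos_angle, hω, mul_one, hs']
  have hle := hb.le _ (angle_mem (v - u) ω)
  rw [hcos] at hle
  -- If v - u is orthogonal to ω the cutoff makes the kernel vanish; this case is split off because
  -- the laws of exponents used below need a nonzero base.
  by_cases hs0 : s = 0
  · have : kernel γ b v u ω ≤ 0 := by
      unfold kernel
      rw [hs0] at hle
      simp only [zero_div, abs_zero, mul_zero] at hle
      exact mul_nonpos_of_nonneg_of_nonpos (Real.rpow_nonneg (norm_nonneg _) _) hle
    rw [ENNReal.ofReal_of_nonpos this]
    exact bot_le
  have hle1 : ∀ i : Fin 3, |inner ℝ (e i) v - inner ℝ (e i) u| ≤ ‖v - u‖ := by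
    intro i
    have := abs_real_inner_le_norm (e i) (v - u)
    rwa [e.norm_eq_one, one_mul, inner_sub_right] at this
  have hz : 0 < ‖v - u‖ := (abs_pos.2 hs0).trans_le (hle1 0)
  -- The factor |cos θ| = |s|/|v-u| lowers the exponent of |v-u| to γ - 1 = (α-1)+β+β. All three
  -- parts are nonpositive, so in each of them |v-u| may be replaced by one coordinate difference,
  -- and |s| restores the exponent α.
  have h1 : kernel γ b v u ω ≤ C * (|s| * ‖v - u‖ ^ (γ - 1)) := by
    unfold kernel
    calc _ ≤ ‖v - u‖ ^ γ * (C * |s / ‖v - u‖|) := by gcongr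
      _ = _ := by
        rw [abs_div, abs_of_pos hz, Real.rpow_sub_one hz.ne']; field_simp
  refine (ENNReal.ofReal_le_ofReal h1).trans ?_
  rw [ENNReal.ofReal_mul hb.pos.le, ENNReal.ofReal_mul (abs_nonneg _)]
  gcongr ENNReal.ofReal C * ?_
  have hz0 : ENNReal.ofReal ‖v - u‖ ≠ 0 := by simpa using hz
  have hst : ENNReal.ofReal |s| ≠ 0 := by simpa using hs0
  rw [← ENNReal.ofReal_rpow_of_pos hz, show γ - 1 = (α - 1) + (β + β) by linarith,
    ENNReal.rpow_add _ _ hz0 ENNReal.ofReal_ne_top, ENNReal.rpow_add _ _ hz0 ENNReal.ofReal_ne_top,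
    ← mul_assoc]
  have h2 : absPow α s = ENNReal.ofReal |s| * ENNReal.ofReal |s| ^ (α - 1) := by
    unfold absPow
    conv_lhs => rw [show α = 1 + (α - 1) by ring, ENNReal.rpow_add _ _ hst ENNReal.ofReal_ne_top, ENNReal.rpow_one]
  rw [h2]
  unfold absPow
  have h3 : ∀ i : Fin 3, ∀ z : ℝ, z ≤ 0 → ENNReal.ofReal ‖v - u‖ ^ z ≤
      ENNReal.ofReal |inner ℝ (e i) v - inner ℝ (e i) u| ^ z := fun i z hz =>
    enn_rpow_le_rpow_of_nonpos (ENNReal.ofReal_le_ofReal (hle1 i)) hz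
  rw [mul_assoc]
  refine (mul_le_mul_right ((mul_le_mul' (h3 0 (α - 1) (by linarith))
    (mul_le_mul' (h3 1 _ hβ) (h3 2 _ hβ)))) _).trans (mul_assoc _ _ _).symm.le

/-- Separation of variables in the `u`-integral of the kernel against a dominated function. -/
theorem lintegral_kernel_mul_le {b : ℝ → ℝ} {C : ℝ} (hb : IsCutoff b C) {γ α β : ℝ} (hα : α ≤ 1)
    (hβ : β ≤ 0) (hγ : α + β + β = γ) {e : OrthonormalBasis (Fin 3) ℝ R3} {ω : S2}
    (he : e 0 = ω) (v : R3) {W : R3 → ℝ≥0∞} {f g h : ℝ → ℝ≥0∞} (hf : Measurable f)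
    (hg : Measurable g) (hh : Measurable h)
    (hW : ∀ u, W u ≤ f (inner ℝ (e 0) u) * (g (inner ℝ (e 1) u) * h (inner ℝ (e 2) u))) :
    ∫⁻ u, ENNReal.ofReal (kernel γ b v u ω) * W u ≤ ENNReal.ofReal C *
      ((∫⁻ p, absPow α (inner ℝ (e 0) v - p) * f p) *
        ((∫⁻ p, absPow β (inner ℝ (e 1) v - p) * g p) *
          ∫⁻ p, absPow β (inner ℝ (e 2) v - p) * h p)) := by
  rw [← lintegral_orthonormalBasis e (fun p => absPow α (inner ℝ (e 0) v - p) * f p)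
    (fun p => absPow β (inner ℝ (e 1) v - p) * g p)
    (fun p => absPow β (inner ℝ (e 2) v - p) * h p) (by fun_prop) (by fun_prop) (by fun_prop),
    ← lintegral_const_mul _ (by fun_prop)]
  refine lintegral_mono fun u => ?_
  refine (mul_le_mul' (kernel_le hb hα hβ hγ he v u) (hW u)).trans (le_of_eq ?_)
  ring

end Boltzmann

/-! ### Collision integrals of polynomial weights -/

namespace Boltzmann

theorem weight_neg_le_of_le {l r X : ℝ} (hl : 0 ≤ l) {c : ℝ} (hc : 0 < c) (hX : 0 < X) {v : R3}
    (h : X ≤ c * (1 + ‖v‖)) (hr : c ^ l ≤ r) : weight (-l) v ≤ r * X ^ (-l) := by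
  unfold weight
  have h1 : 0 < 1 + ‖v‖ := by positivity
  have h2 : (c * (1 + ‖v‖)) ^ (-l) ≤ X ^ (-l) := Real.rpow_le_rpow_of_nonpos hX h (by linarith)
  rw [Real.mul_rpow hc.le h1.le] at h2
  have h3 : 0 < c ^ l := by positivity
  have h4 : (1 + ‖v‖) ^ (-l) = c ^ l * (c ^ (-l) * (1 + ‖v‖) ^ (-l)) := by
    rw [← mul_assoc, ← Real.rpow_add hc]; simp
  rw [h4]
  exact mul_le_mul hr h2 (by positivity) (h3.le.trans hr)

theorem weight_neg_le_prod {v : R3} {x y z : ℝ} (hx0 : 0 ≤ x) (hy0 : 0 ≤ y)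
    (hz0 : 0 ≤ z) (hx : x ≤ ‖v‖) (hy : y ≤ ‖v‖) (hz : z ≤ ‖v‖) {p q r : ℝ} (hp : 0 ≤ p)
    (hq : 0 ≤ q) (hr : 0 ≤ r) :
    weight (-(p + q + r)) v ≤ (1 + x) ^ (-p) * ((1 + y) ^ (-q) * (1 + z) ^ (-r)) := by
  unfold weight
  have h1 : 0 < 1 + ‖v‖ := by positivity
  rw [show -(p + q + r) = -p + (-q + -r) by ring, Real.rpow_add h1, Real.rpow_add h1]
  have key : ∀ t m : ℝ, 0 ≤ t → t ≤ ‖v‖ → 0 ≤ m → (1 + ‖v‖) ^ (-m) ≤ (1 + t) ^ (-m) :=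
    fun t m ht h hm => Real.rpow_le_rpow_of_nonpos (by linarith) (by linarith) (by linarith)
  have := key x p hx0 hx hp
  have := key y q hy0 hy hq
  have := key z r hz0 hz hr
  gcongr

theorem abs_le_norm_of_sq {x : ℝ} {v : R3} (h : x ^ 2 ≤ ‖v‖ ^ 2) : |x| ≤ ‖v‖ :=
  abs_le_of_sq_le_sq h (norm_nonneg v)

/-- When the part of v orthogonal to ω dominates, v' retains it, so |v| ≤ 2|v'| and v' supplies the
decay in |v| and in u₀. The weight at u' is shared out: two powers for v₀, kept for the integration
over ω, and (l-2)/2 ≥ 3 powers for each of u₁ and u₂. -/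
theorem weights_post_le_of_perp {l : ℝ} (hl : 8 ≤ l) {e : OrthonormalBasis (Fin 3) ℝ R3} {ω : S2}
    (he : e 0 = ω) (v : R3) (hca : (inner ℝ (e 0) v) ^ 2 ≤ ‖v‖ ^ 2 - (inner ℝ (e 0) v) ^ 2) (u : R3) :
    weight (-l) (uPost v u ω) * weight (-l) (vPost v u ω) ≤
      (3 ^ l * (1 + (inner ℝ (e 0) v) ^ 2)⁻¹) * (1 + ‖v‖ + |inner ℝ (e 0) u|) ^ (-l) *
        ((1 + |inner ℝ (e 1) u|) ^ (-((l - 2) / 2)) *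
         (1 + |inner ℝ (e 2) u|) ^ (-((l - 2) / 2))) := by
  have hU := norm_uPost_sq he v u
  have hV := norm_vPost_sq he v u
  have hv2 := norm_sq_eq_basis e v
  set v0 := inner ℝ (e 0) v
  set u0 := inner ℝ (e 0) u
  have s0 := sq_nonneg u0
  have s1 := sq_nonneg (inner ℝ (e 1) u)
  have s2 := sq_nonneg (inner ℝ (e 2) u)
  have s3 := sq_nonneg v0
  have s4 := sq_nonneg (inner ℝ (e 1) v)
  have s5 := sq_nonneg (inner ℝ (e 2) v)
  have h1 : weight (-l) (uPost v u ω) ≤ (1 + v0 ^ 2)⁻¹ *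
      ((1 + |inner ℝ (e 1) u|) ^ (-((l - 2) / 2)) *
     (1 + |inner ℝ (e 2) u|) ^ (-((l - 2) / 2))) := by
    have := weight_neg_le_prod (v := uPost v u ω) (abs_nonneg v0) (abs_nonneg (inner ℝ (e 1) u))
      (abs_nonneg (inner ℝ (e 2) u)) (abs_le_norm_of_sq (by rw [hU]; linarith))
      (abs_le_norm_of_sq (by rw [hU]; linarith)) (abs_le_norm_of_sq (by rw [hU]; linarith))
      (p := 2) (q := (l - 2) / 2) (r := (l - 2) / 2) (by norm_num) (by linarith) (by linarith)
    rw [show 2 + (l - 2) / 2 + (l - 2) / 2 = l by ring] at this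
    refine this.trans ?_
    gcongr
    rw [Real.rpow_neg (by positivity)]
    apply inv_anti₀ (by positivity)
    rw [← sq_abs v0]
    norm_cast
    have := abs_nonneg v0
    rw [add_sq]; linarith
  have h2 : weight (-l) (vPost v u ω) ≤ 3 ^ l * (1 + ‖v‖ + |u0|) ^ (-l) := by
    refine weight_neg_le_of_le (by linarith) (by norm_num) (by positivity) ?_ le_rfl
    have h3 : |u0| ≤ ‖vPost v u ω‖ := abs_le_norm_of_sq (by rw [hV]; linarith)
    have h4 : ‖v‖ ≤ 2 * ‖vPost v u ω‖ := by
      apply le_of_sq_le_sq _ (by positivity)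
      rw [mul_pow, hV]; linarith
    have := norm_nonneg (vPost v u ω)
    linarith
  have w1 := (weight_pos (-l) (uPost v u ω)).le
  have w2 := (weight_pos (-l) (vPost v u ω)).le
  calc _ ≤ _ := mul_le_mul h1 h2 w2 (by positivity)
    _ = _ := by ring

/-- The mirror case: v₀ dominates and is passed on to u', whose weight supplies the decay in |v|,
half of it with u₁ and half with u₂. The weight at v' gives four powers of the orthogonal part of v,
kept for the integration over ω, and l-4 powers of u₀. -/
theorem weights_post_le_of_parallel {l : ℝ} (hl : 8 ≤ l) {e : OrthonormalBasis (Fin 3) ℝ R3}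
    {ω : S2} (he : e 0 = ω) (v : R3)
    (hca : ‖v‖ ^ 2 - (inner ℝ (e 0) v) ^ 2 ≤ (inner ℝ (e 0) v) ^ 2) (u : R3) :
    weight (-l) (uPost v u ω) * weight (-l) (vPost v u ω) ≤
      (3 ^ l * ((1 + (‖v‖ ^ 2 - (inner ℝ (e 0) v) ^ 2)) ^ 2)⁻¹) *
          (1 + |inner ℝ (e 0) u|) ^ (-(l - 4)) *
        ((1 + ‖v‖ + |inner ℝ (e 1) u|) ^ (-(l / 2)) *
         (1 + ‖v‖ + |inner ℝ (e 2) u|) ^ (-(l / 2))) := by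
  have hU := norm_uPost_sq he v u
  have hV := norm_vPost_sq he v u
  have hv2 := norm_sq_eq_basis e v
  set v0 := inner ℝ (e 0) v
  set u0 := inner ℝ (e 0) u
  have s0 := sq_nonneg u0
  have s1 := sq_nonneg (inner ℝ (e 1) u)
  have s2 := sq_nonneg (inner ℝ (e 2) u)
  have s3 := sq_nonneg v0
  have s4 := sq_nonneg (inner ℝ (e 1) v)
  have s5 := sq_nonneg (inner ℝ (e 2) v)
  have hva : ‖v‖ ^ 2 - v0 ^ 2 = inner ℝ (e 1) v ^ 2 + inner ℝ (e 2) v ^ 2 := by rw [hv2]; ring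
  set a2 := ‖v‖ ^ 2 - v0 ^ 2
  have ha0 : 0 ≤ a2 := by rw [hva]; positivity
  have h1 : weight (-l) (vPost v u ω) ≤ ((1 + a2) ^ 2)⁻¹ * (1 + |u0|) ^ (-(l - 4)) := by
    have h3 : √a2 ≤ ‖vPost v u ω‖ := by
      apply Real.sqrt_le_iff.2 ⟨norm_nonneg _, _⟩
      rw [hV, hva]; linarith
    have := weight_neg_le_prod (v := vPost v u ω) (Real.sqrt_nonneg a2)
      (abs_nonneg u0) le_rfl h3
      (abs_le_norm_of_sq (by rw [hV]; linarith)) (norm_nonneg _)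
      (p := 4) (q := l - 4) (r := 0) (by norm_num) (by linarith) le_rfl
    rw [show 4 + (l - 4) + 0 = l by ring] at this
    refine this.trans ?_
    simp only [neg_zero, Real.rpow_zero, mul_one]
    gcongr
    rw [Real.rpow_neg (by positivity)]
    apply inv_anti₀ (by positivity)
    have h5 : 1 + a2 ≤ (1 + √a2) ^ 2 := by
      have := Real.sq_sqrt ha0
      have := Real.sqrt_nonneg a2
      rw [add_sq]; linarith
    calc (1 + a2) ^ 2 ≤ ((1 + √a2) ^ 2) ^ 2 := by gcongr
      _ = _ := by rw [← pow_mul]; norm_cast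
  have hsplit : weight (-l) (uPost v u ω)
      = weight (-(l / 2)) (uPost v u ω) * weight (-(l / 2)) (uPost v u ω) := by
    rw [← weight_add]; congr 1; ring
  have h2 : ∀ x : ℝ, x ^ 2 ≤ ‖uPost v u ω‖ ^ 2 →
      weight (-(l / 2)) (uPost v u ω) ≤ 3 ^ (l / 2) * (1 + ‖v‖ + |x|) ^ (-(l / 2)) := by
    intro x hx
    refine weight_neg_le_of_le (by linarith) (by norm_num) (by positivity) ?_ le_rfl
    have h3 : |x| ≤ ‖uPost v u ω‖ := abs_le_norm_of_sq hx
    have h4 : ‖v‖ ≤ 2 * ‖uPost v u ω‖ := by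
      apply le_of_sq_le_sq _ (by positivity)
      rw [mul_pow, hU]; linarith
    have := norm_nonneg (uPost v u ω)
    linarith
  have h21 := h2 (inner ℝ (e 1) u) (by rw [hU]; linarith)
  have h22 := h2 (inner ℝ (e 2) u) (by rw [hU]; linarith)
  have w1 := (weight_pos (-(l / 2)) (uPost v u ω)).le
  have w2 := (weight_pos (-l) (vPost v u ω)).le
  rw [hsplit]
  calc _ ≤ _ := mul_le_mul (mul_le_mul h21 h22 w1 (by positivity)) h1 w2 (by positivity)
    _ = _ := by
      rw [show (3 : ℝ) ^ l = 3 ^ (l / 2) * 3 ^ (l / 2) by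
        rw [← Real.rpow_add (by norm_num)]; congr 1; ring]
      ring

theorem abs_inner_basis_le (e : OrthonormalBasis (Fin 3) ℝ R3) (i : Fin 3) (v : R3) :
    |inner ℝ (e i) v| ≤ ‖v‖ := by
  have := abs_real_inner_le_norm (e i) v
  rwa [e.norm_eq_one, one_mul] at this

/-- Integrating (1+|v|+|u₀|)^{-l} in u₀ costs one power of 1+|v|. It is displayed next to
(1+(v·ω)²)^{-1}, whose integral over the sphere repays it. -/
theorem lintegral_kernel_weights_perp {b : ℝ → ℝ} {C : ℝ} (hb : IsCutoff b C) {γ α β : ℝ}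
    (hα0 : -1 < α) (hα : α ≤ 1) (hβ0 : -1 < β) (hβ : β ≤ 0) (hγ : α + β + β = γ) {l : ℝ}
    (hl : 8 ≤ l) : ∃ K : ℝ, 0 < K ∧ ∀ (v : R3) (ω : S2),
      (inner ℝ (ω : R3) v) ^ 2 ≤ ‖v‖ ^ 2 - (inner ℝ (ω : R3) v) ^ 2 →
      ∫⁻ u, ENNReal.ofReal (kernel γ b v u ω) *
          ENNReal.ofReal (weight (-l) (uPost v u ω) * weight (-l) (vPost v u ω))
        ≤ ENNReal.ofReal (K * (1 + ‖v‖) ^ (max α 0 - l)) *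
          ENNReal.ofReal ((1 + ‖v‖) * (1 + (inner ℝ (ω : R3) v) ^ 2)⁻¹) := by
  obtain ⟨A, hA1, hA⟩ := lintegral_absPow_weight hα0 hα
  obtain ⟨B, hB1, hB⟩ := lintegral_absPow_weight hβ0 (hβ.trans zero_le_one)
  have hC := hb.pos
  have hA0 : 0 < A := by linarith
  have hB0 : 0 < B := by linarith
  have hβm : max β 0 = 0 := max_eq_right hβ
  have hαm1 : max α 0 ≤ 1 := max_le hα zero_le_one
  have hαm0 : 0 ≤ max α 0 := le_max_right _ _
  refine ⟨C * 3 ^ l * A * B * B * 2, by positivity, fun v ω hca => ?_⟩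
  obtain ⟨e, he⟩ := exists_orthonormalBasis_sphere ω
  rw [← he] at hca ⊢
  have hW := weights_post_le_of_perp hl he v hca
  have hv0X := abs_inner_basis_le e 0 v
  set X := 1 + ‖v‖ with hX
  have hX1 : 1 ≤ X := by linarith [norm_nonneg v]
  have hX0 : 0 < X := by linarith
  set v0 := inner ℝ (e 0) v with hv0
  refine (lintegral_kernel_mul_le hb hα hβ hγ he v
    (f := fun p => ENNReal.ofReal (3 ^ l * (1 + v0 ^ 2)⁻¹) * ENNReal.ofReal ((X + |p|) ^ (-l)))
    (g := fun p => ENNReal.ofReal ((1 + |p|) ^ (-((l - 2) / 2))))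
    (h := fun p => ENNReal.ofReal ((1 + |p|) ^ (-((l - 2) / 2))))
    (by fun_prop) (by fun_prop) (by fun_prop) ?_).trans ?_
  · intro u
    rw [← ENNReal.ofReal_mul (by positivity), ← ENNReal.ofReal_mul (by positivity),
      ← ENNReal.ofReal_mul (by positivity)]
    exact ENNReal.ofReal_le_ofReal (hW u)
  have i1 : ∫⁻ p, absPow α (v0 - p) * (ENNReal.ofReal (3 ^ l * (1 + v0 ^ 2)⁻¹) *
      ENNReal.ofReal ((X + |p|) ^ (-l)))
      ≤ ENNReal.ofReal (3 ^ l * (1 + v0 ^ 2)⁻¹) *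
        ENNReal.ofReal (A * X ^ (1 - l) * (2 * X ^ (max α 0))) := by
    calc _ = ENNReal.ofReal (3 ^ l * (1 + v0 ^ 2)⁻¹) *
          ∫⁻ p, absPow α (v0 - p) * ENNReal.ofReal ((X + |p|) ^ (-l)) := by
          rw [← lintegral_const_mul _ (by fun_prop)]
          refine lintegral_congr fun p => ?_
          ring
      _ ≤ _ := by
          gcongr
          refine (hA l X v0 (by linarith) hX1).trans (ENNReal.ofReal_le_ofReal ?_)
          gcongr
          calc (X + |v0|) ^ max α 0 ≤ (2 * X) ^ max α 0 := by gcongr; linarith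
            _ = 2 ^ max α 0 * X ^ max α 0 := Real.mul_rpow (by norm_num) hX0.le
            _ ≤ 2 ^ (1:ℝ) * X ^ max α 0 := by gcongr; norm_num
            _ = _ := by norm_num
  have i2 : ∀ y : ℝ, ∫⁻ p, absPow β (y - p) * ENNReal.ofReal ((1 + |p|) ^ (-((l - 2) / 2)))
      ≤ ENNReal.ofReal B := by
    intro y
    refine (hB ((l - 2) / 2) 1 y (by linarith) le_rfl).trans (ENNReal.ofReal_le_ofReal ?_)
    rw [hβm]; simp
  calc _ ≤ ENNReal.ofReal C * (_ * (ENNReal.ofReal B * ENNReal.ofReal B)) :=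
        mul_le_mul_right (mul_le_mul' i1 (mul_le_mul' (i2 _) (i2 _))) _
    _ = _ := by
        rw [← ENNReal.ofReal_mul (by positivity), ← ENNReal.ofReal_mul (by positivity),
          ← ENNReal.ofReal_mul (by positivity), ← ENNReal.ofReal_mul (by positivity),
          ← ENNReal.ofReal_mul (by positivity)]
        congr 1
        rw [sub_eq_add_neg, Real.rpow_add hX0, sub_eq_add_neg, Real.rpow_add hX0, Real.rpow_one]
        ring

/-- Here the integrals in u₁ and u₂ cost one power of 1+|v| each; the accompanying function of ω is
concentrated near ±v and repays both. -/
theorem lintegral_kernel_weights_parallel {b : ℝ → ℝ} {C : ℝ} (hb : IsCutoff b C) {γ α β : ℝ}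
    (hα0 : -1 < α) (hα : α ≤ 1) (hβ0 : -1 < β) (hβ : β ≤ 0) (hγ : α + β + β = γ) {l : ℝ}
    (hl : 8 ≤ l) : ∃ K : ℝ, 0 < K ∧ ∀ (v : R3) (ω : S2),
      ‖v‖ ^ 2 - (inner ℝ (ω : R3) v) ^ 2 ≤ (inner ℝ (ω : R3) v) ^ 2 →
      ∫⁻ u, ENNReal.ofReal (kernel γ b v u ω) *
          ENNReal.ofReal (weight (-l) (uPost v u ω) * weight (-l) (vPost v u ω))
        ≤ ENNReal.ofReal (K * (1 + ‖v‖) ^ (max α 0 - l)) *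
          ENNReal.ofReal ((1 + ‖v‖) ^ 2 *
            ((1 + (‖v‖ ^ 2 - (inner ℝ (ω : R3) v) ^ 2)) ^ 2)⁻¹) := by
  obtain ⟨A, hA1, hA⟩ := lintegral_absPow_weight hα0 hα
  obtain ⟨B, hB1, hB⟩ := lintegral_absPow_weight hβ0 (hβ.trans zero_le_one)
  have hC := hb.pos
  have hA0 : 0 < A := by linarith
  have hB0 : 0 < B := by linarith
  have hβm : max β 0 = 0 := max_eq_right hβ
  have hαm1 : max α 0 ≤ 1 := max_le hα zero_le_one
  have hαm0 : 0 ≤ max α 0 := le_max_right _ _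
  refine ⟨C * 3 ^ l * A * B * B, by positivity, fun v ω hca => ?_⟩
  obtain ⟨e, he⟩ := exists_orthonormalBasis_sphere ω
  rw [← he] at hca ⊢
  have hW := weights_post_le_of_parallel hl he v hca
  have hv0X := abs_inner_basis_le e 0 v
  have ha0 : 0 ≤ ‖v‖ ^ 2 - (inner ℝ (e 0) v) ^ 2 := by
    rw [← sq_abs (inner ℝ (e 0) v)]
    have := pow_le_pow_left₀ (abs_nonneg _) hv0X 2
    linarith
  set X := 1 + ‖v‖ with hX
  have hX1 : 1 ≤ X := by linarith [norm_nonneg v]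
  have hX0 : 0 < X := by linarith
  set v0 := inner ℝ (e 0) v with hv0
  set a2 := ‖v‖ ^ 2 - v0 ^ 2
  refine (lintegral_kernel_mul_le hb hα hβ hγ he v
    (f := fun p => ENNReal.ofReal (3 ^ l * ((1 + a2) ^ 2)⁻¹) *
      ENNReal.ofReal ((1 + |p|) ^ (-(l - 4))))
    (g := fun p => ENNReal.ofReal ((X + |p|) ^ (-(l / 2))))
    (h := fun p => ENNReal.ofReal ((X + |p|) ^ (-(l / 2))))
    (by fun_prop) (by fun_prop) (by fun_prop) ?_).trans ?_
  · intro u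
    rw [← ENNReal.ofReal_mul (by positivity), ← ENNReal.ofReal_mul (by positivity),
      ← ENNReal.ofReal_mul (by positivity)]
    exact ENNReal.ofReal_le_ofReal (hW u)
  have i1 : ∫⁻ p, absPow α (v0 - p) * (ENNReal.ofReal (3 ^ l * ((1 + a2) ^ 2)⁻¹) *
      ENNReal.ofReal ((1 + |p|) ^ (-(l - 4))))
      ≤ ENNReal.ofReal (3 ^ l * ((1 + a2) ^ 2)⁻¹) * ENNReal.ofReal (A * X ^ (max α 0)) := by
    calc _ = ENNReal.ofReal (3 ^ l * ((1 + a2) ^ 2)⁻¹) *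
          ∫⁻ p, absPow α (v0 - p) * ENNReal.ofReal ((1 + |p|) ^ (-(l - 4))) := by
          rw [← lintegral_const_mul _ (by fun_prop)]
          refine lintegral_congr fun p => ?_
          ring
      _ ≤ _ := by
          gcongr
          refine (hA (l - 4) 1 v0 (by linarith) le_rfl).trans (ENNReal.ofReal_le_ofReal ?_)
          rw [Real.one_rpow, mul_one]
          gcongr
          linarith
  have i2 : ∀ y : ℝ, ∫⁻ p, absPow β (y - p) * ENNReal.ofReal ((X + |p|) ^ (-(l / 2)))
      ≤ ENNReal.ofReal (B * X ^ (1 - l / 2)) := by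
    intro y
    refine (hB (l / 2) X y (by linarith) hX1).trans (ENNReal.ofReal_le_ofReal ?_)
    rw [hβm]; simp
  calc _ ≤ ENNReal.ofReal C * (_ * (ENNReal.ofReal (B * X ^ (1 - l / 2)) *
          ENNReal.ofReal (B * X ^ (1 - l / 2)))) :=
        mul_le_mul_right (mul_le_mul' i1 (mul_le_mul' (i2 _) (i2 _))) _
    _ = _ := by
        rw [← ENNReal.ofReal_mul (by positivity), ← ENNReal.ofReal_mul (by positivity),
          ← ENNReal.ofReal_mul (by positivity), ← ENNReal.ofReal_mul (by positivity),
          ← ENNReal.ofReal_mul (by positivity)]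
        congr 1
        have : X ^ (1 - l / 2) * X ^ (1 - l / 2) = X ^ 2 * X ^ (-l) := by
          rw [← Real.rpow_add hX0, ← Real.rpow_natCast, ← Real.rpow_add hX0]
          congr 1; push_cast; ring
        rw [sub_eq_add_neg (max α 0), Real.rpow_add hX0]
        linear_combination C * (3 ^ l * ((1 + a2) ^ 2)⁻¹ * (A * X ^ (max α 0)) * (B * B)) * this

/-- For fixed `ω`, the `u`-integral of the kernel against two weights. -/
theorem lintegral_kernel_weights_slice {b : ℝ → ℝ} {C : ℝ} (hb : IsCutoff b C) {γ α β : ℝ}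
    (hα0 : -1 < α) (hα : α ≤ 1) (hβ0 : -1 < β) (hβ : β ≤ 0) (hγ : α + β + β = γ) {l : ℝ}
    (hl : 8 ≤ l) : ∃ K : ℝ, 0 < K ∧ ∀ (v : R3) (ω : S2),
      ∫⁻ u, ENNReal.ofReal (kernel γ b v u ω) *
          ENNReal.ofReal (weight (-l) (uPost v u ω) * weight (-l) (vPost v u ω))
        ≤ ENNReal.ofReal (K * (1 + ‖v‖) ^ (max α 0 - l)) *
          (ENNReal.ofReal ((1 + ‖v‖) * (1 + (inner ℝ (ω : R3) v) ^ 2)⁻¹) +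
           ENNReal.ofReal ((1 + ‖v‖) ^ 2 * ((1 + (‖v‖ ^ 2 - (inner ℝ (ω : R3) v) ^ 2)) ^ 2)⁻¹)) := by
  obtain ⟨K1, hK1, h1⟩ := lintegral_kernel_weights_perp hb hα0 hα hβ0 hβ hγ hl
  obtain ⟨K2, hK2, h2⟩ := lintegral_kernel_weights_parallel hb hα0 hα hβ0 hβ hγ hl
  refine ⟨max K1 K2, lt_max_of_lt_left hK1, fun v ω => ?_⟩
  have hX0 : 0 < 1 + ‖v‖ := by positivity
  rcases le_total ((inner ℝ (ω : R3) v) ^ 2) (‖v‖ ^ 2 - (inner ℝ (ω : R3) v) ^ 2) with hca | hca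
  · refine (h1 v ω hca).trans (mul_le_mul' (ENNReal.ofReal_le_ofReal ?_) le_self_add)
    gcongr; exact le_max_left _ _
  · refine (h2 v ω hca).trans (mul_le_mul' (ENNReal.ofReal_le_ofReal ?_) le_add_self)
    gcongr; exact le_max_right _ _

/-- Exponents separating the variables in the collision kernel. -/
theorem exists_exponents {γ : ℝ} (hγ : -3 < γ) (hγ1 : γ ≤ 1) : ∃ α β : ℝ, -1 < α ∧ α ≤ 1 ∧
    -1 < β ∧ β ≤ 0 ∧ α + β + β = γ ∧ max α 0 = max γ 0 := by
  -- A power γ > -1 is integrable on the line and can be put on the first coordinate. A stronger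
  -- singularity is shared among the three coordinates so that each exponent exceeds -1. Both
  -- choices keep the growth exponent max γ 0.
  by_cases h : -1 < γ
  · exact ⟨γ, 0, h, hγ1, by norm_num, le_rfl, by ring, rfl⟩
  · push Not at h
    exact ⟨(γ + 1) / 2, (γ - 1) / 4, by linarith, by linarith, by linarith, by linarith, by ring,
      by rw [max_eq_right (by linarith), max_eq_right (by linarith)]⟩

theorem measurable_kernel_right {b : ℝ → ℝ} (hb : Measurable b) (γ : ℝ) (v : R3) :
    Measurable fun p : R3 × S2 => kernel γ b v p.1 p.2 :=
  measurable_kernel_comp hb γ measurable_const measurable_fst measurable_snd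

theorem measurable_ofReal_kernel {b : ℝ → ℝ} (hb : Measurable b) (γ : ℝ) (v : R3) :
    Measurable fun p : R3 × S2 => ENNReal.ofReal (kernel γ b v p.1 p.2) :=
  (measurable_kernel_right hb γ v).ennreal_ofReal

/-- The gain term of two polynomial weights. -/
theorem lintegral_gain_weights {b : ℝ → ℝ} {C : ℝ} (hb : IsCutoff b C) {γ : ℝ} (hγ : -3 < γ)
    (hγ1 : γ ≤ 1) {l : ℝ} (hl : 8 ≤ l) : ∃ K : ℝ, 0 < K ∧ ∀ v : R3,
      ∫⁻ p : R3 × S2, ENNReal.ofReal (kernel γ b v p.1 p.2) *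
          ENNReal.ofReal (weight (-l) (uPost v p.1 p.2) * weight (-l) (vPost v p.1 p.2)) ∂duDω
        ≤ ENNReal.ofReal (K * (1 + ‖v‖) ^ (max γ 0) * weight (-l) v) := by
  obtain ⟨α, β, h1, h2, h3, h4, h5, h6⟩ := exists_exponents hγ hγ1
  obtain ⟨K, hK0, hK⟩ := lintegral_kernel_weights_slice hb h1 h2 h3 h4 h5 hl
  obtain ⟨C1, hC1, hS1⟩ := sphere_decay_parallel
  obtain ⟨C2, hC2, hS2⟩ := sphere_decay_perp
  refine ⟨K * (C1 + C2), by positivity, fun v => ?_⟩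
  have hX0 : 0 < 1 + ‖v‖ := by positivity
  have hmeas := measurable_ofReal_kernel hb.meas γ v
  rw [lintegral_duDω (F := fun p => _ * _) (hmeas.mul (by fun_prop))]
  -- The two sphere integrals gain exactly the powers of 1+|v| lost in the slices.
  calc _ ≤ _ := lintegral_mono fun ω => hK v ω
    _ = ENNReal.ofReal (K * (1 + ‖v‖) ^ (max α 0 - l)) *
      (ENNReal.ofReal (1 + ‖v‖) * (∫⁻ ω : S2, ENNReal.ofReal ((1 + (inner ℝ (ω : R3) v) ^ 2)⁻¹)
        ∂(volume : Measure R3).toSphere)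
      + ENNReal.ofReal ((1 + ‖v‖) ^ 2) * (∫⁻ ω : S2, ENNReal.ofReal
        (((1 + (‖v‖ ^ 2 - (inner ℝ (ω : R3) v) ^ 2)) ^ 2)⁻¹) ∂(volume : Measure R3).toSphere)) := by
      simp only [ENNReal.ofReal_mul hX0.le, ENNReal.ofReal_mul (sq_nonneg (1 + ‖v‖))]
      rw [lintegral_const_mul _ (by fun_prop), lintegral_add_left (by fun_prop),
        lintegral_const_mul _ (by fun_prop), lintegral_const_mul _ (by fun_prop)]
    _ ≤ ENNReal.ofReal (K * (1 + ‖v‖) ^ (max α 0 - l)) *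
      (ENNReal.ofReal (1 + ‖v‖) * ENNReal.ofReal (C1 / (1 + ‖v‖))
      + ENNReal.ofReal ((1 + ‖v‖) ^ 2) * ENNReal.ofReal (C2 / (1 + ‖v‖) ^ 2)) := by
      gcongr
      · exact hS1 v
      · exact hS2 v
    _ = _ := by
      rw [← ENNReal.ofReal_mul hX0.le, ← ENNReal.ofReal_mul (by positivity),
        mul_div_cancel₀ _ hX0.ne', mul_div_cancel₀ _ (by positivity), ← ENNReal.ofReal_add hC1.le hC2.le,
        ← ENNReal.ofReal_mul (by positivity), h6, sub_eq_add_neg, Real.rpow_add hX0]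
      congr 1
      unfold weight
      ring

/-- The loss term of a polynomial weight. -/
theorem lintegral_loss_weight {b : ℝ → ℝ} {C : ℝ} (hb : IsCutoff b C) {γ : ℝ} (hγ : -3 < γ)
    (hγ1 : γ ≤ 1) {l : ℝ} (hl : 9 ≤ l) : ∃ K : ℝ, 0 < K ∧ ∀ v : R3,
      ∫⁻ p : R3 × S2, ENNReal.ofReal (kernel γ b v p.1 p.2) *
          ENNReal.ofReal (weight (-l) p.1) ∂duDω
        ≤ ENNReal.ofReal (K * (1 + ‖v‖) ^ (max γ 0)) := by
  obtain ⟨α, β, h1, h2, h3, h4, h5, h6⟩ := exists_exponents hγ hγ1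
  obtain ⟨A, hA1, hA⟩ := lintegral_absPow_weight h1 h2
  obtain ⟨B, hB1, hB⟩ := lintegral_absPow_weight h3 (h4.trans zero_le_one)
  have hC := hb.pos
  obtain ⟨m, hm⟩ : ∃ m : ℝ, (volume : Measure R3).toSphere univ = ENNReal.ofReal m ∧ 0 ≤ m :=
    ⟨_, (ENNReal.ofReal_toReal sphere_univ_ne_top).symm, ENNReal.toReal_nonneg⟩
  refine ⟨C * A * B * B * (m + 1), by have := hm.2; positivity, fun v => ?_⟩
  have hm0 := hm.2
  have hX0 : 0 < 1 + ‖v‖ := by positivity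
  have hmeas := measurable_ofReal_kernel hb.meas γ v
  have hαm0 : 0 ≤ max α 0 := le_max_right _ _
  rw [lintegral_duDω (F := fun p => _ * _) (hmeas.mul (by fun_prop))]
  -- The weight is shared equally by the three coordinates; l ≥ 9 leaves the exponent l/3 ≥ 3
  -- required in one dimension.
  have key : ∀ ω : S2, ∫⁻ u, ENNReal.ofReal (kernel γ b v u ω) * ENNReal.ofReal (weight (-l) u)
      ≤ ENNReal.ofReal (C * A * B * B * (1 + ‖v‖) ^ (max α 0)) := by
    intro ω
    obtain ⟨e, he⟩ := exists_orthonormalBasis_sphere ω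
    have hw : ∀ u : R3, ENNReal.ofReal (weight (-l) u) ≤
        ENNReal.ofReal ((1 + |inner ℝ (e 0) u|) ^ (-(l / 3))) *
        (ENNReal.ofReal ((1 + |inner ℝ (e 1) u|) ^ (-(l / 3))) *
         ENNReal.ofReal ((1 + |inner ℝ (e 2) u|) ^ (-(l / 3)))) := by
      intro u
      rw [← ENNReal.ofReal_mul (by positivity), ← ENNReal.ofReal_mul (by positivity)]
      apply ENNReal.ofReal_le_ofReal
      have hi : ∀ i, |inner ℝ (e i) u| ≤ ‖u‖ := fun i => by
        have := abs_real_inner_le_norm (e i) u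
        rwa [e.norm_eq_one, one_mul] at this
      have := weight_neg_le_prod (v := u) (abs_nonneg (inner ℝ (e 0) u)) (abs_nonneg (inner ℝ (e 1) u))
          (abs_nonneg (inner ℝ (e 2) u)) (hi 0) (hi 1) (hi 2) (p := l / 3) (q := l / 3) (r := l / 3)
          (by linarith) (by linarith) (by linarith)
      rwa [show l / 3 + l / 3 + l / 3 = l by ring] at this
    refine (lintegral_kernel_mul_le hb h2 h4 h5 he v
      (f := fun p => ENNReal.ofReal ((1 + |p|) ^ (-(l / 3))))
      (g := fun p => ENNReal.ofReal ((1 + |p|) ^ (-(l / 3))))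
      (h := fun p => ENNReal.ofReal ((1 + |p|) ^ (-(l / 3))))
      (by fun_prop) (by fun_prop) (by fun_prop) hw).trans ?_
    have i1 : ∫⁻ p, absPow α (inner ℝ (e 0) v - p) * ENNReal.ofReal ((1 + |p|) ^ (-(l / 3)))
        ≤ ENNReal.ofReal (A * (1 + ‖v‖) ^ (max α 0)) := by
      refine (hA (l / 3) 1 _ (by linarith) le_rfl).trans (ENNReal.ofReal_le_ofReal ?_)
      rw [Real.one_rpow, mul_one]
      gcongr
      have := abs_real_inner_le_norm (e 0) v
      rwa [e.norm_eq_one, one_mul] at this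
    have i2 : ∀ y : ℝ, ∫⁻ p, absPow β (y - p) * ENNReal.ofReal ((1 + |p|) ^ (-(l / 3)))
        ≤ ENNReal.ofReal B := by
      intro y
      refine (hB (l / 3) 1 y (by linarith) le_rfl).trans (ENNReal.ofReal_le_ofReal ?_)
      rw [max_eq_right h4]; simp
    calc _ ≤ ENNReal.ofReal C * (_ * (ENNReal.ofReal B * ENNReal.ofReal B)) :=
          mul_le_mul_right (mul_le_mul' i1 (mul_le_mul' (i2 _) (i2 _))) _
      _ = _ := by
          rw [← ENNReal.ofReal_mul (by positivity), ← ENNReal.ofReal_mul (by positivity),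
            ← ENNReal.ofReal_mul (by positivity)]
          congr 1; ring
  calc _ ≤ _ := lintegral_mono key
    _ = ENNReal.ofReal (C * A * B * B * (1 + ‖v‖) ^ (max α 0) * m) := by
      rw [lintegral_const, hm.1, ← ENNReal.ofReal_mul (by positivity)]
    _ ≤ _ := by
      apply ENNReal.ofReal_le_ofReal
      rw [h6]
      have : 0 ≤ C * A * B * B * (1 + ‖v‖) ^ max γ 0 := by positivity
      nlinarith

end Boltzmann

/-! ### Gain terms with a Maxwellian: slices with a small constant -/

namespace Boltzmann

theorem exists_maxwellian_le_weight (m : ℝ) :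
    ∃ C : ℝ, 0 < C ∧ ∀ v : R3, maxwellian v ≤ C * weight (-m) v := by
  obtain ⟨n, hn⟩ := exists_nat_ge m
  refine ⟨(2 * Real.pi) ^ (-(3 / 2) : ℝ) * (n.factorial * Real.exp (3 / 2)), by positivity, fun v => ?_⟩
  unfold maxwellian
  rw [mul_assoc]
  gcongr
  set r := ‖v‖
  have hr : 0 ≤ r := norm_nonneg v
  rw [weight_neg, ← div_eq_mul_inv, le_div_iff₀ (weight_pos _ _)]
  have h1 : weight m v ≤ (1 + r) ^ n := by
    rw [← Real.rpow_natCast]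
    exact Real.rpow_le_rpow_of_exponent_le (by linarith) hn
  have h2 : (1 + r) ^ n ≤ n.factorial * Real.exp (1 + r) := by
    have := Real.pow_div_factorial_le_exp (1 + r) (by linarith) n
    rwa [div_le_iff₀ (by positivity), mul_comm] at this
  calc Real.exp (-r ^ 2 / 2) * weight m v ≤ Real.exp (-r ^ 2 / 2) * (n.factorial * Real.exp (1 + r)) := by
        gcongr; exact h1.trans h2
    _ = n.factorial * Real.exp (-r ^ 2 / 2 + (1 + r)) := by
        rw [Real.exp_add (-r ^ 2 / 2)]; ring
    _ ≤ _ := by gcongr; nlinarith [sq_nonneg (r - 1)]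

theorem maxwellian_const_le_one : (2 * Real.pi) ^ (-(3 / 2) : ℝ) ≤ 1 :=
  Real.rpow_le_one_of_one_le_of_nonpos (by linarith [Real.two_le_pi]) (by norm_num)

/-- Comparison of the weights before and after a collision transferring little energy. -/
theorem ratio_le {A D y z l : ℝ} (hA : 1 ≤ A) (hD : 0 ≤ D) (hy : 0 ≤ y) (hz : 0 ≤ z) (hl : 0 ≤ l)
    (hyA : y ≤ A ^ 2 / 2) (hDA : D ^ 2 = A ^ 2 - y + z) (hlA : 4 * l ≤ A ^ 2) :
    (1 + D) ^ (-l) ≤ (1 + A) ^ (-l) * (Real.exp (y / 4) * (1 + z / A ^ 2) ^ (-(l / 4))) := by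
  have hA0 : 0 < A := by linarith
  set x := y / A ^ 2 with hx
  set ζ := z / A ^ 2 with hζ
  have hx0 : 0 ≤ x := by positivity
  have hζ0 : 0 ≤ ζ := by positivity
  have hx2 : x ≤ 1 / 2 := by rw [hx, div_le_iff₀ (by positivity)]; linarith
  have hDA' : D ^ 2 = A ^ 2 * (1 - x + ζ) := by rw [hDA, hx, hζ]; field_simp
  have hq : A ^ 2 * ((1 - x) * (1 + ζ)) ≤ D ^ 2 := by
    rw [hDA']; gcongr; nlinarith [mul_nonneg hx0 hζ0]
  -- Fourth powers accommodate both cases: (1+D)/(1+A) is at least D/A if D ≤ A, but only at least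
  -- the square root of D/A if D ≥ A. Hence 1+ζ enters to the first power only.
  have h4 : (1 + A) ^ 4 * ((1 - x) ^ 2 * (1 + ζ)) ≤ (1 + D) ^ 4 := by
    have hx1 : 0 ≤ 1 - x := by linarith
    rcases le_total A D with h | h
    · have e1 : (1 + A) ^ 2 * D ≤ (1 + D) ^ 2 * A := by
        have : 0 ≤ (D - A) * (A * D - 1) := mul_nonneg (by linarith) (by nlinarith)
        nlinarith
      have e2 : ((1 + A) ^ 2 * D) ^ 2 ≤ ((1 + D) ^ 2 * A) ^ 2 := by gcongr
      have e3 : (1 - x) ^ 2 * (1 + ζ) ≤ (1 - x) * (1 + ζ) := by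
        gcongr; nlinarith
      have e4 : A ^ 2 * ((1 + A) ^ 4 * ((1 - x) ^ 2 * (1 + ζ))) ≤ A ^ 2 * (1 + D) ^ 4 := by
        calc _ = (1 + A) ^ 4 * (A ^ 2 * ((1 - x) ^ 2 * (1 + ζ))) := by ring
          _ ≤ (1 + A) ^ 4 * (A ^ 2 * ((1 - x) * (1 + ζ))) := by gcongr
          _ ≤ (1 + A) ^ 4 * D ^ 2 := by gcongr
          _ = ((1 + A) ^ 2 * D) ^ 2 := by ring
          _ ≤ _ := e2
          _ = _ := by ring
      exact le_of_mul_le_mul_left e4 (by positivity)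
    · have e1 : (1 + A) * D ≤ (1 + D) * A := by linarith
      have e2 : ((1 + A) * D) ^ 4 ≤ ((1 + D) * A) ^ 4 := by gcongr
      have e3 : (1 - x) ^ 2 * (1 + ζ) ≤ (1 - x) ^ 2 * (1 + ζ) ^ 2 := by
        gcongr; nlinarith
      have e4 : A ^ 4 * ((1 + A) ^ 4 * ((1 - x) ^ 2 * (1 + ζ))) ≤ A ^ 4 * (1 + D) ^ 4 := by
        calc _ = (1 + A) ^ 4 * (A ^ 4 * ((1 - x) ^ 2 * (1 + ζ))) := by ring
          _ ≤ (1 + A) ^ 4 * (A ^ 4 * ((1 - x) ^ 2 * (1 + ζ) ^ 2)) := by gcongr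
          _ = (1 + A) ^ 4 * (A ^ 2 * ((1 - x) * (1 + ζ))) ^ 2 := by ring
          _ ≤ (1 + A) ^ 4 * (D ^ 2) ^ 2 := by gcongr
          _ = ((1 + A) * D) ^ 4 := by ring
          _ ≤ _ := e2
          _ = _ := by ring
      exact le_of_mul_le_mul_left e4 (by positivity)
  have hx1 : Real.exp (-2 * x) ≤ 1 - x := by
    have h1 : 0 < 1 - x := by linarith
    have h2 : (1 - x)⁻¹ ≤ Real.exp (2 * x) := by
      calc (1 - x)⁻¹ ≤ 2 * x + 1 := by
            rw [inv_le_iff_one_le_mul₀ h1]; nlinarith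
        _ ≤ _ := Real.add_one_le_exp _
    rw [show -2 * x = -(2 * x) by ring, Real.exp_neg]
    exact inv_le_of_inv_le₀ h1 h2
  -- Since x ≤ 1/2, 1-x ≥ e^{-2x}; the condition 4l ≤ A² turns l·x = l·y/A² into at most y/4, so the
  -- price of the lost energy y does not depend on l.
  have hexp : Real.exp (-(y / 4)) ≤ (1 - x) ^ (l / 2) := by
    calc Real.exp (-(y / 4)) ≤ Real.exp (-2 * x * (l / 2)) := by
          apply Real.exp_le_exp.2
          have : x * l ≤ y / 4 := by
            rw [hx, div_mul_eq_mul_div, div_le_iff₀ (by positivity)]; nlinarith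
          linarith
      _ = Real.exp (-2 * x) ^ (l / 2) := by rw [Real.exp_mul]
      _ ≤ _ := by gcongr
  have h5 := Real.rpow_le_rpow (by have : 0 ≤ 1 - x := by linarith
                                   positivity) h4 (show 0 ≤ l / 4 by linarith)
  have hx1' : 0 < 1 - x := by linarith
  rw [Real.mul_rpow (by positivity) (by positivity), Real.mul_rpow (by positivity) (by positivity),
    ← Real.rpow_natCast (1 + A), ← Real.rpow_mul (by positivity),
    ← Real.rpow_natCast (1 + D), ← Real.rpow_mul (by positivity),
    ← Real.rpow_natCast (1 - x), ← Real.rpow_mul (by positivity)] at h5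
  rw [show ((4 : ℕ) : ℝ) * (l / 4) = l by push_cast; ring,
    show ((2 : ℕ) : ℝ) * (l / 4) = l / 2 by push_cast; ring] at h5
  have h6 : (1 + A) ^ l * (Real.exp (-(y / 4)) * (1 + ζ) ^ (l / 4)) ≤ (1 + D) ^ l := by
    refine le_trans ?_ h5
    gcongr
  rw [Real.rpow_neg (by positivity), Real.rpow_neg (by positivity), Real.rpow_neg (by positivity)]
  have h7 := inv_anti₀ (by positivity) h6
  rw [mul_inv, mul_inv, ← Real.exp_neg, neg_neg] at h7
  exact h7

theorem bernoulli_inv {s n : ℝ} (hs : 0 ≤ s) (hn : 1 ≤ n) :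
    (1 + s) ^ (-n) ≤ (1 + n * s)⁻¹ := by
  rw [Real.rpow_neg (by linarith)]
  exact inv_anti₀ (by positivity) (one_add_mul_self_le_rpow_one_add (by linarith) hn)

theorem exp_neg_half_sq_le (q : ℝ) : Real.exp (-(q ^ 2 / 2)) ≤ 2 * (1 + q ^ 2)⁻¹ := by
  rw [Real.exp_neg, ← div_eq_mul_inv, inv_le_comm₀ (by positivity) (by positivity), inv_div]
  linarith [Real.add_one_le_exp (q ^ 2 / 2), sq_nonneg q]

theorem exp_neg_quarter_le {y : ℝ} (hy : 0 ≤ y) : Real.exp (-(y / 4)) ≤ 4 * (1 + y)⁻¹ := by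
  rw [Real.exp_neg, ← div_eq_mul_inv, inv_le_comm₀ (by positivity) (by positivity), inv_div]
  linarith [Real.add_one_le_exp (y / 4)]

theorem exp_neg_quarter_le_sq {y : ℝ} (hy : 0 ≤ y) :
    Real.exp (-(y / 4)) ≤ 64 * ((1 + y) ^ 2)⁻¹ := by
  rw [Real.exp_neg, ← div_eq_mul_inv, inv_le_comm₀ (by positivity) (by positivity), inv_div]
  have h1 := Real.add_one_le_exp (y / 8)
  have h2 : (y / 8 + 1) ^ 2 ≤ Real.exp (y / 8) ^ 2 := by gcongr
  rw [← Real.exp_nat_mul] at h2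
  rw [show ((2 : ℕ) : ℝ) * (y / 8) = y / 4 by push_cast; ring] at h2
  nlinarith

theorem one_add_abs_mul_exp_le (p : ℝ) :
    (1 + |p|) * Real.exp (-(p ^ 2 / 2)) ≤ 32 * (1 + p ^ 2)⁻¹ := by
  have h1 := Real.add_one_le_exp (p ^ 2 / 4)
  have h2 : (p ^ 2 / 4 + 1) ^ 2 ≤ Real.exp (p ^ 2 / 4) ^ 2 := by gcongr
  rw [← Real.exp_nat_mul, show ((2 : ℕ) : ℝ) * (p ^ 2 / 4) = p ^ 2 / 2 by push_cast; ring] at h2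
  rw [Real.exp_neg, ← div_eq_mul_inv, ← div_eq_mul_inv, div_le_div_iff₀ (by positivity) (by positivity)]
  have h3 : 1 + |p| ≤ 2 * (1 + p ^ 2) := by nlinarith [sq_abs p, sq_nonneg (|p| - 1), sq_nonneg p]
  calc (1 + |p|) * (1 + p ^ 2) ≤ 2 * (1 + p ^ 2) * (1 + p ^ 2) := by gcongr
    _ ≤ 32 * ((p ^ 2 / 4 + 1) ^ 2) := by nlinarith [sq_nonneg p, sq_nonneg (p^2)]
    _ ≤ _ := by gcongr

theorem lintegral_inv_one_add_mul_sq {a : ℝ} (ha : 0 < a) {A : ℝ} (hA : 0 < A) :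
    ∫⁻ p : ℝ, ENNReal.ofReal ((1 + a * (p ^ 2 / A ^ 2))⁻¹) = ENNReal.ofReal (Real.pi * A / √a) := by
  have h := lintegral_inv_one_add_sq (a := √a / A) (by positivity)
  rw [div_div_eq_mul_div] at h
  rw [← h]
  refine lintegral_congr fun p => ?_
  rw [mul_pow, div_pow, Real.sq_sqrt ha.le]
  congr 2; ring

theorem absPow_zero (y : ℝ) : absPow 0 y = 1 := ENNReal.rpow_zero

theorem absPow_of_pos {α : ℝ} (hα : 0 < α) (y : ℝ) : absPow α y = ENNReal.ofReal (|y| ^ α) :=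
  ENNReal.ofReal_rpow_of_nonneg (abs_nonneg y) hα.le

theorem lintegral_inv_one_add_sq_one : ∫⁻ p : ℝ, ENNReal.ofReal ((1 + p ^ 2)⁻¹) = ENNReal.ofReal Real.pi := by
  have := lintegral_inv_one_add_sq one_pos
  simpa using this

/-- Slice estimate for hard potentials when the collision transfers the parallel component `v·ω` of
small size: the constant is small for large `l`. -/
theorem gain_slice_parallel {b : ℝ → ℝ} {C : ℝ} (hb : IsCutoff b C) {γ : ℝ} (hγ : 0 < γ)
    (hγ1 : γ ≤ 1) {l : ℝ} (hl : 8 ≤ l) {v : R3} (hv : 1 ≤ ‖v‖) (hlv : 4 * l ≤ ‖v‖ ^ 2) {ω : S2}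
    (hω : (inner ℝ (ω : R3) v) ^ 2 ≤ ‖v‖ ^ 2 / 2) :
    ∫⁻ u, ENNReal.ofReal (kernel γ b v u ω) *
      ENNReal.ofReal (maxwellian (uPost v u ω) * weight (-l) (vPost v u ω)) ≤
    ENNReal.ofReal (C * 32 * Real.pi ^ 3 / √(l / 8) * ‖v‖ ^ γ * weight (-l) v * ‖v‖) *
      ENNReal.ofReal ((1 + (inner ℝ (ω : R3) v) ^ 2)⁻¹) := by
  have hC := hb.pos
  obtain ⟨e, he⟩ := exists_orthonormalBasis_sphere ω
  rw [← he] at hω ⊢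
  have hv0A := abs_inner_basis_le e 0 v
  have hv2 := norm_sq_eq_basis e v
  have hw := weight_pos (-l) v
  have hpi := Real.pi_pos
  refine (lintegral_kernel_mul_le hb hγ1 le_rfl (by ring) he v
    (f := fun p => ENNReal.ofReal ((weight (-l) v * (4 * (1 + (inner ℝ (e 0) v) ^ 2)⁻¹)) *
      (1 + p ^ 2 / ‖v‖ ^ 2) ^ (-(l / 4))))
    (g := fun p => ENNReal.ofReal (2 * (1 + p ^ 2)⁻¹))
    (h := fun p => ENNReal.ofReal (2 * (1 + p ^ 2)⁻¹))
    (by fun_prop) (by fun_prop) (by fun_prop) ?_).trans ?_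
  · intro u
    rw [← ENNReal.ofReal_mul (by positivity), ← ENNReal.ofReal_mul (by positivity)]
    apply ENNReal.ofReal_le_ofReal
    have hU := norm_uPost_sq he v u
    have hV := norm_vPost_sq he v u
    set v0 := inner ℝ (e 0) v
    set u0 := inner ℝ (e 0) u
    set u1 := inner ℝ (e 1) u
    set u2 := inner ℝ (e 2) u
    -- Passing from v to v' replaces v₀² by u₀². The price e^{v₀²/4} is covered by the factor
    -- e^{-v₀²/2} of the Maxwellian at u', and e^{-v₀²/4} remains for the integration over ω.
    have h1 := ratio_le hv (norm_nonneg (vPost v u ω)) (sq_nonneg v0) (sq_nonneg u0)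
      (by linarith : 0 ≤ l) hω (by rw [hV, hv2]; ring) hlv
    have h2 : maxwellian (uPost v u ω) ≤ Real.exp (-(v0 ^ 2 / 2)) *
        (Real.exp (-(u1 ^ 2 / 2)) * Real.exp (-(u2 ^ 2 / 2))) := by
      unfold maxwellian
      rw [← Real.exp_add, ← Real.exp_add, hU]
      calc _ ≤ 1 * Real.exp (-(v0 ^ 2 + u1 ^ 2 + u2 ^ 2) / 2) := by
            gcongr; exact maxwellian_const_le_one
        _ = _ := by rw [one_mul]; congr 1; ring
    have h3 : Real.exp (-(v0 ^ 2 / 2)) * Real.exp (v0 ^ 2 / 4) ≤ 4 * (1 + v0 ^ 2)⁻¹ := by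
      rw [← Real.exp_add]
      refine le_trans (le_of_eq ?_) (exp_neg_quarter_le (sq_nonneg v0))
      congr 1; ring
    calc maxwellian (uPost v u ω) * weight (-l) (vPost v u ω)
        ≤ (Real.exp (-(v0 ^ 2 / 2)) * (Real.exp (-(u1 ^ 2 / 2)) * Real.exp (-(u2 ^ 2 / 2)))) *
          (weight (-l) v * (Real.exp (v0 ^ 2 / 4) * (1 + u0 ^ 2 / ‖v‖ ^ 2) ^ (-(l / 4)))) :=
          mul_le_mul h2 h1 (weight_pos _ _).le (by positivity)
      _ = (weight (-l) v * (Real.exp (-(v0 ^ 2 / 2)) * Real.exp (v0 ^ 2 / 4)) *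
          (1 + u0 ^ 2 / ‖v‖ ^ 2) ^ (-(l / 4))) *
          (Real.exp (-(u1 ^ 2 / 2)) * Real.exp (-(u2 ^ 2 / 2))) := by ring
      _ ≤ _ := by
          gcongr
          · exact exp_neg_half_sq_le _
          · exact exp_neg_half_sq_le _
  · set v0 := inner ℝ (e 0) v
    set A := ‖v‖
    have hA0 : 0 < A := by linarith
    have i1 : ∫⁻ p, absPow γ (v0 - p) * ENNReal.ofReal ((weight (-l) v * (4 * (1 + v0 ^ 2)⁻¹)) *
        (1 + p ^ 2 / A ^ 2) ^ (-(l / 4))) ≤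
        ENNReal.ofReal (weight (-l) v * (4 * (1 + v0 ^ 2)⁻¹) * (2 * A ^ γ)) *
          ENNReal.ofReal (Real.pi * A / √(l / 8)) := by
      rw [← lintegral_inv_one_add_mul_sq (by linarith : 0 < l / 8) hA0,
        ← lintegral_const_mul _ (by fun_prop)]
      refine lintegral_mono fun p => ?_
      rw [absPow_of_pos hγ, ← ENNReal.ofReal_mul (by positivity), ← ENNReal.ofReal_mul (by positivity)]
      apply ENNReal.ofReal_le_ofReal
      set ζ := p ^ 2 / A ^ 2 with hζ
      have hζ0 : 0 ≤ ζ := by positivity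
      have h1 : |v0 - p| ^ γ ≤ A ^ γ * (2 * (1 + ζ)) := by
        have h2 : |v0 - p| ≤ A * (1 + |p| / A) := by
          rw [mul_add, mul_div_cancel₀ _ hA0.ne', mul_one]
          exact (abs_sub _ _).trans (by linarith)
        have h3 : 1 + |p| / A ≤ 2 * (1 + ζ) := by
          have : ζ = (|p| / A) ^ 2 := by rw [div_pow, sq_abs]
          rw [this]
          nlinarith [sq_nonneg (|p| / A - 1), sq_nonneg (|p| / A)]
        have h4 : 1 ≤ 1 + |p| / A := by have : 0 ≤ |p| / A := by positivity
                                        linarith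
        calc |v0 - p| ^ γ ≤ (A * (1 + |p| / A)) ^ γ := by gcongr
          _ = A ^ γ * (1 + |p| / A) ^ γ := Real.mul_rpow hA0.le (by positivity)
          _ ≤ A ^ γ * (1 + |p| / A) ^ (1 : ℝ) := by gcongr
          _ = A ^ γ * (1 + |p| / A) := by rw [Real.rpow_one]
          _ ≤ _ := by gcongr
      -- One power pays for the growth of |v₀-p|^γ, and l ≥ 8 leaves at least the exponent l/8. By
      -- Bernoulli this decays like 1/(1+lζ/8), whose integral is of order |v|/√l: this is the
      -- origin of the small constant.
      have h5 : (1 + ζ) * (1 + ζ) ^ (-(l / 4)) ≤ (1 + l / 8 * ζ)⁻¹ := by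
        calc (1 + ζ) * (1 + ζ) ^ (-(l / 4)) = (1 + ζ) ^ (1 + -(l / 4)) := by
              rw [Real.rpow_add (by positivity), Real.rpow_one]
          _ ≤ (1 + ζ) ^ (-(l / 8)) := Real.rpow_le_rpow_of_exponent_le (by linarith) (by linarith)
          _ ≤ _ := bernoulli_inv hζ0 (by linarith)
      calc _ ≤ A ^ γ * (2 * (1 + ζ)) * (weight (-l) v * (4 * (1 + v0 ^ 2)⁻¹) * (1 + ζ) ^ (-(l / 4))) := by
            gcongr
        _ = weight (-l) v * (4 * (1 + v0 ^ 2)⁻¹) * (2 * A ^ γ) * ((1 + ζ) * (1 + ζ) ^ (-(l / 4))) := by ring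
        _ ≤ _ := by gcongr
    have i2 : ∀ y : ℝ, ∫⁻ p, absPow 0 (y - p) * ENNReal.ofReal (2 * (1 + p ^ 2)⁻¹)
        = ENNReal.ofReal (2 * Real.pi) := by
      intro y
      simp only [absPow_zero, one_mul]
      simp_rw [ENNReal.ofReal_mul (show (0:ℝ) ≤ 2 by norm_num)]
      rw [lintegral_const_mul _ (by fun_prop), lintegral_inv_one_add_sq_one]
    rw [i2, i2]
    calc _ ≤ _ := mul_le_mul_right (mul_le_mul_left i1 _) _
      _ = _ := by
        rw [← ENNReal.ofReal_mul (by positivity), ← ENNReal.ofReal_mul (by positivity),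
          ← ENNReal.ofReal_mul (by positivity), ← ENNReal.ofReal_mul (by positivity),
          ← ENNReal.ofReal_mul (by positivity)]
        congr 1
        ring

/-- Slice estimate for hard potentials when the collision transfers the perpendicular component
of `v` of small size. -/
theorem gain_slice_perp {b : ℝ → ℝ} {C : ℝ} (hb : IsCutoff b C) {γ : ℝ} (hγ : 0 < γ)
    (hγ1 : γ ≤ 1) {l : ℝ} (hl : 8 ≤ l) {v : R3} (hv : 1 ≤ ‖v‖) (hlv : 4 * l ≤ ‖v‖ ^ 2) {ω : S2}
    (hω : ‖v‖ ^ 2 - (inner ℝ (ω : R3) v) ^ 2 ≤ ‖v‖ ^ 2 / 2) :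
    ∫⁻ u, ENNReal.ofReal (kernel γ b v u ω) *
      ENNReal.ofReal (maxwellian (vPost v u ω) * weight (-l) (uPost v u ω)) ≤
    ENNReal.ofReal (C * 2048 * Real.pi ^ 3 / √(l / 8) * ‖v‖ ^ γ * weight (-l) v * ‖v‖ ^ 2) *
      ENNReal.ofReal (((1 + (‖v‖ ^ 2 - (inner ℝ (ω : R3) v) ^ 2)) ^ 2)⁻¹) := by
  have hC := hb.pos
  obtain ⟨e, he⟩ := exists_orthonormalBasis_sphere ω
  rw [← he] at hω ⊢
  have hv0A := abs_inner_basis_le e 0 v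
  have hv2 := norm_sq_eq_basis e v
  have hw := weight_pos (-l) v
  have hpi := Real.pi_pos
  have hva : ‖v‖ ^ 2 - (inner ℝ (e 0) v) ^ 2 = inner ℝ (e 1) v ^ 2 + inner ℝ (e 2) v ^ 2 := by
    rw [hv2]; ring
  set a2 := ‖v‖ ^ 2 - (inner ℝ (e 0) v) ^ 2 with ha2
  have ha0 : 0 ≤ a2 := by rw [hva]; positivity
  refine (lintegral_kernel_mul_le hb hγ1 le_rfl (by ring) he v
    (f := fun p => ENNReal.ofReal ((weight (-l) v * (64 * ((1 + a2) ^ 2)⁻¹)) *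
      Real.exp (-(p ^ 2 / 2))))
    (g := fun p => ENNReal.ofReal ((1 + l / 8 * (p ^ 2 / ‖v‖ ^ 2))⁻¹))
    (h := fun p => ENNReal.ofReal ((1 + l / 8 * (p ^ 2 / ‖v‖ ^ 2))⁻¹))
    (by fun_prop) (by fun_prop) (by fun_prop) ?_).trans ?_
  · intro u
    rw [← ENNReal.ofReal_mul (by positivity), ← ENNReal.ofReal_mul (by positivity)]
    apply ENNReal.ofReal_le_ofReal
    have hU := norm_uPost_sq he v u
    have hV := norm_vPost_sq he v u
    set v0 := inner ℝ (e 0) v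
    set u0 := inner ℝ (e 0) u
    set u1 := inner ℝ (e 1) u
    set u2 := inner ℝ (e 2) u
    have h1 := ratio_le hv (norm_nonneg (uPost v u ω)) ha0
      (by positivity : 0 ≤ u1 ^ 2 + u2 ^ 2)
      (by linarith : 0 ≤ l) hω (by rw [hU, ha2]; ring) hlv
    have h2 : maxwellian (vPost v u ω) ≤ Real.exp (-(u0 ^ 2 / 2)) * Real.exp (-(a2 / 2)) := by
      unfold maxwellian
      rw [← Real.exp_add, hV]
      calc _ ≤ 1 * Real.exp (-(u0 ^ 2 + inner ℝ (e 1) v ^ 2 + inner ℝ (e 2) v ^ 2) / 2) := by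
            gcongr; exact maxwellian_const_le_one
        _ = _ := by rw [one_mul, hva]; congr 1; ring
    have h3 : Real.exp (-(a2 / 2)) * Real.exp (a2 / 4) ≤ 64 * ((1 + a2) ^ 2)⁻¹ := by
      rw [← Real.exp_add]
      refine le_trans (le_of_eq ?_) (exp_neg_quarter_le_sq ha0)
      congr 1; ring
    -- The exponent is halved between u₁ and u₂, and each coordinate yields |v|/√(l/8). One of the
    -- two factors 1/√(l/8) is finally dropped, so that the constant has the same shape as in the
    -- other slice.
    have h4 : (1 + (u1 ^ 2 + u2 ^ 2) / ‖v‖ ^ 2) ^ (-(l / 4)) ≤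
        (1 + l / 8 * (u1 ^ 2 / ‖v‖ ^ 2))⁻¹ * (1 + l / 8 * (u2 ^ 2 / ‖v‖ ^ 2))⁻¹ := by
      have h5 : ∀ x : ℝ, x ^ 2 ≤ u1 ^ 2 + u2 ^ 2 →
          (1 + (u1 ^ 2 + u2 ^ 2) / ‖v‖ ^ 2) ^ (-(l / 8)) ≤ (1 + l / 8 * (x ^ 2 / ‖v‖ ^ 2))⁻¹ := by
        intro x hx
        calc _ ≤ (1 + x ^ 2 / ‖v‖ ^ 2) ^ (-(l / 8)) := by
              apply Real.rpow_le_rpow_of_nonpos (by positivity) _ (by linarith)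
              gcongr
          _ ≤ _ := bernoulli_inv (by positivity) (by linarith)
      rw [show -(l / 4) = -(l / 8) + -(l / 8) by ring, Real.rpow_add (by positivity)]
      exact mul_le_mul (h5 _ (by nlinarith)) (h5 _ (by nlinarith)) (by positivity) (by positivity)
    calc maxwellian (vPost v u ω) * weight (-l) (uPost v u ω)
        ≤ (Real.exp (-(u0 ^ 2 / 2)) * Real.exp (-(a2 / 2))) *
          (weight (-l) v * (Real.exp (a2 / 4) * (1 + (u1 ^ 2 + u2 ^ 2) / ‖v‖ ^ 2) ^ (-(l / 4)))) :=
          mul_le_mul h2 h1 (weight_pos _ _).le (by positivity)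
      _ = (weight (-l) v * (Real.exp (-(a2 / 2)) * Real.exp (a2 / 4)) *
          Real.exp (-(u0 ^ 2 / 2))) * (1 + (u1 ^ 2 + u2 ^ 2) / ‖v‖ ^ 2) ^ (-(l / 4)) := by ring
      _ ≤ _ := by gcongr
  · set v0 := inner ℝ (e 0) v
    set A := ‖v‖
    have hA0 : 0 < A := by linarith
    have i1 : ∫⁻ p, absPow γ (v0 - p) * ENNReal.ofReal ((weight (-l) v * (64 * ((1 + a2) ^ 2)⁻¹)) *
        Real.exp (-(p ^ 2 / 2))) ≤
        ENNReal.ofReal (weight (-l) v * (64 * ((1 + a2) ^ 2)⁻¹) * (A ^ γ * 32)) *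
          ENNReal.ofReal Real.pi := by
      rw [← lintegral_inv_one_add_sq_one, ← lintegral_const_mul _ (by fun_prop)]
      refine lintegral_mono fun p => ?_
      rw [absPow_of_pos hγ, ← ENNReal.ofReal_mul (by positivity), ← ENNReal.ofReal_mul (by positivity)]
      apply ENNReal.ofReal_le_ofReal
      have h1 : |v0 - p| ^ γ ≤ A ^ γ * (1 + |p|) := by
        have h2 : |v0 - p| ≤ A * (1 + |p|) := by
          refine (abs_sub _ _).trans ?_
          nlinarith [abs_nonneg p]
        have h4 : 1 ≤ 1 + |p| := by linarith [abs_nonneg p]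
        calc |v0 - p| ^ γ ≤ (A * (1 + |p|)) ^ γ := by gcongr
          _ = A ^ γ * (1 + |p|) ^ γ := Real.mul_rpow hA0.le (by positivity)
          _ ≤ A ^ γ * (1 + |p|) ^ (1 : ℝ) := by gcongr
          _ = A ^ γ * (1 + |p|) := by rw [Real.rpow_one]
      calc _ ≤ A ^ γ * (1 + |p|) * (weight (-l) v * (64 * ((1 + a2) ^ 2)⁻¹) * Real.exp (-(p ^ 2 / 2))) := by
            gcongr
        _ = weight (-l) v * (64 * ((1 + a2) ^ 2)⁻¹) * A ^ γ * ((1 + |p|) * Real.exp (-(p ^ 2 / 2))) := by ring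
        _ ≤ weight (-l) v * (64 * ((1 + a2) ^ 2)⁻¹) * A ^ γ * (32 * (1 + p ^ 2)⁻¹) := by
            exact mul_le_mul_of_nonneg_left (one_add_abs_mul_exp_le p) (by positivity)
        _ = _ := by ring
    have i2 : ∀ y : ℝ, ∫⁻ p, absPow 0 (y - p) * ENNReal.ofReal ((1 + l / 8 * (p ^ 2 / A ^ 2))⁻¹)
        = ENNReal.ofReal (Real.pi * A / √(l / 8)) := by
      intro y
      simp only [absPow_zero, one_mul]
      exact lintegral_inv_one_add_mul_sq (by linarith) hA0
    rw [i2, i2]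
    calc _ ≤ _ := mul_le_mul_right (mul_le_mul_left i1 _) _
      _ = ENNReal.ofReal ((C * 2048 * Real.pi ^ 3 / √(l / 8) * A ^ γ * weight (-l) v * A ^ 2) *
            (√(l / 8))⁻¹ * ((1 + a2) ^ 2)⁻¹) := by
        rw [← ENNReal.ofReal_mul (by positivity), ← ENNReal.ofReal_mul (by positivity),
          ← ENNReal.ofReal_mul (by positivity), ← ENNReal.ofReal_mul (by positivity)]
        congr 1
        field_simp
        ring
      _ ≤ _ := by
        rw [← ENNReal.ofReal_mul (by positivity)]
        apply ENNReal.ofReal_le_ofReal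
        have h1 : (√(l / 8))⁻¹ ≤ 1 := inv_le_one_of_one_le₀ (by
          rw [Real.one_le_sqrt]; linarith)
        have h2 : 0 ≤ C * 2048 * Real.pi ^ 3 / √(l / 8) * A ^ γ * weight (-l) v * A ^ 2 := by positivity
        exact mul_le_mul_of_nonneg_right (mul_le_of_le_one_right h2 h1) (by positivity)

end Boltzmann

/-! ### Gain terms with a Maxwellian: degenerate collisions and summation over ω -/

namespace Boltzmann

/-- A spare power of decay of the Maxwellian is traded for X⁻¹. With X = 1+|v| this cancels the
growth (1+|v|)^γ for γ ≤ 1, so such collisions contribute a bounded coefficient only. -/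
theorem maxwellian_le_of_le {l K C : ℝ} (hC : 0 < C)
    (hm : ∀ v : R3, maxwellian v ≤ C * weight (-(l + 1)) v) {X : ℝ} (hX : 0 < X) {x : R3}
    (h : X ≤ K * (1 + ‖x‖)) : maxwellian x ≤ C * K * X⁻¹ * weight (-l) x := by
  refine (hm x).trans ?_
  rw [show -(l + 1) = -l + -1 by ring, weight_add, weight_neg 1, weight_one]
  have h1 : 0 < 1 + ‖x‖ := by positivity
  have h2 : (1 + ‖x‖)⁻¹ ≤ K * X⁻¹ := by
    rw [← div_eq_mul_inv, inv_le_iff_one_le_mul₀ h1, div_mul_eq_mul_div, le_div_iff₀ hX, one_mul]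
    exact h
  have := weight_pos (-l) x
  calc C * (weight (-l) x * (1 + ‖x‖)⁻¹) ≤ C * (weight (-l) x * (K * X⁻¹)) := by gcongr
    _ = _ := by ring

/-- These are the collisions to which the slice estimates do not apply: |v| is bounded in terms of
l, or the velocity x at which the Maxwellian sits carries a fixed fraction of the energy of v. -/
theorem one_add_norm_le_of_degenerate {l : ℝ} {v x : R3}
    (h : ¬ (1 ≤ ‖v‖ ∧ 4 * l ≤ ‖v‖ ^ 2) ∨ ‖v‖ ^ 2 ≤ 2 * ‖x‖ ^ 2) :
    1 + ‖v‖ ≤ (2 + √(4 * l)) * (1 + ‖x‖) := by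
  have hs := Real.sqrt_nonneg (4 * l)
  have hx := norm_nonneg x
  have hv := norm_nonneg v
  rcases h with h | h
  · have : ‖v‖ ≤ 1 + √(4 * l) := by
      rw [not_and_or, not_le, not_le] at h
      rcases h with h | h
      · linarith
      · have := Real.le_sqrt_of_sq_le h.le
        linarith
    nlinarith [mul_nonneg hs hx]
  · have : ‖v‖ ≤ 2 * ‖x‖ := by
      apply le_of_sq_le_sq _ (by positivity)
      rw [mul_pow]; linarith [sq_nonneg ‖x‖]
    nlinarith [mul_nonneg hs hx]

theorem measurable_slice {b : ℝ → ℝ} (hb : Measurable b) (γ : ℝ) (v : R3) {W : R3 × S2 → ℝ}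
    (hW : Measurable W) :
    Measurable fun p : R3 × S2 => ENNReal.ofReal (kernel γ b v p.1 p.2) * ENNReal.ofReal (W p) :=
  (measurable_ofReal_kernel hb γ v).mul hW.ennreal_ofReal

/-- Splitting off the degenerate collisions in the gain terms containing a Maxwellian. -/
theorem lintegral_gain_maxwellian_le {b : ℝ → ℝ} {C : ℝ} (hb : IsCutoff b C) {γ : ℝ} {l : ℝ} {v : R3} {c : ℝ} (hc : 0 ≤ c)
    {y z : R3 → S2 → R3} (hy : Measurable fun p : R3 × S2 => y p.1 p.2)
    (hz : Measurable fun p : R3 × S2 => z p.1 p.2) {M : S2 → ℝ≥0∞}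
    (hM : Measurable M)
    (h : ∀ ω, (∫⁻ u, ENNReal.ofReal (kernel γ b v u ω) *
        ENNReal.ofReal (maxwellian (y u ω) * weight (-l) (z u ω)) ≤ M ω) ∨
      ∀ u, maxwellian (y u ω) ≤ c * weight (-l) (y u ω)) :
    ∫⁻ p : R3 × S2, ENNReal.ofReal (kernel γ b v p.1 p.2) *
      ENNReal.ofReal (maxwellian (y p.1 p.2) * weight (-l) (z p.1 p.2)) ∂duDω ≤
    ∫⁻ ω, M ω ∂(volume : Measure R3).toSphere + ENNReal.ofReal c *
      ∫⁻ p : R3 × S2, ENNReal.ofReal (kernel γ b v p.1 p.2) *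
        ENNReal.ofReal (weight (-l) (y p.1 p.2) * weight (-l) (z p.1 p.2)) ∂duDω := by
  rw [lintegral_duDω (F := fun p => _ * _) (measurable_slice hb.meas γ v (by fun_prop)),
    lintegral_duDω (F := fun p => _ * _) (measurable_slice hb.meas γ v (by fun_prop)),
    ← lintegral_const_mul' _ _ ENNReal.ofReal_ne_top, ← lintegral_add_left hM]
  refine lintegral_mono fun ω => ?_
  rcases h ω with h1 | h1
  · exact h1.trans le_self_add
  · refine le_trans ?_ le_add_self
    rw [← lintegral_const_mul' _ _ ENNReal.ofReal_ne_top]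
    refine lintegral_mono fun u => ?_
    rw [mul_left_comm, ← ENNReal.ofReal_mul hc]
    refine mul_le_mul_right (ENNReal.ofReal_le_ofReal ?_) _
    rw [← mul_assoc c]
    exact mul_le_mul_of_nonneg_right (h1 u) (weight_pos _ _).le

theorem one_add_norm_rpow_le (v : R3) {g : ℝ} (hg : g ≤ 1) : (1 + ‖v‖) ^ g ≤ 1 + ‖v‖ :=
  (Real.rpow_le_rpow_of_exponent_le (by linarith [norm_nonneg v]) hg).trans_eq (Real.rpow_one _)

/-- The order of quantifiers is essential: K precedes l while c may depend on l. The coefficient of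
(1+|v|)^γ therefore tends to zero as l grows, and everything produced by degenerate collisions is
placed in c. -/
theorem exists_gain_maxwellian_hard {b : ℝ → ℝ} {C : ℝ} (hb : IsCutoff b C) {γ : ℝ} (hγ : 0 < γ)
    (hγ1 : γ ≤ 1) : ∃ K : ℝ, 0 < K ∧ ∀ l : ℝ, 8 ≤ l → ∃ c : ℝ, 0 < c ∧ ∀ v : R3,
      ∫⁻ p : R3 × S2, ENNReal.ofReal (kernel γ b v p.1 p.2) * ENNReal.ofReal
        (maxwellian (uPost v p.1 p.2) * weight (-l) (vPost v p.1 p.2)) ∂duDω +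
      ∫⁻ p : R3 × S2, ENNReal.ofReal (kernel γ b v p.1 p.2) * ENNReal.ofReal
        (maxwellian (vPost v p.1 p.2) * weight (-l) (uPost v p.1 p.2)) ∂duDω ≤
      ENNReal.ofReal ((K / √(l / 8) * (1 + ‖v‖) ^ γ + c) * weight (-l) v) := by
  have hC := hb.pos
  obtain ⟨C1, hC1, hS1⟩ := sphere_decay_parallel
  obtain ⟨C2, hC2, hS2⟩ := sphere_decay_perp
  have hpi := Real.pi_pos
  refine ⟨C * 32 * Real.pi ^ 3 * C1 + C * 2048 * Real.pi ^ 3 * C2, by positivity, fun l hl => ?_⟩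
  obtain ⟨K, hK, hG⟩ := lintegral_gain_weights hb (by linarith : -3 < γ) hγ1 hl
  obtain ⟨c0, hc0, hm⟩ := exists_maxwellian_le_weight (l + 1)
  refine ⟨2 * (c0 * (2 + √(4 * l)) * K), by positivity, fun v => ?_⟩
  have hX0 : 0 < 1 + ‖v‖ := by positivity
  have hsl : 0 < √(l / 8) := Real.sqrt_pos.2 (by linarith)
  set c := c0 * (2 + √(4 * l)) * (1 + ‖v‖)⁻¹ with hc
  have hcpos : 0 ≤ c := by positivity
  have hw := weight_pos (-l) v
  have hmax : max γ 0 = γ := max_eq_left hγ.le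
  have hrest : ENNReal.ofReal c * ENNReal.ofReal (K * (1 + ‖v‖) ^ (max γ 0) * weight (-l) v) ≤
      ENNReal.ofReal (c0 * (2 + √(4 * l)) * K * weight (-l) v) := by
    rw [← ENNReal.ofReal_mul hcpos]
    apply ENNReal.ofReal_le_ofReal
    rw [hmax, hc]
    have h1 : (1 + ‖v‖)⁻¹ * (1 + ‖v‖) ^ γ ≤ 1 := by
      rw [inv_mul_le_iff₀ hX0, mul_one]; exact one_add_norm_rpow_le v hγ1
    calc _ = c0 * (2 + √(4 * l)) * K * weight (-l) v * ((1 + ‖v‖)⁻¹ * (1 + ‖v‖) ^ γ) := by ring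
      _ ≤ _ := mul_le_of_le_one_right (by positivity) h1
  have hAγ : ‖v‖ ^ γ ≤ (1 + ‖v‖) ^ γ := by gcongr; linarith
  have h1 := lintegral_gain_maxwellian_le hb (γ := γ) (l := l) (v := v) hcpos
    (y := uPost v) (z := vPost v) (by fun_prop) (by fun_prop)
    (M := fun ω => ENNReal.ofReal (C * 32 * Real.pi ^ 3 / √(l / 8) * ‖v‖ ^ γ * weight (-l) v * ‖v‖) *
      ENNReal.ofReal ((1 + (inner ℝ (ω : R3) v) ^ 2)⁻¹)) (by fun_prop) (by
      intro ω
      by_cases h : (1 ≤ ‖v‖ ∧ 4 * l ≤ ‖v‖ ^ 2) ∧ (inner ℝ (ω : R3) v) ^ 2 ≤ ‖v‖ ^ 2 / 2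
      · left; exact gain_slice_parallel hb hγ hγ1 hl h.1.1 h.1.2 h.2
      · right
        intro u
        obtain ⟨e, he⟩ := exists_orthonormalBasis_sphere ω
        refine maxwellian_le_of_le hc0 hm hX0 (one_add_norm_le_of_degenerate (l := l) ?_)
        rw [not_and_or] at h
        refine h.imp id fun h => ?_
        rw [norm_uPost_sq he v u, he]
        nlinarith [sq_nonneg (inner ℝ (e 1) u), sq_nonneg (inner ℝ (e 2) u)])
  have h2 := lintegral_gain_maxwellian_le hb (γ := γ) (l := l) (v := v) hcpos
    (y := vPost v) (z := uPost v) (by fun_prop) (by fun_prop)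
    (M := fun ω => ENNReal.ofReal (C * 2048 * Real.pi ^ 3 / √(l / 8) * ‖v‖ ^ γ * weight (-l) v * ‖v‖ ^ 2) *
      ENNReal.ofReal (((1 + (‖v‖ ^ 2 - (inner ℝ (ω : R3) v) ^ 2)) ^ 2)⁻¹)) (by fun_prop) (by
      intro ω
      by_cases h : (1 ≤ ‖v‖ ∧ 4 * l ≤ ‖v‖ ^ 2) ∧ ‖v‖ ^ 2 - (inner ℝ (ω : R3) v) ^ 2 ≤ ‖v‖ ^ 2 / 2
      · left; exact gain_slice_perp hb hγ hγ1 hl h.1.1 h.1.2 h.2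
      · right
        intro u
        obtain ⟨e, he⟩ := exists_orthonormalBasis_sphere ω
        refine maxwellian_le_of_le hc0 hm hX0 (one_add_norm_le_of_degenerate (l := l) ?_)
        rw [not_and_or] at h
        refine h.imp id fun h => ?_
        rw [← he] at h
        have := norm_sq_eq_basis e v
        rw [norm_vPost_sq he v u]
        nlinarith [sq_nonneg (inner ℝ (e 0) u)])
  rw [lintegral_const_mul _ (by fun_prop)] at h1 h2
  have hsymm : ∫⁻ p : R3 × S2, ENNReal.ofReal (kernel γ b v p.1 p.2) * ENNReal.ofReal
        (weight (-l) (vPost v p.1 p.2) * weight (-l) (uPost v p.1 p.2)) ∂duDω ≤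
        ENNReal.ofReal (K * (1 + ‖v‖) ^ (max γ 0) * weight (-l) v) := by
    simp_rw [mul_comm (weight (-l) (vPost v _ _))]
    exact hG v
  have e1 := h1.trans (add_le_add (mul_le_mul_right (hS1 v) _) ((mul_le_mul_right (hG v) _).trans hrest))
  have e2 := h2.trans (add_le_add (mul_le_mul_right (hS2 v) _) ((mul_le_mul_right hsymm _).trans hrest))
  refine (add_le_add e1 e2).trans ?_
  rw [← ENNReal.ofReal_mul (by positivity), ← ENNReal.ofReal_mul (by positivity),
    ← ENNReal.ofReal_add (by positivity) (by positivity),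
    ← ENNReal.ofReal_add (by positivity) (by positivity),
    ← ENNReal.ofReal_add (by positivity) (by positivity)]
  apply ENNReal.ofReal_le_ofReal
  have f1 : ‖v‖ * (C1 / (1 + ‖v‖)) ≤ C1 := by
    rw [← mul_div_assoc, div_le_iff₀ hX0]; nlinarith
  have f2 : ‖v‖ ^ 2 * (C2 / (1 + ‖v‖) ^ 2) ≤ C2 := by
    rw [← mul_div_assoc, div_le_iff₀ (by positivity), mul_comm]
    gcongr; linarith
  have g1 : C * 32 * Real.pi ^ 3 / √(l / 8) * ‖v‖ ^ γ * weight (-l) v * ‖v‖ * (C1 / (1 + ‖v‖)) ≤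
      C * 32 * Real.pi ^ 3 / √(l / 8) * (1 + ‖v‖) ^ γ * weight (-l) v * C1 := by
    rw [mul_assoc _ ‖v‖]; gcongr
  have g2 : C * 2048 * Real.pi ^ 3 / √(l / 8) * ‖v‖ ^ γ * weight (-l) v * ‖v‖ ^ 2 * (C2 / (1 + ‖v‖) ^ 2) ≤
      C * 2048 * Real.pi ^ 3 / √(l / 8) * (1 + ‖v‖) ^ γ * weight (-l) v * C2 := by
    rw [mul_assoc _ (‖v‖ ^ 2)]; gcongr
  refine (add_le_add (add_le_add_left g1 _) (add_le_add_left g2 _)).trans (le_of_eq ?_)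
  ring

/-- For γ ≤ 0 there is no growth and the whole constant goes into c. For γ > 0 the threshold l ≥
8(K/η)² makes K/√(l/8) ≤ η. -/
theorem exists_gain_maxwellian {b : ℝ → ℝ} {C : ℝ} (hb : IsCutoff b C) {γ : ℝ} (hγ : -3 < γ)
    (hγ1 : γ ≤ 1) {η : ℝ} (hη : 0 < η) : ∃ l₀ : ℝ, 8 ≤ l₀ ∧ ∀ l : ℝ, l₀ ≤ l → ∃ c : ℝ, 0 < c ∧ ∀ v : R3,
      ∫⁻ p : R3 × S2, ENNReal.ofReal (kernel γ b v p.1 p.2) * ENNReal.ofReal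
        (maxwellian (uPost v p.1 p.2) * weight (-l) (vPost v p.1 p.2)) ∂duDω +
      ∫⁻ p : R3 × S2, ENNReal.ofReal (kernel γ b v p.1 p.2) * ENNReal.ofReal
        (maxwellian (vPost v p.1 p.2) * weight (-l) (uPost v p.1 p.2)) ∂duDω ≤
      ENNReal.ofReal ((η * (1 + ‖v‖) ^ (max γ 0) + c) * weight (-l) v) := by
  rcases le_or_gt γ 0 with h0 | h0
  · refine ⟨8, le_rfl, fun l hl => ?_⟩
    obtain ⟨K, hK, hG⟩ := lintegral_gain_weights hb hγ hγ1 hl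
    obtain ⟨c0, hc0, hm⟩ := exists_maxwellian_le_weight l
    refine ⟨2 * c0 * K, by positivity, fun v => ?_⟩
    have hw := weight_pos (-l) v
    have key : ∀ y z : R3 → S2 → R3, ∫⁻ p : R3 × S2, ENNReal.ofReal (kernel γ b v p.1 p.2) * ENNReal.ofReal
        (maxwellian (y p.1 p.2) * weight (-l) (z p.1 p.2)) ∂duDω ≤ ENNReal.ofReal c0 *
        ∫⁻ p : R3 × S2, ENNReal.ofReal (kernel γ b v p.1 p.2) * ENNReal.ofReal
        (weight (-l) (y p.1 p.2) * weight (-l) (z p.1 p.2)) ∂duDω := by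
      intro y z
      rw [← lintegral_const_mul' _ _ ENNReal.ofReal_ne_top]
      refine lintegral_mono fun p => ?_
      rw [mul_left_comm, ← ENNReal.ofReal_mul hc0.le]
      refine mul_le_mul_right (ENNReal.ofReal_le_ofReal ?_) _
      rw [← mul_assoc c0]
      exact mul_le_mul_of_nonneg_right (hm _) (weight_pos _ _).le
    have hsymm : ∫⁻ p : R3 × S2, ENNReal.ofReal (kernel γ b v p.1 p.2) * ENNReal.ofReal
        (weight (-l) (vPost v p.1 p.2) * weight (-l) (uPost v p.1 p.2)) ∂duDω ≤
        ENNReal.ofReal (K * (1 + ‖v‖) ^ (max γ 0) * weight (-l) v) := by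
      simp_rw [mul_comm (weight (-l) (vPost v _ _))]
      exact hG v
    refine (add_le_add ((key (uPost v) (vPost v)).trans (mul_le_mul_right (hG v) _))
      ((key (vPost v) (uPost v)).trans (mul_le_mul_right hsymm _))).trans ?_
    rw [← ENNReal.ofReal_mul hc0.le, ← ENNReal.ofReal_add (by positivity) (by positivity)]
    apply ENNReal.ofReal_le_ofReal
    rw [max_eq_right h0, Real.rpow_zero]
    nlinarith
  · obtain ⟨K, hK, hG⟩ := exists_gain_maxwellian_hard hb h0 hγ1
    refine ⟨max 8 (8 * (K / η) ^ 2), le_max_left _ _, fun l hl => ?_⟩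
    have hl8 : 8 ≤ l := (le_max_left _ _).trans hl
    obtain ⟨c, hc, h⟩ := hG l hl8
    refine ⟨c, hc, fun v => (h v).trans (ENNReal.ofReal_le_ofReal ?_)⟩
    have hw := weight_pos (-l) v
    rw [max_eq_left h0.le]
    have hsl : 0 < √(l / 8) := Real.sqrt_pos.2 (by linarith)
    have : K / √(l / 8) ≤ η := by
      rw [div_le_iff₀ hsl, mul_comm, ← div_le_iff₀ hη]
      apply Real.le_sqrt_of_sq_le
      have := (le_max_right _ _).trans hl
      linarith
    gcongr

end Boltzmann

/-! ### The collision frequency and the weighted bounds -/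

namespace Boltzmann

theorem angle_dir (z : R3) {x : R3} (hx : x ≠ 0) :
    InnerProductGeometry.angle z (dir x : R3) = InnerProductGeometry.angle z x := by
  rw [coe_dir hx]
  exact InnerProductGeometry.angle_smul_right_of_pos _ _ (inv_pos.2 (norm_pos_iff.2 hx))

theorem measurable_angular {b : ℝ → ℝ} (hb : Measurable b) (z : R3) :
    Measurable fun x : R3 => ENNReal.ofReal (b (InnerProductGeometry.angle z x)) := by
  have h : Measurable fun x : R3 => ((z, x) : R3 × R3) := measurable_prodMk_left
  exact (hb.comp (measurable_angle.comp h)).ennreal_ofReal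

/-- The angular integral does not depend on the direction. -/
theorem lintegral_angular_eq {b : ℝ → ℝ} (hb : Measurable b) {z z' : R3} (hz : z ≠ 0)
    (hz' : z' ≠ 0) :
    ∫⁻ ω : S2, ENNReal.ofReal (b (InnerProductGeometry.angle z ω)) ∂(volume : Measure R3).toSphere
      = ∫⁻ ω : S2, ENNReal.ofReal (b (InnerProductGeometry.angle z' ω))
        ∂(volume : Measure R3).toSphere := by
  have hm := measurable_angular hb
  have hs : ∀ y : R3, Measurable fun ω : S2 => ENNReal.ofReal (b (InnerProductGeometry.angle y ω)) :=
    fun y => (hm y).comp measurable_subtype_coe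
  rw [lintegral_sphere (hs z), lintegral_sphere (hs z')]
  congr 1
  have hset : MeasurableSet (Metric.ball (0 : R3) 1 \ {0}) :=
    measurableSet_ball.diff (measurableSet_singleton _)
  have h1 : ∀ y : R3, ∫⁻ x in Metric.ball (0 : R3) 1 \ {0},
      ENNReal.ofReal (b (InnerProductGeometry.angle y (dir x)))
      = ∫⁻ x in Metric.ball (0 : R3) 1 \ {0}, ENNReal.ofReal (b (InnerProductGeometry.angle y x)) :=
    fun y => setLIntegral_congr_fun hset fun x hx => by rw [angle_dir y hx.2]
  rw [h1, h1]
  obtain ⟨e, he⟩ := exists_orthonormalBasis z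
  obtain ⟨e', he'⟩ := exists_orthonormalBasis z'
  -- An isometry taking the direction of z to that of z'; it preserves Lebesgue measure, the
  -- punctured ball and angles.
  set L : R3 ≃ₗᵢ[ℝ] R3 := e.repr.trans e'.repr.symm with hL
  have hLe : L (e 0) = e' 0 := by simp [hL]
  have hmp := L.measurePreserving
  have hpre : L ⁻¹' (Metric.ball (0 : R3) 1 \ {0}) = Metric.ball (0 : R3) 1 \ {0} := by
    ext x; simp
  have h2 : ∀ x, InnerProductGeometry.angle z' (L x) = InnerProductGeometry.angle z x := by
    intro x
    rw [he', InnerProductGeometry.angle_smul_left_of_pos _ _ (norm_pos_iff.2 hz'), ← hLe]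
    conv_rhs => rw [he, InnerProductGeometry.angle_smul_left_of_pos _ _ (norm_pos_iff.2 hz)]
    exact L.toLinearIsometry.angle_map (e 0) x
  rw [← hmp.setLIntegral_comp_preimage hset (hm z'), hpre]
  simp_rw [h2]

theorem lintegral_kernel_eq {b : ℝ → ℝ} (hb : Measurable b) (γ : ℝ) {v u : R3} (h : v ≠ u) :
    ∫⁻ ω : S2, ENNReal.ofReal (kernel γ b v u ω) ∂(volume : Measure R3).toSphere =
      ENNReal.ofReal (‖v - u‖ ^ γ) *
      ∫⁻ ω : S2, ENNReal.ofReal (b (InnerProductGeometry.angle (EuclideanSpace.single 0 1 : R3) ω))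
        ∂(volume : Measure R3).toSphere := by
  have hs : Measurable fun ω : S2 => ENNReal.ofReal (b (InnerProductGeometry.angle (v - u) ω)) :=
    (measurable_angular hb _).comp measurable_subtype_coe
  rw [← lintegral_angular_eq hb (sub_ne_zero.2 h) (by simp), ← lintegral_const_mul _ hs]
  refine lintegral_congr fun ω => ?_
  rw [← ENNReal.ofReal_mul (Real.rpow_nonneg (norm_nonneg _) _)]
  rfl

theorem lintegral_duDω' {F : R3 × S2 → ℝ≥0∞} (hF : Measurable F) :
    ∫⁻ p, F p ∂duDω = ∫⁻ u, ∫⁻ ω, F (u, ω) ∂(volume : Measure R3).toSphere ∂volume :=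
  lintegral_prod _ hF.aemeasurable

/-- Either the collision kernel vanishes almost everywhere or its angular average is positive. -/
theorem kernel_vanishes_of_angular_eq_zero {b : ℝ → ℝ} (hb : Measurable b) (γ : ℝ)
    (h0 : ∫⁻ ω : S2, ENNReal.ofReal (b (InnerProductGeometry.angle (EuclideanSpace.single 0 1 : R3) ω))
        ∂(volume : Measure R3).toSphere = 0) (v : R3) (W : R3 × S2 → ℝ≥0∞) :
    ∫⁻ p : R3 × S2, ENNReal.ofReal (kernel γ b v p.1 p.2) * W p ∂duDω = 0 := by
  have hm := measurable_ofReal_kernel hb γ v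
  have h1 : ∫⁻ p : R3 × S2, ENNReal.ofReal (kernel γ b v p.1 p.2) ∂duDω = 0 := by
    rw [lintegral_duDω' hm, lintegral_eq_zero_iff hm.lintegral_prod_right']
    have : ∀ᵐ u : R3, u ≠ v := by simp [ae_iff]
    filter_upwards [this] with u hu
    rw [lintegral_kernel_eq hb γ hu.symm, h0, mul_zero]; rfl
  rw [lintegral_eq_zero_iff hm] at h1
  rw [lintegral_congr_ae (g := fun _ => 0), lintegral_zero]
  filter_upwards [h1] with p hp
  rw [hp]; simp

theorem lintegral_kernel_maxwellian_le {b : ℝ → ℝ} {C : ℝ} (hb : IsCutoff b C) {γ : ℝ} (hγ : -3 < γ)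
    (hγ1 : γ ≤ 1) : ∃ K : ℝ, 0 < K ∧ ∀ v : R3, ∫⁻ p : R3 × S2,
      ENNReal.ofReal (kernel γ b v p.1 p.2) * ENNReal.ofReal (maxwellian p.1) ∂duDω ≤
        ENNReal.ofReal (K * (1 + ‖v‖) ^ (max γ 0)) := by
  obtain ⟨K, hK, h⟩ := lintegral_loss_weight hb hγ hγ1 (le_refl 9)
  obtain ⟨c, hc, hm⟩ := exists_maxwellian_le_weight 9
  refine ⟨c * K, by positivity, fun v => ?_⟩
  calc _ ≤ ENNReal.ofReal c * ∫⁻ p : R3 × S2, ENNReal.ofReal (kernel γ b v p.1 p.2) *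
          ENNReal.ofReal (weight (-9) p.1) ∂duDω := by
        rw [← lintegral_const_mul' _ _ ENNReal.ofReal_ne_top]
        refine lintegral_mono fun p => ?_
        rw [mul_left_comm, ← ENNReal.ofReal_mul hc.le]
        exact mul_le_mul_right (ENNReal.ofReal_le_ofReal (hm _)) _
    _ ≤ _ := by
        refine (mul_le_mul_right (h v) _).trans (le_of_eq ?_)
        rw [← ENNReal.ofReal_mul hc.le, mul_assoc]

theorem nu_nonneg {b : ℝ → ℝ} {C : ℝ} (hb : IsCutoff b C) (γ : ℝ) (v : R3) : 0 ≤ nu γ b v :=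
  integral_nonneg fun _ => mul_nonneg (kernel_nonneg hb γ v _ _) (maxwellian_pos _).le

theorem integrable_kernel_mul {b : ℝ → ℝ} {C : ℝ} (hb : IsCutoff b C) {γ : ℝ} {v : R3}
    {W : R3 × S2 → ℝ} (hW : Measurable W) (hW0 : ∀ p, 0 ≤ W p)
    (h : ∫⁻ p : R3 × S2, ENNReal.ofReal (kernel γ b v p.1 p.2) * ENNReal.ofReal (W p) ∂duDω ≠ ∞) :
    Integrable (fun p : R3 × S2 => kernel γ b v p.1 p.2 * W p) duDω := by
  refine ⟨((measurable_kernel_right hb.meas γ v).mul hW).aestronglyMeasurable, ?_⟩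
  rw [hasFiniteIntegral_iff_ofReal (Filter.Eventually.of_forall fun p =>
    mul_nonneg (kernel_nonneg hb γ v _ _) (hW0 p))]
  simp_rw [ENNReal.ofReal_mul (kernel_nonneg hb γ v _ _)]
  exact h.lt_top

theorem integral_kernel_mul {b : ℝ → ℝ} {C : ℝ} (hb : IsCutoff b C) {γ : ℝ} {v : R3}
    {W : R3 × S2 → ℝ} (hW : Measurable W) (hW0 : ∀ p, 0 ≤ W p)
    (h : ∫⁻ p : R3 × S2, ENNReal.ofReal (kernel γ b v p.1 p.2) * ENNReal.ofReal (W p) ∂duDω ≠ ∞) :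
    ENNReal.ofReal (∫ p : R3 × S2, kernel γ b v p.1 p.2 * W p ∂duDω) =
      ∫⁻ p : R3 × S2, ENNReal.ofReal (kernel γ b v p.1 p.2) * ENNReal.ofReal (W p) ∂duDω := by
  rw [ofReal_integral_eq_lintegral_ofReal (integrable_kernel_mul hb hW hW0 h)
    (Filter.Eventually.of_forall fun p => mul_nonneg (kernel_nonneg hb γ v _ _) (hW0 p))]
  simp_rw [ENNReal.ofReal_mul (kernel_nonneg hb γ v _ _)]

theorem ofReal_nu {b : ℝ → ℝ} {C : ℝ} (hb : IsCutoff b C) {γ : ℝ} (hγ : -3 < γ)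
    (hγ1 : γ ≤ 1) (v : R3) : ENNReal.ofReal (nu γ b v) = ∫⁻ p : R3 × S2,
      ENNReal.ofReal (kernel γ b v p.1 p.2) * ENNReal.ofReal (maxwellian p.1) ∂duDω := by
  obtain ⟨K, hK, h⟩ := lintegral_kernel_maxwellian_le hb hγ hγ1
  exact integral_kernel_mul hb (W := fun p => maxwellian p.1) (by fun_prop)
    (fun _ => (maxwellian_pos _).le) (ne_top_of_le_ne_top ENNReal.ofReal_ne_top (h v))

/-- For |v| ≥ 2 and |u| < 1 the relative speed is at least (1+|v|)/4, so the part of ν coming from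
the unit ball already grows like (1+|v|)^γ. For bounded v the summand 1 suffices. -/
theorem exists_nu_lower {b : ℝ → ℝ} {C : ℝ} (hb : IsCutoff b C) {γ : ℝ} (hγ : 0 < γ)
    (hγ1 : γ ≤ 1)
    (h0 : ∫⁻ ω : S2, ENNReal.ofReal (b (InnerProductGeometry.angle (EuclideanSpace.single 0 1 : R3) ω))
        ∂(volume : Measure R3).toSphere ≠ 0) :
    ∃ c : ℝ, 0 < c ∧ ∀ v : R3, (1 + ‖v‖) ^ γ ≤ c * (nu γ b v + 1) := by
  set B := ∫⁻ ω : S2, ENNReal.ofReal (b (InnerProductGeometry.angle (EuclideanSpace.single 0 1 : R3) ω))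
        ∂(volume : Measure R3).toSphere with hB
  set m := ∫⁻ u in Metric.ball (0 : R3) 1, ENNReal.ofReal (maxwellian u) with hm
  have hm0 : m ≠ 0 := by
    rw [hm, Ne, setLIntegral_eq_zero_iff measurableSet_ball (by fun_prop)]
    intro h
    have h1 : ∀ᵐ x : R3, x ∉ Metric.ball (0 : R3) 1 := by
      filter_upwards [h] with x hx hx1
      have := hx hx1
      rw [ENNReal.ofReal_eq_zero] at this
      exact absurd this (not_le.2 (maxwellian_pos x))
    rw [ae_iff] at h1
    simp only [not_not, ofPred_mem_eq] at h1
    exact (Metric.measure_ball_pos volume (0 : R3) one_pos).ne' h1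
  have key : ∀ v : R3, 2 ≤ ‖v‖ → ENNReal.ofReal (((1 + ‖v‖) / 4) ^ γ) * (B * m)
      ≤ ENNReal.ofReal (nu γ b v) := by
    intro v hv
    have hmeas := measurable_slice hb.meas γ v (W := fun p => maxwellian p.1) (by fun_prop)
    rw [ofReal_nu hb (by linarith) hγ1, lintegral_duDω' (F := fun p => _ * _) hmeas, hm,
      ← lintegral_const_mul _ (by fun_prop), ← lintegral_const_mul _ (by fun_prop)]
    refine le_trans ?_ (setLIntegral_le_lintegral (Metric.ball (0 : R3) 1) _)
    refine setLIntegral_mono' measurableSet_ball fun u hu => ?_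
    rw [mem_ball_zero_iff] at hu
    have hne : v ≠ u := by rintro rfl; linarith
    have hd : (1 + ‖v‖) / 4 ≤ ‖v - u‖ := by
      have := norm_sub_norm_le v u
      linarith
    simp only
    have hs : Measurable fun ω : S2 => ENNReal.ofReal (kernel γ b v u ω) :=
      (measurable_kernel_comp hb.meas γ measurable_const measurable_const measurable_id).ennreal_ofReal
    rw [lintegral_mul_const _ hs,
      lintegral_kernel_eq hb.meas γ hne, ← mul_assoc]
    gcongr
  have hBm : ∃ q : ℝ, 0 < q ∧ ENNReal.ofReal q ≤ B * m := by
    obtain ⟨r, hr0, hr1⟩ := ENNReal.lt_iff_exists_nnreal_btwn.1 (pos_iff_ne_zero.2 (mul_ne_zero h0 hm0))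
    exact ⟨r, by exact_mod_cast hr0, by rw [ENNReal.ofReal_coe_nnreal]; exact hr1.le⟩
  obtain ⟨q, hq, hqB⟩ := hBm
  refine ⟨4 / q + 3, by positivity, fun v => ?_⟩
  have hν := nu_nonneg hb γ v
  rcases le_or_gt ‖v‖ 2 with hv | hv
  · have h1 := one_add_norm_rpow_le v hγ1
    have : 0 ≤ 4 / q := by positivity
    nlinarith
  · have h1 := (mul_le_mul_right hqB _).trans (key v hv.le)
    rw [← ENNReal.ofReal_mul (by positivity), ENNReal.ofReal_le_ofReal_iff hν,
      Real.div_rpow (by positivity) (by norm_num)] at h1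
    have h4 : (4 : ℝ) ^ γ ≤ 4 := by
      calc (4 : ℝ) ^ γ ≤ 4 ^ (1 : ℝ) := Real.rpow_le_rpow_of_exponent_le (by norm_num) hγ1
        _ = 4 := Real.rpow_one _
    have hP : 0 < (1 + ‖v‖) ^ γ := by positivity
    have h5 : (1 + ‖v‖) ^ γ / 4 * q ≤ nu γ b v := by
      refine le_trans ?_ h1
      gcongr
    have h6 : (1 + ‖v‖) ^ γ ≤ 4 / q * nu γ b v := by
      rw [div_mul_eq_mul_div, le_div_iff₀ hq]; linarith
    have : 0 ≤ 4 / q := by positivity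
    nlinarith

/-- The weighted estimates of the linearized and quadratic collision operators. -/
structure WeightBound (γ : ℝ) (b : ℝ → ℝ) (l K : ℝ) : Prop where
  linear : ∀ v : R3, ∫⁻ p : R3 × S2, ENNReal.ofReal (kernel γ b v p.1 p.2) * ENNReal.ofReal
    (maxwellian (uPost v p.1 p.2) * weight (-l) (vPost v p.1 p.2) +
      maxwellian (vPost v p.1 p.2) * weight (-l) (uPost v p.1 p.2) +
      maxwellian v * weight (-l) p.1) ∂duDω ≤
    ENNReal.ofReal ((nu γ b v / 8 + K) * weight (-l) v)
  quadratic : ∀ v : R3, ∫⁻ p : R3 × S2, ENNReal.ofReal (kernel γ b v p.1 p.2) * ENNReal.ofReal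
    (weight (-l) (uPost v p.1 p.2) * weight (-l) (vPost v p.1 p.2) +
      weight (-l) p.1 * weight (-l) v) ∂duDω ≤
    ENNReal.ofReal (K * (nu γ b v + 1) * weight (-l) v)
  nu_le : ∀ v : R3, nu γ b v ≤ K * (1 + ‖v‖)

theorem exists_nu_le {b : ℝ → ℝ} {C : ℝ} (hb : IsCutoff b C) {γ : ℝ} (hγ : -3 < γ)
    (hγ1 : γ ≤ 1) : ∃ K : ℝ, 0 < K ∧ ∀ v : R3, nu γ b v ≤ K * (1 + ‖v‖) := by
  obtain ⟨K, hK, h⟩ := lintegral_kernel_maxwellian_le hb hγ hγ1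
  refine ⟨K, hK, fun v => ?_⟩
  have h1 := h v
  rw [← ofReal_nu hb hγ hγ1, ENNReal.ofReal_le_ofReal_iff (by positivity)] at h1
  refine h1.trans ?_
  gcongr
  exact one_add_norm_rpow_le v (max_le hγ1 zero_le_one)

/-- Unless the kernel is null, (1+|v|)^{max γ 0} ≤ c(ν+1). Choosing η = 1/(8c) in the gain estimate
converts its growth into ν/8 plus a constant. The loss part of 𝒦 carries the factor μ(v), which
beats all growth. A null kernel makes the integral bounds trivial. -/
theorem exists_weightBound {b : ℝ → ℝ} {C : ℝ} (hb : IsCutoff b C) {γ : ℝ} (hγ : -3 < γ)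
    (hγ1 : γ ≤ 1) : ∃ l₀ : ℝ, 0 < l₀ ∧ ∀ l : ℝ, l₀ ≤ l → ∃ K : ℝ, 0 < K ∧ WeightBound γ b l K := by
  obtain ⟨Kν, hKν, hνle⟩ := exists_nu_le hb hγ hγ1
  have hzero : (∃ c : ℝ, 0 < c ∧ ∀ v : R3, (1 + ‖v‖) ^ (max γ 0) ≤ c * (nu γ b v + 1)) ∨
      ∀ (v : R3) (W : R3 × S2 → ℝ≥0∞),
        ∫⁻ p : R3 × S2, ENNReal.ofReal (kernel γ b v p.1 p.2) * W p ∂duDω = 0 := by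
    rcases le_or_gt γ 0 with h0 | h0
    · left
      refine ⟨1, one_pos, fun v => ?_⟩
      rw [max_eq_right h0, Real.rpow_zero]
      linarith [nu_nonneg hb γ v]
    · by_cases hB : ∫⁻ ω : S2, ENNReal.ofReal (b (InnerProductGeometry.angle
          (EuclideanSpace.single 0 1 : R3) ω)) ∂(volume : Measure R3).toSphere = 0
      · right; exact fun v W => kernel_vanishes_of_angular_eq_zero hb.meas γ hB v W
      · left; rw [max_eq_left h0.le]; exact exists_nu_lower hb h0 hγ1 hB
  rcases hzero with ⟨c, hc, hcν⟩ | hz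
  · obtain ⟨l₀, hl₀, hG⟩ := exists_gain_maxwellian hb hγ hγ1 (η := 1 / (8 * c)) (by positivity)
    -- Adding 1 to l₀ ≥ 8 secures l ≥ 9, needed for the loss term.
    refine ⟨l₀ + 1, by linarith, fun l hl => ?_⟩
    obtain ⟨c1, hc1, hlin⟩ := hG l (by linarith)
    obtain ⟨c2, hc2, hquad⟩ := lintegral_gain_weights hb hγ hγ1 (l := l) (by linarith)
    obtain ⟨c3, hc3, hloss⟩ := lintegral_loss_weight hb hγ hγ1 (l := l) (by linarith)
    obtain ⟨c4, hc4, hmax⟩ := exists_maxwellian_le_weight (l + 1)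
    have hw := fun v => weight_pos (-l) v
    have hX : ∀ v : R3, 0 < (1 + ‖v‖) ^ (max γ 0) := fun v => by positivity
    have hm1 : ∀ v : R3, maxwellian v * (1 + ‖v‖) ^ (max γ 0) ≤ c4 * weight (-l) v := by
      intro v
      have h1 := one_add_norm_rpow_le v (max_le hγ1 zero_le_one : max γ 0 ≤ 1)
      have h2 := hmax v
      rw [show -(l + 1) = -l + -1 by ring, weight_add, weight_neg 1, weight_one] at h2
      have h3 : 0 < 1 + ‖v‖ := by positivity
      calc maxwellian v * (1 + ‖v‖) ^ (max γ 0)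
          ≤ (c4 * (weight (-l) v * (1 + ‖v‖)⁻¹)) * (1 + ‖v‖) :=
            mul_le_mul h2 h1 (hX v).le ((maxwellian_pos v).le.trans h2)
        _ = c4 * weight (-l) v := by field_simp
    have hlossm : ∀ (v : R3) (a : ℝ), 0 ≤ a → ∫⁻ p : R3 × S2, ENNReal.ofReal (kernel γ b v p.1 p.2) *
        ENNReal.ofReal (a * weight (-l) p.1) ∂duDω ≤
        ENNReal.ofReal (a * (c3 * (1 + ‖v‖) ^ (max γ 0))) := by
      intro v a ha
      simp_rw [ENNReal.ofReal_mul ha, mul_left_comm _ (ENNReal.ofReal a)]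
      rw [lintegral_const_mul' _ _ ENNReal.ofReal_ne_top]
      exact mul_le_mul_right (hloss v) _
    refine ⟨1 / 8 + c1 + c3 * c4 + c2 * c + c3 * c + Kν, by positivity, ?_, ?_, ?_⟩
    · intro v
      have hp := maxwellian_pos
      have hν := nu_nonneg hb γ v
      calc _ = ∫⁻ p : R3 × S2, ENNReal.ofReal (kernel γ b v p.1 p.2) * ENNReal.ofReal
                (maxwellian (uPost v p.1 p.2) * weight (-l) (vPost v p.1 p.2)) ∂duDω +
              ∫⁻ p : R3 × S2, ENNReal.ofReal (kernel γ b v p.1 p.2) * ENNReal.ofReal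
                (maxwellian (vPost v p.1 p.2) * weight (-l) (uPost v p.1 p.2)) ∂duDω +
              ∫⁻ p : R3 × S2, ENNReal.ofReal (kernel γ b v p.1 p.2) *
                ENNReal.ofReal (maxwellian v * weight (-l) p.1) ∂duDω := by
            rw [← lintegral_add_left (measurable_slice hb.meas γ v (by fun_prop)),
              ← lintegral_add_right _ (measurable_slice hb.meas γ v (by fun_prop))]
            refine lintegral_congr fun p => ?_
            have q1 := mul_pos (hp (uPost v p.1 p.2)) (hw (vPost v p.1 p.2))
            have q2 := mul_pos (hp (vPost v p.1 p.2)) (hw (uPost v p.1 p.2))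
            have q3 := mul_pos (hp v) (hw p.1)
            rw [ENNReal.ofReal_add (add_pos q1 q2).le q3.le, ENNReal.ofReal_add q1.le q2.le,
              mul_add, mul_add]
        _ ≤ ENNReal.ofReal ((1 / (8 * c) * (1 + ‖v‖) ^ (max γ 0) + c1) * weight (-l) v) +
              ENNReal.ofReal (maxwellian v * (c3 * (1 + ‖v‖) ^ (max γ 0))) :=
            add_le_add (hlin v) (hlossm v _ (hp v).le)
        _ ≤ _ := by
            have h1 := hX v
            have h2 := hp v
            have h3 := hw v
            rw [← ENNReal.ofReal_add (by positivity) (by positivity)]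
            apply ENNReal.ofReal_le_ofReal
            have h4 : 1 / (8 * c) * (1 + ‖v‖) ^ (max γ 0) ≤ nu γ b v / 8 + 1 / 8 := by
              rw [div_mul_eq_mul_div, one_mul, div_le_iff₀ (by positivity)]
              linarith [hcν v]
            have h5 : maxwellian v * (c3 * (1 + ‖v‖) ^ (max γ 0)) ≤ c3 * c4 * weight (-l) v := by
              have := mul_le_mul_of_nonneg_left (hm1 v) hc3.le
              linarith
            calc _ ≤ (nu γ b v / 8 + 1 / 8 + c1) * weight (-l) v + c3 * c4 * weight (-l) v := by gcongr
              _ = (nu γ b v / 8 + (1 / 8 + c1 + c3 * c4)) * weight (-l) v := by ring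
              _ ≤ _ := by
                refine mul_le_mul_of_nonneg_right ?_ h3.le
                have : 0 ≤ c2 * c + c3 * c + Kν := by positivity
                linarith
    · intro v
      have hν := nu_nonneg hb γ v
      calc _ = ∫⁻ p : R3 × S2, ENNReal.ofReal (kernel γ b v p.1 p.2) * ENNReal.ofReal
                (weight (-l) (uPost v p.1 p.2) * weight (-l) (vPost v p.1 p.2)) ∂duDω +
              ∫⁻ p : R3 × S2, ENNReal.ofReal (kernel γ b v p.1 p.2) *
                ENNReal.ofReal (weight (-l) v * weight (-l) p.1) ∂duDω := by
            rw [← lintegral_add_left (measurable_slice hb.meas γ v (by fun_prop))]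
            refine lintegral_congr fun p => ?_
            have q1 := mul_pos (hw (uPost v p.1 p.2)) (hw (vPost v p.1 p.2))
            have q3 := mul_pos (hw p.1) (hw v)
            rw [ENNReal.ofReal_add q1.le q3.le, mul_add, mul_comm (weight (-l) v)]
        _ ≤ ENNReal.ofReal (c2 * (1 + ‖v‖) ^ (max γ 0) * weight (-l) v) +
              ENNReal.ofReal (weight (-l) v * (c3 * (1 + ‖v‖) ^ (max γ 0))) :=
            add_le_add (hquad v) (hlossm v _ (hw v).le)
        _ ≤ _ := by
            have h1 := hX v
            have h3 := hw v
            rw [← ENNReal.ofReal_add (by positivity) (by positivity)]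
            apply ENNReal.ofReal_le_ofReal
            calc _ = (c2 + c3) * (1 + ‖v‖) ^ (max γ 0) * weight (-l) v := by ring
              _ ≤ (c2 + c3) * (c * (nu γ b v + 1)) * weight (-l) v := by gcongr; exact hcν v
              _ = (c2 * c + c3 * c) * (nu γ b v + 1) * weight (-l) v := by ring
              _ ≤ _ := by
                refine mul_le_mul_of_nonneg_right (mul_le_mul_of_nonneg_right ?_ (by positivity))
                  h3.le
                have : 0 ≤ 1 / 8 + c1 + c3 * c4 + Kν := by positivity
                linarith
    · intro v
      refine (hνle v).trans ?_
      refine mul_le_mul_of_nonneg_right ?_ (by positivity)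
      have : 0 ≤ 1 / 8 + c1 + c3 * c4 + c2 * c + c3 * c := by positivity
      linarith
  · refine ⟨1, one_pos, fun l _ => ⟨Kν, hKν, fun v => ?_, fun v => ?_, hνle⟩⟩
    · rw [hz v]; exact bot_le
    · rw [hz v]; exact bot_le

end Boltzmann

/-! ### Bounds for 𝒦 and Q on weighted functions, and their sign structure -/

namespace Boltzmann

theorem WeightBound.mono {γ : ℝ} {b : ℝ → ℝ} {C : ℝ} (hb : IsCutoff b C) {l K K' : ℝ}
    (h : WeightBound γ b l K) (hK : K ≤ K') : WeightBound γ b l K' := by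
  refine ⟨fun v => (h.linear v).trans ?_, fun v => (h.quadratic v).trans ?_,
    fun v => (h.nu_le v).trans ?_⟩
  · have := (weight_pos (-l) v).le
    gcongr
  · have := (weight_pos (-l) v).le
    have := nu_nonneg hb γ v
    gcongr
  · gcongr

/-- The nonlinear part `𝒦 f + Q(f, f)` of the perturbed equation. -/
noncomputable def source (γ : ℝ) (b : ℝ → ℝ) (f : R3 → ℝ) (v : R3) : ℝ :=
  linearK γ b f v + collision γ b f f v

variable {γ : ℝ} {b : ℝ → ℝ} {C l K : ℝ}

theorem integrable_kernel_of_abs_le (hb : IsCutoff b C) {v : R3} {W φ : R3 × S2 → ℝ} {D c : ℝ}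
    (hφm : Measurable φ) (hW : Measurable W) (hW0 : ∀ p, 0 ≤ W p)
    (h : ∫⁻ p : R3 × S2, ENNReal.ofReal (kernel γ b v p.1 p.2) * ENNReal.ofReal (W p) ∂duDω
      ≤ ENNReal.ofReal c) (hφ : ∀ p, |φ p| ≤ D * W p) :
    Integrable (fun p : R3 × S2 => kernel γ b v p.1 p.2 * φ p) duDω := by
  have h1 := (integrable_kernel_mul hb hW hW0
    (ne_top_of_le_ne_top ENNReal.ofReal_ne_top h)).const_mul D
  refine h1.mono' ((measurable_kernel_right hb.meas γ v).mul hφm).aestronglyMeasurable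
    (Filter.Eventually.of_forall fun p => ?_)
  rw [Real.norm_eq_abs, abs_mul, abs_of_nonneg (kernel_nonneg hb γ v _ _), mul_left_comm]
  exact mul_le_mul_of_nonneg_left (hφ p) (kernel_nonneg hb γ v _ _)

theorem integral_kernel_le (hb : IsCutoff b C) {v : R3} {W φ : R3 × S2 → ℝ} {D c : ℝ}
    (hφi : Integrable (fun p : R3 × S2 => kernel γ b v p.1 p.2 * φ p) duDω)
    (hW : Measurable W) (hW0 : ∀ p, 0 ≤ W p) (hD : 0 ≤ D) (hc : 0 ≤ c)
    (h : ∫⁻ p : R3 × S2, ENNReal.ofReal (kernel γ b v p.1 p.2) * ENNReal.ofReal (W p) ∂duDω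
      ≤ ENNReal.ofReal c) (hφ : ∀ p, φ p ≤ D * W p) :
    ∫ p : R3 × S2, kernel γ b v p.1 p.2 * φ p ∂duDω ≤ D * c := by
  have h0 := ne_top_of_le_ne_top ENNReal.ofReal_ne_top h
  have h1 := integrable_kernel_mul hb hW hW0 h0
  have h2 := integral_kernel_mul hb hW hW0 h0
  rw [← h2, ENNReal.ofReal_le_ofReal_iff hc] at h
  calc _ ≤ ∫ p : R3 × S2, D * (kernel γ b v p.1 p.2 * W p) ∂duDω := by
        refine integral_mono hφi (h1.const_mul D) fun p => ?_
        have := mul_le_mul_of_nonneg_left (hφ p) (kernel_nonneg hb γ v p.1 p.2)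
        simp only
        linarith
    _ = D * ∫ p : R3 × S2, kernel γ b v p.1 p.2 * W p ∂duDω := integral_const_mul _ _
    _ ≤ _ := mul_le_mul_of_nonneg_left h hD

theorem abs_integral_kernel_le (hb : IsCutoff b C) {v : R3} {W φ : R3 × S2 → ℝ} {D c : ℝ}
    (hφi : Integrable (fun p : R3 × S2 => kernel γ b v p.1 p.2 * φ p) duDω)
    (hW : Measurable W) (hW0 : ∀ p, 0 ≤ W p) (hD : 0 ≤ D) (hc : 0 ≤ c)
    (h : ∫⁻ p : R3 × S2, ENNReal.ofReal (kernel γ b v p.1 p.2) * ENNReal.ofReal (W p) ∂duDω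
      ≤ ENNReal.ofReal c) (hφ : ∀ p, |φ p| ≤ D * W p) :
    |∫ p : R3 × S2, kernel γ b v p.1 p.2 * φ p ∂duDω| ≤ D * c := by
  rw [abs_le]
  constructor
  · rw [neg_le, ← integral_neg]
    simp_rw [← mul_neg]
    refine integral_kernel_le hb ?_ hW hW0 hD hc h fun p => (neg_le_abs _).trans (hφ p)
    exact hφi.neg.congr (Filter.Eventually.of_forall fun p => (mul_neg _ _).symm)
  · exact integral_kernel_le hb hφi hW hW0 hD hc h fun p => (le_abs_self _).trans (hφ p)

/-- The weight dominating the linearized operator. -/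
noncomputable def linearWeight (l : ℝ) (v : R3) (p : R3 × S2) : ℝ :=
  maxwellian (uPost v p.1 p.2) * weight (-l) (vPost v p.1 p.2) +
    maxwellian (vPost v p.1 p.2) * weight (-l) (uPost v p.1 p.2) + maxwellian v * weight (-l) p.1

/-- The weight dominating the quadratic operator. -/
noncomputable def quadraticWeight (l : ℝ) (v : R3) (p : R3 × S2) : ℝ :=
  weight (-l) (uPost v p.1 p.2) * weight (-l) (vPost v p.1 p.2) + weight (-l) p.1 * weight (-l) v

theorem measurable_linearWeight (l : ℝ) (v : R3) : Measurable (linearWeight l v) := by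
  unfold linearWeight; fun_prop

theorem measurable_quadraticWeight (l : ℝ) (v : R3) : Measurable (quadraticWeight l v) := by
  unfold quadraticWeight; fun_prop

theorem linearWeight_nonneg (l : ℝ) (v : R3) (p : R3 × S2) : 0 ≤ linearWeight l v p := by
  have h1 := fun v => (maxwellian_pos v).le
  have h2 := fun v => (weight_pos (-l) v).le
  exact add_nonneg (add_nonneg (mul_nonneg (h1 _) (h2 _)) (mul_nonneg (h1 _) (h2 _)))
    (mul_nonneg (h1 _) (h2 _))

theorem quadraticWeight_nonneg (l : ℝ) (v : R3) (p : R3 × S2) : 0 ≤ quadraticWeight l v p := by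
  have h2 := fun v => (weight_pos (-l) v).le
  exact add_nonneg (mul_nonneg (h2 _) (h2 _)) (mul_nonneg (h2 _) (h2 _))

theorem linearCoeff_nonneg (hb : IsCutoff b C) (hK : 0 ≤ K) (v : R3) :
    0 ≤ (nu γ b v / 8 + K) * weight (-l) v := by
  have := nu_nonneg hb γ v
  have := (weight_pos (-l) v).le
  positivity

theorem quadraticCoeff_nonneg (hb : IsCutoff b C) (hK : 0 ≤ K) (v : R3) :
    0 ≤ K * (nu γ b v + 1) * weight (-l) v := by
  have := nu_nonneg hb γ v
  have := (weight_pos (-l) v).le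
  positivity

theorem abs_linear_le {f : R3 → ℝ} {D : ℝ} (hfD : ∀ v, |f v| ≤ D * weight (-l) v) (v : R3)
    (p : R3 × S2) :
    |maxwellian (uPost v p.1 p.2) * f (vPost v p.1 p.2)
      + maxwellian (vPost v p.1 p.2) * f (uPost v p.1 p.2) - maxwellian v * f p.1|
      ≤ D * linearWeight l v p := by
  have h : ∀ x y, |maxwellian x * f y| ≤ D * (maxwellian x * weight (-l) y) := fun x y => by
    rw [abs_mul, abs_of_pos (maxwellian_pos x), mul_left_comm]
    exact mul_le_mul_of_nonneg_left (hfD y) (maxwellian_pos x).le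
  refine (abs_sub _ _).trans ((add_le_add (abs_add_le _ _) le_rfl).trans ?_)
  refine (add_le_add (add_le_add (h _ _) (h _ _)) (h _ _)).trans (le_of_eq ?_)
  unfold linearWeight; ring

theorem abs_quadratic_le {f g : R3 → ℝ} {A D : ℝ} (hfA : ∀ v, |f v| ≤ A * weight (-l) v)
    (hgD : ∀ v, |g v| ≤ D * weight (-l) v) (v : R3) (p : R3 × S2) :
    |f (uPost v p.1 p.2) * g (vPost v p.1 p.2) - f p.1 * g v| ≤ A * D * quadraticWeight l v p := by
  have h : ∀ x y, |f x * g y| ≤ A * D * (weight (-l) x * weight (-l) y) := fun x y => by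
    rw [abs_mul]
    refine (mul_le_mul (hfA x) (hgD y) (abs_nonneg _) ((abs_nonneg _).trans (hfA x))).trans
      (le_of_eq (by ring))
  refine (abs_sub _ _).trans ((add_le_add (h _ _) (h _ _)).trans (le_of_eq ?_))
  unfold quadraticWeight; ring

theorem WeightBound.integrable_linearIntegrand (hb : IsCutoff b C) (h : WeightBound γ b l K)
    {f : R3 → ℝ} (hf : Measurable f) {D : ℝ} (hfD : ∀ v, |f v| ≤ D * weight (-l) v) (v : R3) :
    Integrable (linearIntegrand γ b f v) duDω :=
  integrable_kernel_of_abs_le hb (by fun_prop) (measurable_linearWeight l v)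
    (linearWeight_nonneg l v) (h.linear v) (abs_linear_le hfD v)

theorem WeightBound.integrable_collisionIntegrand (hb : IsCutoff b C) (h : WeightBound γ b l K)
    {f g : R3 → ℝ} (hf : Measurable f) (hg : Measurable g) {A D : ℝ}
    (hfA : ∀ v, |f v| ≤ A * weight (-l) v) (hgD : ∀ v, |g v| ≤ D * weight (-l) v) (v : R3) :
    Integrable (collisionIntegrand γ b f g v) duDω :=
  integrable_kernel_of_abs_le hb (by fun_prop) (measurable_quadraticWeight l v)
    (quadraticWeight_nonneg l v) (h.quadratic v) (abs_quadratic_le hfA hgD v)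

theorem const_nonneg_of_abs_le {f : R3 → ℝ} {D : ℝ} (hfD : ∀ v, |f v| ≤ D * weight (-l) v) :
    0 ≤ D :=
  nonneg_of_mul_nonneg_left ((abs_nonneg _).trans (hfD 0)) (weight_pos _ _)

theorem WeightBound.abs_linearK_le (hb : IsCutoff b C) (h : WeightBound γ b l K) (hK : 0 ≤ K)
    {f : R3 → ℝ} (hf : Measurable f) {D : ℝ} (hfD : ∀ v, |f v| ≤ D * weight (-l) v) (v : R3) :
    |linearK γ b f v| ≤ (nu γ b v / 8 + K) * (D * weight (-l) v) := by
  refine (abs_integral_kernel_le hb (h.integrable_linearIntegrand hb hf hfD v)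
    (measurable_linearWeight l v) (linearWeight_nonneg l v) (const_nonneg_of_abs_le hfD)
    (linearCoeff_nonneg hb hK v) (h.linear v) (abs_linear_le hfD v)).trans (le_of_eq (by ring))

theorem WeightBound.abs_collision_le (hb : IsCutoff b C) (h : WeightBound γ b l K) (hK : 0 ≤ K)
    {f g : R3 → ℝ} (hf : Measurable f) (hg : Measurable g) {A D : ℝ}
    (hfA : ∀ v, |f v| ≤ A * weight (-l) v) (hgD : ∀ v, |g v| ≤ D * weight (-l) v) (v : R3) :
    |collision γ b f g v| ≤ A * K * (nu γ b v + 1) * (D * weight (-l) v) :=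
  (abs_integral_kernel_le hb (h.integrable_collisionIntegrand hb hf hg hfA hgD v)
    (measurable_quadraticWeight l v) (quadraticWeight_nonneg l v)
    (mul_nonneg (const_nonneg_of_abs_le hfA) (const_nonneg_of_abs_le hgD))
    (quadraticCoeff_nonneg hb hK v) (h.quadratic v) (abs_quadratic_le hfA hgD v)).trans
    (le_of_eq (by ring))

/-- The Lipschitz estimate of the nonlinear part. -/
theorem WeightBound.abs_source_sub_le (hb : IsCutoff b C) (h : WeightBound γ b l K) (hK : 0 ≤ K)
    {f g : R3 → ℝ} (hf : Measurable f) (hg : Measurable g) {A D : ℝ}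
    (hfA : ∀ v, |f v| ≤ A * weight (-l) v) (hgA : ∀ v, |g v| ≤ A * weight (-l) v)
    (hD : ∀ v, |f v - g v| ≤ D * weight (-l) v) (v : R3) :
    |source γ b f v - source γ b g v| ≤
      ((1 / 8 + 2 * A * K) * nu γ b v + (K + 2 * A * K)) * (D * weight (-l) v) := by
  have hfg : Measurable fun v => f v - g v := hf.sub hg
  have e1 : linearK γ b f v - linearK γ b g v = linearK γ b (fun v => f v - g v) v := by
    unfold linearK
    rw [← integral_sub (h.integrable_linearIntegrand hb hf hfA v)
      (h.integrable_linearIntegrand hb hg hgA v)]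
    refine integral_congr_ae (Filter.Eventually.of_forall fun p => ?_)
    simp only [linearIntegrand]; ring
  have e2 : collision γ b f f v - collision γ b g g v =
      collision γ b f (fun v => f v - g v) v + collision γ b (fun v => f v - g v) g v := by
    unfold collision
    rw [← integral_sub (h.integrable_collisionIntegrand hb hf hf hfA hfA v)
      (h.integrable_collisionIntegrand hb hg hg hgA hgA v),
      ← integral_add (h.integrable_collisionIntegrand hb hf hfg hfA hD v)
      (h.integrable_collisionIntegrand hb hfg hg hD hgA v)]
    refine integral_congr_ae (Filter.Eventually.of_forall fun p => ?_)
    simp only [collisionIntegrand]; ring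
  have h1 := abs_le.1 (h.abs_linearK_le hb hK hfg hD v)
  have h2 := abs_le.1 (h.abs_collision_le hb hK hf hfg hfA hD v)
  have h3 := abs_le.1 (h.abs_collision_le hb hK hfg hg hD hgA v)
  have e3 : source γ b f v - source γ b g v = (linearK γ b f v - linearK γ b g v) +
      (collision γ b f f v - collision γ b g g v) := by unfold source; ring
  rw [e3, e1, e2, abs_le]
  constructor <;> linarith

theorem source_zero (v : R3) : source γ b (fun _ => 0) v = 0 := by
  simp [source, linearK, collision, linearIntegrand, collisionIntegrand]

theorem WeightBound.abs_source_le (hb : IsCutoff b C) (h : WeightBound γ b l K) (hK : 0 ≤ K)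
    {f : R3 → ℝ} (hf : Measurable f) {A : ℝ} (hfA : ∀ v, |f v| ≤ A * weight (-l) v) (v : R3) :
    |source γ b f v| ≤
      ((1 / 8 + 2 * A * K) * nu γ b v + (K + 2 * A * K)) * (A * weight (-l) v) := by
  have h1 := h.abs_source_sub_le hb hK hf (measurable_const (a := (0 : ℝ))) hfA
    (fun v => by
      rw [abs_zero]; exact mul_nonneg (const_nonneg_of_abs_le hfA) (weight_pos _ _).le)
    (fun v => by simpa using hfA v) v
  rwa [source_zero, sub_zero] at h1

/-- The gain-loss form of the collision operator in terms of `F = μ + f`. -/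
theorem WeightBound.nu_add_source (hb : IsCutoff b C) (hγ : -3 < γ) (hγ1 : γ ≤ 1)
    (h : WeightBound γ b l K) {f : R3 → ℝ} (hf : Measurable f) {A : ℝ}
    (hfA : ∀ v, |f v| ≤ A * weight (-l) v) (v : R3) :
    Integrable (fun p : R3 × S2 => kernel γ b v p.1 p.2 *
      ((maxwellian (uPost v p.1 p.2) + f (uPost v p.1 p.2)) *
        (maxwellian (vPost v p.1 p.2) + f (vPost v p.1 p.2)) - f p.1 * (maxwellian v + f v))) duDω ∧
    nu γ b v * maxwellian v + source γ b f v = ∫ p : R3 × S2, kernel γ b v p.1 p.2 *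
      ((maxwellian (uPost v p.1 p.2) + f (uPost v p.1 p.2)) *
        (maxwellian (vPost v p.1 p.2) + f (vPost v p.1 p.2)) - f p.1 * (maxwellian v + f v))
      ∂duDω := by
  have h1 := h.integrable_linearIntegrand hb hf hfA v
  have h2 := h.integrable_collisionIntegrand hb hf hf hfA hfA v
  have h3 : Integrable (fun p : R3 × S2 => kernel γ b v p.1 p.2 * maxwellian p.1) duDω := by
    obtain ⟨K, hK, h⟩ := lintegral_kernel_maxwellian_le hb hγ hγ1
    exact integrable_kernel_mul hb (W := fun p => maxwellian p.1) (by fun_prop)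
      (fun _ => (maxwellian_pos _).le) (ne_top_of_le_ne_top ENNReal.ofReal_ne_top (h v))
  have h4 := ((h3.mul_const (maxwellian v)).add (h1.add h2))
  -- With F = μ+f the left side is Q(F,F) + νF: adding νF removes μ(u)F(v) from the loss term and
  -- leaves f(u)F(v). The pure Maxwellian terms match because μ(u')μ(v') = μ(u)μ(v).
  have e : (fun p : R3 × S2 => kernel γ b v p.1 p.2 *
      ((maxwellian (uPost v p.1 p.2) + f (uPost v p.1 p.2)) *
        (maxwellian (vPost v p.1 p.2) + f (vPost v p.1 p.2)) - f p.1 * (maxwellian v + f v))) =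
      (fun p : R3 × S2 => kernel γ b v p.1 p.2 * maxwellian p.1 * maxwellian v) +
        (linearIntegrand γ b f v + collisionIntegrand γ b f f v) := by
    funext p
    have := maxwellian_post v p.1 p.2
    simp only [Pi.add_apply, linearIntegrand, collisionIntegrand]
    linear_combination (kernel γ b v p.1 p.2) * this
  refine ⟨e ▸ h4, ?_⟩
  rw [e, integral_add' (h3.mul_const _) (h1.add h2), integral_add' h1 h2, integral_mul_const]
  rfl

/-- The negative part of `F = μ + f` controls the negative part of the collision operator. -/
theorem WeightBound.nu_add_source_ge (hb : IsCutoff b C) (hγ : -3 < γ) (hγ1 : γ ≤ 1)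
    (h : WeightBound γ b l K) (hK : 0 ≤ K) {f : R3 → ℝ} (hf : Measurable f) {A Z : ℝ}
    (hfA : ∀ v, |f v| ≤ A * weight (-l) v) (hZ : 0 ≤ Z)
    (hF : ∀ v, -(Z * weight (-l) v) ≤ maxwellian v + f v) {v : R3} (hv : maxwellian v + f v ≤ 0) :
    -(((1 / 8 + 3 * A * K) * nu γ b v + (K + 3 * A * K)) * (Z * weight (-l) v)) ≤
      nu γ b v * maxwellian v + source γ b f v := by
  obtain ⟨hi, he⟩ := h.nu_add_source hb hγ hγ1 hf hfA v
  have hA := const_nonneg_of_abs_le hfA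
  have hw := fun v => (weight_pos (-l) v).le
  have hm := fun v => (maxwellian_pos v).le
  -- A product of two values of F is negative only if exactly one of them is. The negative one is at
  -- least -Z times the weight, the other at most μ + A times the weight, so the bound is linear in
  -- Z.
  have key : ∀ x y, -(Z * (maxwellian x * weight (-l) y + maxwellian y * weight (-l) x +
      2 * A * (weight (-l) x * weight (-l) y))) ≤
      (maxwellian x + f x) * (maxwellian y + f y) := by
    intro x y
    have hx := abs_le.1 (hfA x)
    have hy := abs_le.1 (hfA y)
    have ax : |maxwellian x + f x| ≤ maxwellian x + A * weight (-l) x := by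
      rw [abs_le]; constructor <;> linarith [hm x]
    have ay : |maxwellian y + f y| ≤ maxwellian y + A * weight (-l) y := by
      rw [abs_le]; constructor <;> linarith [hm y]
    have hx1 := abs_le.1 ax
    have hy1 := abs_le.1 ay
    have p1 : 0 ≤ Z * weight (-l) y := mul_nonneg hZ (hw y)
    have p2 : 0 ≤ Z * weight (-l) x := mul_nonneg hZ (hw x)
    have p3 : 0 ≤ maxwellian x + A * weight (-l) x := (abs_nonneg _).trans ax
    have p4 : 0 ≤ maxwellian y + A * weight (-l) y := (abs_nonneg _).trans ay
    have hFx := hF x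
    have hFy := hF y
    have q1 := mul_nonneg p1 p3
    have q2 := mul_nonneg p2 p4
    rcases le_or_gt 0 (maxwellian x + f x) with h1 | h1 <;>
    rcases le_or_gt 0 (maxwellian y + f y) with h2 | h2
    · have := mul_nonneg h1 h2; linarith
    · have := mul_le_mul hx1.2 (show -(maxwellian y + f y) ≤ Z * weight (-l) y by linarith)
        (by linarith) p3
      linarith
    · have := mul_le_mul hy1.2 (show -(maxwellian x + f x) ≤ Z * weight (-l) x by linarith)
        (by linarith) p4
      linarith
    · have := mul_nonneg_of_nonpos_of_nonpos h1.le h2.le; linarith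
  have hint := integral_kernel_le hb (D := Z)
    (φ := fun p => -((maxwellian (uPost v p.1 p.2) + f (uPost v p.1 p.2)) *
        (maxwellian (vPost v p.1 p.2) + f (vPost v p.1 p.2)) - f p.1 * (maxwellian v + f v)))
    (W := fun p => linearWeight l v p + 3 * A * quadraticWeight l v p)
    (c := (nu γ b v / 8 + K) * weight (-l) v + 3 * A * (K * (nu γ b v + 1) * weight (-l) v))
    (v := v) (γ := γ)
    (hi.neg.congr (Filter.Eventually.of_forall fun p => (mul_neg _ _).symm))
    ((measurable_linearWeight l v).add ((measurable_quadraticWeight l v).const_mul _))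
    (fun p => add_nonneg (linearWeight_nonneg l v p)
      (mul_nonneg (by positivity) (quadraticWeight_nonneg l v p))) hZ
    (add_nonneg (linearCoeff_nonneg hb hK v)
      (mul_nonneg (by positivity) (quadraticCoeff_nonneg hb hK v)))
    (by
      rw [ENNReal.ofReal_add (linearCoeff_nonneg hb hK v)
        (mul_nonneg (by positivity) (quadraticCoeff_nonneg hb hK v)), ENNReal.ofReal_mul (p := 3 * A)
        (by positivity)]
      have hl : ∫⁻ p : R3 × S2, ENNReal.ofReal (kernel γ b v p.1 p.2) *
        ENNReal.ofReal (linearWeight l v p) ∂duDω ≤ _ := h.linear v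
      have hq : ∫⁻ p : R3 × S2, ENNReal.ofReal (kernel γ b v p.1 p.2) *
        ENNReal.ofReal (quadraticWeight l v p) ∂duDω ≤ _ := h.quadratic v
      refine le_trans (le_of_eq ?_) (add_le_add hl (mul_le_mul_right hq _))
      rw [← lintegral_const_mul' _ _ ENNReal.ofReal_ne_top, ← lintegral_add_left
        (measurable_slice hb.meas γ v (measurable_linearWeight l v))]
      refine lintegral_congr fun p => ?_
      rw [ENNReal.ofReal_add (linearWeight_nonneg l v p)
        (mul_nonneg (by positivity) (quadraticWeight_nonneg l v p)), mul_add,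
        ENNReal.ofReal_mul (by positivity), mul_left_comm])
    (fun p => by
      have k1 := key (uPost v p.1 p.2) (vPost v p.1 p.2)
      -- The sign assumption at v enters here: F(v) ≤ 0 forces |F(v)| ≤ Z times the weight, which
      -- makes the loss term proportional to Z as well.
      have k2 : f p.1 * (maxwellian v + f v) ≤ Z * (A * (weight (-l) p.1 * weight (-l) v)) := by
        have := mul_le_mul (hfA p.1) (show -(maxwellian v + f v) ≤ Z * weight (-l) v by
          linarith [hF v]) (by linarith) ((abs_nonneg _).trans (hfA _))
        have h5 : f p.1 * (maxwellian v + f v) ≤ |f p.1| * -(maxwellian v + f v) := by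
          have := mul_le_mul_of_nonneg_right (neg_abs_le (f p.1))
            (show 0 ≤ -(maxwellian v + f v) by linarith)
          linarith
        linarith
      have k3 : 0 ≤ Z * (maxwellian v * weight (-l) p.1) :=
        mul_nonneg hZ (mul_nonneg (hm _) (hw _))
      have k4 : 0 ≤ Z * A * (weight (-l) (uPost v p.1 p.2) * weight (-l) (vPost v p.1 p.2)) :=
        mul_nonneg (mul_nonneg hZ hA) (mul_nonneg (hw _) (hw _))
      have k5 : 0 ≤ Z * A * (weight (-l) p.1 * weight (-l) v) :=
        mul_nonneg (mul_nonneg hZ hA) (mul_nonneg (hw _) (hw _))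
      unfold linearWeight quadraticWeight
      linarith)
  rw [he]
  simp_rw [mul_neg] at hint
  rw [integral_neg] at hint
  linarith

end Boltzmann

/-! ### The Duhamel map and its fixed point -/

namespace Boltzmann

variable {γ : ℝ} {b : ℝ → ℝ} {C l K T : ℝ}

instance : IsFiniteMeasure (volume : Measure R3).toSphere := inferInstance

instance : SFinite duDω :=
  inferInstanceAs (SFinite ((volume : Measure R3).prod (volume : Measure R3).toSphere))

theorem measurable_nu (hb : IsCutoff b C) (γ : ℝ) : Measurable (nu γ b) := by
  have h : Measurable fun q : R3 × (R3 × S2) => kernel γ b q.1 q.2.1 q.2.2 * maxwellian q.2.1 :=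
    (measurable_kernel hb.meas γ).mul (by fun_prop)
  exact h.stronglyMeasurable.integral_prod_right'.measurable

section Measurability

variable {α : Type*} [MeasurableSpace α] {f g : α → R3 → ℝ} {v : α → R3}

theorem measurable_linearIntegrand (hb : IsCutoff b C)
    (hf : Measurable fun q : α × R3 => f q.1 q.2) (hv : Measurable v) :
    Measurable fun q : α × (R3 × S2) => linearIntegrand γ b (f q.1) (v q.1) q.2 := by
  have h1 : Measurable fun q : α × (R3 × S2) => f q.1 (vPost (v q.1) q.2.1 q.2.2) :=
    hf.comp (measurable_fst.prodMk (by fun_prop))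
  have h2 : Measurable fun q : α × (R3 × S2) => f q.1 (uPost (v q.1) q.2.1 q.2.2) :=
    hf.comp (measurable_fst.prodMk (by fun_prop))
  have h3 : Measurable fun q : α × (R3 × S2) => f q.1 q.2.1 :=
    hf.comp (measurable_fst.prodMk (by fun_prop))
  unfold linearIntegrand
  exact (measurable_kernel_comp hb.meas γ (by fun_prop) (by fun_prop) (by fun_prop)).mul
    (by fun_prop)

theorem measurable_collisionIntegrand (hb : IsCutoff b C)
    (hf : Measurable fun q : α × R3 => f q.1 q.2) (hg : Measurable fun q : α × R3 => g q.1 q.2)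
    (hv : Measurable v) :
    Measurable fun q : α × (R3 × S2) => collisionIntegrand γ b (f q.1) (g q.1) (v q.1) q.2 := by
  have h1 : Measurable fun q : α × (R3 × S2) => f q.1 (uPost (v q.1) q.2.1 q.2.2) :=
    hf.comp (measurable_fst.prodMk (by fun_prop))
  have h2 : Measurable fun q : α × (R3 × S2) => g q.1 (vPost (v q.1) q.2.1 q.2.2) :=
    hg.comp (measurable_fst.prodMk (by fun_prop))
  have h3 : Measurable fun q : α × (R3 × S2) => f q.1 q.2.1 :=
    hf.comp (measurable_fst.prodMk (by fun_prop))
  have h4 : Measurable fun q : α × (R3 × S2) => g q.1 (v q.1) :=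
    hg.comp (measurable_fst.prodMk (by fun_prop))
  unfold collisionIntegrand
  exact (measurable_kernel_comp hb.meas γ (by fun_prop) (by fun_prop) (by fun_prop)).mul
    (by fun_prop)

theorem measurable_linearK (hb : IsCutoff b C)
    (hf : Measurable fun q : α × R3 => f q.1 q.2) (hv : Measurable v) :
    Measurable fun a => linearK γ b (f a) (v a) :=
  (measurable_linearIntegrand hb hf hv).stronglyMeasurable.integral_prod_right'.measurable

theorem measurable_collision (hb : IsCutoff b C)
    (hf : Measurable fun q : α × R3 => f q.1 q.2) (hg : Measurable fun q : α × R3 => g q.1 q.2)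
    (hv : Measurable v) : Measurable fun a => collision γ b (f a) (g a) (v a) :=
  (measurable_collisionIntegrand hb hf hg hv).stronglyMeasurable.integral_prod_right'.measurable

theorem measurable_source (hb : IsCutoff b C)
    (hf : Measurable fun q : α × R3 => f q.1 q.2) (hv : Measurable v) :
    Measurable fun a => source γ b (f a) (v a) :=
  (measurable_linearK hb hf hv).add (measurable_collision hb hf hf hv)

end Measurability

/-- A jointly measurable function bounded by `A (1 + |v|)^(-l)`. -/
structure Admissible (l A : ℝ) (g : ℝ → R3 → R3 → ℝ) : Prop where
  meas : Measurable fun p : ℝ × R3 × R3 => g p.1 p.2.1 p.2.2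
  le : ∀ t x v, |g t x v| ≤ A * weight (-l) v

theorem Admissible.mono {A A' : ℝ} {g : ℝ → R3 → R3 → ℝ} (h : Admissible l A g) (hA : A ≤ A') :
    Admissible l A' g :=
  ⟨h.meas, fun t x v => (h.le t x v).trans (mul_le_mul_of_nonneg_right hA (weight_pos _ _).le)⟩

theorem Admissible.weight_mono {l' A : ℝ} {g : ℝ → R3 → R3 → ℝ} (h : Admissible l A g)
    (hl : l' ≤ l) : Admissible l' A g :=
  ⟨h.meas, fun t x v => (h.le t x v).trans (mul_le_mul_of_nonneg_left
    (Boltzmann.weight_mono (by linarith) v) (const_nonneg_of_abs_le (h.le t x)))⟩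

theorem measurable_comp_left {g : ℝ → R3 → R3 → ℝ}
    (h : Measurable fun p : ℝ × R3 × R3 => g p.1 p.2.1 p.2.2) (t : ℝ) (x : R3) :
    Measurable (g t x) :=
  h.comp (measurable_const.prodMk (measurable_const.prodMk measurable_id))

/-- The source term along a characteristic. -/
theorem measurable_source_char (hb : IsCutoff b C) {g : ℝ → R3 → R3 → ℝ}
    (h : Measurable fun p : ℝ × R3 × R3 => g p.1 p.2.1 p.2.2) :
    Measurable fun q : (ℝ × R3 × R3) × ℝ =>
      source γ b (g q.2 (q.1.2.1 - (q.1.1 - q.2) • q.1.2.2)) q.1.2.2 := by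
  refine measurable_source (f := fun q : (ℝ × R3 × R3) × ℝ =>
    g q.2 (q.1.2.1 - (q.1.1 - q.2) • q.1.2.2)) hb ?_ (by fun_prop)
  exact h.comp (f := fun q : ((ℝ × R3 × R3) × ℝ) × R3 =>
    (q.1.2, q.1.1.2.1 - (q.1.1.1 - q.1.2) • q.1.1.2.2, q.2)) (by fun_prop)

/-- The exponential absorbs ν, since ∫₀ᵗ ν e^{-ν(t-s)} ds ≤ 1. Thus the coefficient α of ν gains
nothing from a short time and has to be small by itself, whereas β is multiplied by t. -/
theorem integral_exp_mul_le {ν α β t : ℝ} (hν : 0 ≤ ν) (hα : 0 ≤ α) (hβ : 0 ≤ β) (ht : 0 ≤ t) :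
    ∫ s in (0 : ℝ)..t, Real.exp (-ν * (t - s)) * (α * ν + β) ≤ α + β * t := by
  have e : ∀ s, Real.exp (-ν * (t - s)) * (α * ν + β) =
      Real.exp (-ν * (t - s)) * (α * ν) + Real.exp (-ν * (t - s)) * β := fun s => mul_add _ _ _
  simp_rw [e]
  have i1 : ∀ c : ℝ, IntervalIntegrable (fun s => Real.exp (-ν * (t - s)) * c) volume 0 t := fun c =>
    (by fun_prop : Continuous fun s => Real.exp (-ν * (t - s)) * c).intervalIntegrable _ _
  rw [intervalIntegral.integral_add (i1 _) (i1 _)]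
  have d : ∀ s ∈ uIcc 0 t, HasDerivAt (fun s => α * Real.exp (-ν * (t - s)))
      (Real.exp (-ν * (t - s)) * (α * ν)) s := by
    intro s _
    have h1 : HasDerivAt (fun s => -ν * (t - s)) ν s := by
      have := ((hasDerivAt_id s).const_sub t).const_mul (-ν)
      simpa using this
    have := h1.exp.const_mul α
    rwa [mul_left_comm] at this
  rw [intervalIntegral.integral_eq_sub_of_hasDerivAt d (i1 _)]
  have h2 : ∫ s in (0 : ℝ)..t, Real.exp (-ν * (t - s)) * β ≤ ∫ s in (0 : ℝ)..t, β := by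
    refine intervalIntegral.integral_mono_on ht (i1 _) (by simp) fun s hs => ?_
    have : Real.exp (-ν * (t - s)) ≤ 1 := Real.exp_le_one_iff.2 (by nlinarith [hs.2])
    nlinarith
  have h3 := (Real.exp_pos (-ν * (t - 0))).le
  simp at h2 ⊢
  simp at h3
  nlinarith [mul_nonneg hα (Real.exp_pos (-(ν * t))).le]

theorem intervalIntegrable_exp_mul {φ : ℝ → ℝ} (hφ : Measurable φ) {c : ℝ} (hc : ∀ s, |φ s| ≤ c)
    (ν t a a' : ℝ) :
    IntervalIntegrable (fun s => Real.exp (-ν * (t - s)) * φ s) volume a a' := by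
  refine IntervalIntegrable.continuousOn_mul ?_ (by fun_prop)
  refine (intervalIntegrable_const (c := c)).mono_fun hφ.aestronglyMeasurable
    (Filter.Eventually.of_forall fun s => ?_)
  exact (hc s).trans (le_abs_self c)

/-- The Duhamel map, whose fixed points are the mild solutions. -/
noncomputable def mildMap (γ : ℝ) (b : ℝ → ℝ) (T : ℝ) (g₀ : R3 → R3 → ℝ) (g : ℝ → R3 → R3 → ℝ)
    (t : ℝ) (x v : R3) : ℝ :=
  -- The value 0 outside [0,T] lets the bounds and the fixed-point identity hold for every real t.
  open Classical in
  if t ∈ Icc (0 : ℝ) T then Real.exp (-nu γ b v * t) * g₀ (x - t • v) v +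
    ∫ s in (0 : ℝ)..t, Real.exp (-nu γ b v * (t - s)) *
      source γ b (g s (x - (t - s) • v)) v else 0

theorem mildMap_of_mem {g₀ : R3 → R3 → ℝ} {g : ℝ → R3 → R3 → ℝ} {t : ℝ} (ht : t ∈ Icc (0 : ℝ) T)
    (x v : R3) : mildMap γ b T g₀ g t x v = Real.exp (-nu γ b v * t) * g₀ (x - t • v) v +
    ∫ s in (0 : ℝ)..t, Real.exp (-nu γ b v * (t - s)) *
      source γ b (g s (x - (t - s) • v)) v := if_pos ht

theorem mildMap_of_notMem {g₀ : R3 → R3 → ℝ} {g : ℝ → R3 → R3 → ℝ} {t : ℝ}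
    (ht : t ∉ Icc (0 : ℝ) T) (x v : R3) : mildMap γ b T g₀ g t x v = 0 := if_neg ht

theorem measurable_mildMap (hb : IsCutoff b C) {g₀ : R3 → R3 → ℝ} {g : ℝ → R3 → R3 → ℝ}
    (h₀ : Measurable fun z : R3 × R3 => g₀ z.1 z.2)
    (h : Measurable fun p : ℝ × R3 × R3 => g p.1 p.2.1 p.2.2) :
    Measurable fun p : ℝ × R3 × R3 => mildMap γ b T g₀ g p.1 p.2.1 p.2.2 := by
  classical
  have hν := measurable_nu hb γ
  have hs := measurable_source_char (γ := γ) hb h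
  -- The moving endpoint t is put into the integrand as a cutoff, so that measurability of integrals
  -- depending on a parameter applies.
  have hint : Measurable fun p : ℝ × R3 × R3 => ∫ s, (if 0 < s ∧ s ≤ p.1 then
      Real.exp (-nu γ b p.2.2 * (p.1 - s)) * source γ b (g s (p.2.1 - (p.1 - s) • p.2.2)) p.2.2
      else 0) := by
    have hm : Measurable fun q : (ℝ × R3 × R3) × ℝ => (if 0 < q.2 ∧ q.2 ≤ q.1.1 then
      Real.exp (-nu γ b q.1.2.2 * (q.1.1 - q.2)) *
        source γ b (g q.2 (q.1.2.1 - (q.1.1 - q.2) • q.1.2.2)) q.1.2.2 else 0) :=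
      Measurable.ite ((measurableSet_lt measurable_const measurable_snd).inter
        (measurableSet_le measurable_snd (by fun_prop)))
        (Measurable.mul (by fun_prop) hs) measurable_const
    exact hm.stronglyMeasurable.integral_prod_right'.measurable
  have he : (fun p : ℝ × R3 × R3 => mildMap γ b T g₀ g p.1 p.2.1 p.2.2) = fun p =>
      if p.1 ∈ Icc (0 : ℝ) T then Real.exp (-nu γ b p.2.2 * p.1) * g₀ (p.2.1 - p.1 • p.2.2) p.2.2 +
      ∫ s, (if 0 < s ∧ s ≤ p.1 then
      Real.exp (-nu γ b p.2.2 * (p.1 - s)) * source γ b (g s (p.2.1 - (p.1 - s) • p.2.2)) p.2.2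
      else 0) else 0 := by
    funext p
    by_cases hp : p.1 ∈ Icc (0 : ℝ) T
    · rw [mildMap_of_mem hp, if_pos hp, intervalIntegral.integral_of_le hp.1,
        ← integral_indicator measurableSet_Ioc]
      simp only [indicator_apply, mem_Ioc]
    · rw [mildMap_of_notMem hp, if_neg hp]
  rw [he]
  refine Measurable.ite (measurable_fst measurableSet_Icc) (Measurable.add (Measurable.mul
    (by fun_prop) ?_) hint) measurable_const
  exact h₀.comp (f := fun p : ℝ × R3 × R3 => (p.2.1 - p.1 • p.2.2, p.2.2)) (by fun_prop)

/-- The source is bounded along characteristics. -/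
theorem Admissible.intervalIntegrable_source (hb : IsCutoff b C) (hW : WeightBound γ b l K)
    (hK : 0 ≤ K) {A : ℝ} {g : ℝ → R3 → R3 → ℝ} (hg : Admissible l A g) (ν t a a' : ℝ) (x v : R3) :
    IntervalIntegrable (fun s => Real.exp (-ν * (t - s)) *
      source γ b (g s (x - (t - s) • v)) v) volume a a' := by
  refine intervalIntegrable_exp_mul ?_ (fun s => hW.abs_source_le hb hK
    (measurable_comp_left hg.meas _ _) (hg.le _ _) v) _ _ _ _
  exact (measurable_source_char hb hg.meas).comp (f := fun s : ℝ => ((t, x, v), s)) (by fun_prop)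

theorem mildMap_sub_le (hb : IsCutoff b C) (hW : WeightBound γ b l K) (hK : 0 ≤ K)
    {A t : ℝ} {g₀ : R3 → R3 → ℝ} {f g : ℝ → R3 → R3 → ℝ} (hf : Admissible l A f)
    (hg : Admissible l A g) {m : ℝ → ℝ} {x v : R3} (ht : t ∈ Icc 0 T)
    (hm : IntervalIntegrable (fun s => Real.exp (-nu γ b v * (t - s)) * m s) volume 0 t)
    (h : ∀ s ∈ Icc 0 t, |source γ b (f s (x - (t - s) • v)) v -
      source γ b (g s (x - (t - s) • v)) v| ≤ m s) :
    |mildMap γ b T g₀ f t x v - mildMap γ b T g₀ g t x v| ≤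
      ∫ s in (0 : ℝ)..t, Real.exp (-nu γ b v * (t - s)) * m s := by
  rw [mildMap_of_mem ht, mildMap_of_mem ht, add_sub_add_left_eq_sub,
    ← intervalIntegral.integral_sub (hf.intervalIntegrable_source hb hW hK _ _ _ _ _ _)
      (hg.intervalIntegrable_source hb hW hK _ _ _ _ _ _)]
  rw [← Real.norm_eq_abs]
  refine intervalIntegral.norm_integral_le_of_norm_le (g := fun s =>
    Real.exp (-nu γ b v * (t - s)) * m s) ht.1 (Filter.Eventually.of_forall fun s hs => ?_) hm
  rw [Real.norm_eq_abs, ← mul_sub, abs_mul, abs_of_pos (Real.exp_pos _)]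
  exact mul_le_mul_of_nonneg_left (h s (Ioc_subset_Icc_self hs)) (Real.exp_pos _).le

/-- One smallness condition, stated with the factor 3, serves three purposes: c = 2 for the
contraction, c = 1 for the L² bound and c = 3 for nonnegativity. -/
theorem exp_nu_integral_le (hb : IsCutoff b C) (hK : 0 ≤ K) {A : ℝ} (hA : 0 ≤ A)
    (hθ : 1 / 8 + 3 * A * K + (K + 3 * A * K) * T ≤ 1 / 2) {t D : ℝ} (ht : t ∈ Icc 0 T)
    (hD : 0 ≤ D) (v : R3) {c : ℝ} (hc : 0 ≤ c) (hc3 : c ≤ 3) :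
    ∫ s in (0 : ℝ)..t, Real.exp (-nu γ b v * (t - s)) *
      (((1 / 8 + c * A * K) * nu γ b v + (K + c * A * K)) * D) ≤ D / 2 := by
  have hAK := mul_nonneg hA hK
  have h1 := integral_exp_mul_le (nu_nonneg hb γ v) (α := 1 / 8 + c * A * K) (β := K + c * A * K)
    (by rw [mul_assoc]; positivity) (by rw [mul_assoc]; positivity) ht.1
  simp_rw [← mul_assoc (Real.exp _)]
  rw [intervalIntegral.integral_mul_const]
  have h2 : 1 / 8 + c * A * K + (K + c * A * K) * t ≤ 1 / 2 := by
    refine le_trans ?_ hθ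
    have : c * A * K ≤ 3 * A * K := by
      rw [mul_assoc, mul_assoc]; exact mul_le_mul_of_nonneg_right hc3 hAK
    have h0 : 0 ≤ c * A * K := by rw [mul_assoc]; positivity
    have := mul_le_mul (show K + c * A * K ≤ K + 3 * A * K by linarith) ht.2 ht.1 (by linarith)
    linarith
  have := mul_le_mul_of_nonneg_right (h1.trans h2) hD
  linarith

/-- The Duhamel map is a contraction. -/
theorem mildMap_contraction (hb : IsCutoff b C) (hW : WeightBound γ b l K) (hK : 0 ≤ K)
    {A D : ℝ} (hθ : 1 / 8 + 3 * A * K + (K + 3 * A * K) * T ≤ 1 / 2)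
    {g₀ : R3 → R3 → ℝ} {f g : ℝ → R3 → R3 → ℝ} (hf : Admissible l A f) (hg : Admissible l A g)
    (hD : ∀ t x v, |f t x v - g t x v| ≤ D * weight (-l) v) (t : ℝ) (x v : R3) :
    |mildMap γ b T g₀ f t x v - mildMap γ b T g₀ g t x v| ≤ D / 2 * weight (-l) v := by
  have hA := const_nonneg_of_abs_le (hf.le 0 0)
  have hD0 : 0 ≤ D := const_nonneg_of_abs_le (f := fun v => f 0 0 v - g 0 0 v) (hD 0 0)
  have hDw := mul_nonneg hD0 (weight_pos (-l) v).le
  by_cases ht : t ∈ Icc 0 T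
  · refine (mildMap_sub_le hb hW hK hf hg ht (m := fun _ =>
      ((1 / 8 + 2 * A * K) * nu γ b v + (K + 2 * A * K)) * (D * weight (-l) v))
      ((by fun_prop : Continuous _).intervalIntegrable _ _) fun s _ => ?_).trans ?_
    · exact hW.abs_source_sub_le hb hK (measurable_comp_left hf.meas _ _)
        (measurable_comp_left hg.meas _ _) (hf.le _ _) (hg.le _ _) (hD _ _) v
    · refine (exp_nu_integral_le hb hK hA hθ ht hDw v (by norm_num) (by norm_num)).trans
        (le_of_eq (by ring))
  · rw [mildMap_of_notMem ht, mildMap_of_notMem ht, sub_self, abs_zero]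
    linarith

theorem mildMap_zero_le (hb : IsCutoff b C) {N : ℝ} {g₀ : R3 → R3 → ℝ}
    (h₀ : ∀ x v, |g₀ x v| ≤ N * weight (-l) v) (t : ℝ) (x v : R3) :
    |mildMap γ b T g₀ (fun _ _ _ => 0) t x v| ≤ N * weight (-l) v := by
  by_cases ht : t ∈ Icc 0 T
  · rw [mildMap_of_mem ht]
    simp only [source_zero, mul_zero, intervalIntegral.integral_zero, add_zero]
    rw [abs_mul, abs_of_pos (Real.exp_pos _)]
    have : Real.exp (-nu γ b v * t) ≤ 1 :=
      Real.exp_le_one_iff.2 (by nlinarith [nu_nonneg hb γ v, ht.1])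
    nlinarith [h₀ (x - t • v) v, abs_nonneg (g₀ (x - t • v) v)]
  · rw [mildMap_of_notMem ht, abs_zero]
    exact (abs_nonneg _).trans (h₀ x v)

theorem Admissible.zero {A : ℝ} (hA : 0 ≤ A) : Admissible l A fun _ _ _ => 0 :=
  ⟨measurable_const, fun _ _ v => by rw [abs_zero]; exact mul_nonneg hA (weight_pos _ _).le⟩

/-- The ball of radius 2N is invariant: the image of 0 has size at most N, and the contraction moves
any other image by at most half of 2N. -/
theorem Admissible.mildMap (hb : IsCutoff b C) (hW : WeightBound γ b l K) (hK : 0 ≤ K)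
    {N : ℝ} (hN : 0 ≤ N)
    (hθ : 1 / 8 + 3 * (2 * N) * K + (K + 3 * (2 * N) * K) * T ≤ 1 / 2)
    {g₀ : R3 → R3 → ℝ} (h₀m : Measurable fun z : R3 × R3 => g₀ z.1 z.2)
    (h₀ : ∀ x v, |g₀ x v| ≤ N * weight (-l) v) {g : ℝ → R3 → R3 → ℝ}
    (hg : Admissible l (2 * N) g) : Admissible l (2 * N) (mildMap γ b T g₀ g) := by
  refine ⟨measurable_mildMap hb h₀m hg.meas, fun t x v => ?_⟩
  have h1 := mildMap_contraction hb hW hK hθ (g₀ := g₀) hg (Admissible.zero (by linarith))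
    (D := 2 * N) (fun t x v => by simpa using hg.le t x v) t x v
  have h2 := mildMap_zero_le (γ := γ) (T := T) hb h₀ t x v
  rw [abs_le] at *
  constructor <;> linarith

/-- The Picard iterates. -/
noncomputable def iterate (γ : ℝ) (b : ℝ → ℝ) (T : ℝ) (g₀ : R3 → R3 → ℝ) (n : ℕ) :
    ℝ → R3 → R3 → ℝ :=
  (mildMap γ b T g₀)^[n] fun _ _ _ => 0

theorem iterate_succ (g₀ : R3 → R3 → ℝ) (n : ℕ) :
    iterate γ b T g₀ (n + 1) = mildMap γ b T g₀ (iterate γ b T g₀ n) :=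
  Function.iterate_succ_apply' _ _ _

theorem admissible_iterate (hb : IsCutoff b C) (hW : WeightBound γ b l K) (hK : 0 ≤ K)
    {N : ℝ} (hN : 0 ≤ N)
    (hθ : 1 / 8 + 3 * (2 * N) * K + (K + 3 * (2 * N) * K) * T ≤ 1 / 2)
    {g₀ : R3 → R3 → ℝ} (h₀m : Measurable fun z : R3 × R3 => g₀ z.1 z.2)
    (h₀ : ∀ x v, |g₀ x v| ≤ N * weight (-l) v) (n : ℕ) :
    Admissible l (2 * N) (iterate γ b T g₀ n) := by
  induction n with
  | zero => exact Admissible.zero (by linarith)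
  | succ n ih => rw [iterate_succ]; exact ih.mildMap hb hW hK hN hθ h₀m h₀

/-- The iterates converge geometrically at every point, so the limit is measurable and the
fixed-point identity holds without exceptional null sets. Convergence of the iterates is retained
for the passage to the limit in L². -/
theorem exists_fixedPoint (hb : IsCutoff b C) (hW : WeightBound γ b l K) (hK : 0 ≤ K)
    {N : ℝ} (hN : 0 ≤ N)
    (hθ : 1 / 8 + 3 * (2 * N) * K + (K + 3 * (2 * N) * K) * T ≤ 1 / 2)
    {g₀ : R3 → R3 → ℝ} (h₀m : Measurable fun z : R3 × R3 => g₀ z.1 z.2)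
    (h₀ : ∀ x v, |g₀ x v| ≤ N * weight (-l) v) :
    ∃ g : ℝ → R3 → R3 → ℝ, Admissible l (2 * N) g ∧ mildMap γ b T g₀ g = g ∧
      ∀ t x v, Filter.Tendsto (fun n => iterate γ b T g₀ n t x v) Filter.atTop (nhds (g t x v)) := by
  have hA := admissible_iterate hb hW hK hN hθ h₀m h₀
  have hstep : ∀ (n : ℕ) (t : ℝ) (x v : R3), |iterate γ b T g₀ (n + 1) t x v -
      iterate γ b T g₀ n t x v| ≤ 2 * N * (1 / 2) ^ n * weight (-l) v := by
    intro n
    induction n with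
    | zero =>
      intro t x v
      have : iterate γ b T g₀ 0 t x v = 0 := rfl
      rw [this, sub_zero]
      simpa using (hA 1).le t x v
    | succ n ih =>
      intro t x v
      have := mildMap_contraction (g₀ := g₀) hb hW hK hθ (hA (n + 1)) (hA n) ih t x v
      rw [← iterate_succ, ← iterate_succ] at this
      refine this.trans (le_of_eq ?_)
      ring
  have hdist : ∀ (t : ℝ) (x v : R3) (n : ℕ), dist (iterate γ b T g₀ n t x v)
      (iterate γ b T g₀ (n + 1) t x v) ≤ 2 * N * weight (-l) v * (1 / 2) ^ n := by
    intro t x v n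
    rw [dist_comm, Real.dist_eq]
    exact (hstep n t x v).trans (le_of_eq (by ring))
  have hlim : ∀ (t : ℝ) (x v : R3), ∃ y, Filter.Tendsto (fun n => iterate γ b T g₀ n t x v)
      Filter.atTop (nhds y) := fun t x v =>
    cauchySeq_tendsto_of_complete (cauchySeq_of_le_geometric _ _ (by norm_num) (hdist t x v))
  choose g hg using hlim
  have hgA : Admissible l (2 * N) g := by
    refine ⟨measurable_of_tendsto_metrizable (fun n => (hA n).meas)
      (tendsto_pi_nhds.2 fun p => hg p.1 p.2.1 p.2.2), fun t x v => ?_⟩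
    exact le_of_tendsto (hg t x v).abs (Filter.Eventually.of_forall fun n => (hA n).le t x v)
  refine ⟨g, hgA, ?_, hg⟩
  funext t x v
  have hng : ∀ (n : ℕ) (t : ℝ) (x v : R3), |iterate γ b T g₀ n t x v - g t x v| ≤
      4 * N * (1 / 2) ^ n * weight (-l) v := by
    intro n t x v
    have := dist_le_of_le_geometric_of_tendsto _ _ (by norm_num) (hdist t x v) (hg t x v) n
    rw [Real.dist_eq] at this
    refine this.trans (le_of_eq ?_)
    ring
  have hconv : Filter.Tendsto (fun n => iterate γ b T g₀ (n + 1) t x v) Filter.atTop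
      (nhds (mildMap γ b T g₀ g t x v)) := by
    rw [tendsto_iff_dist_tendsto_zero]
    refine squeeze_zero (g := fun n : ℕ => 2 * N * weight (-l) v * (1 / 2) ^ n)
      (fun _ => dist_nonneg) (fun n => ?_) ?_
    · rw [Real.dist_eq, iterate_succ]
      refine (mildMap_contraction (g₀ := g₀) hb hW hK hθ (hA n) hgA (hng n) t x v).trans
        (le_of_eq ?_)
      ring
    · have := tendsto_pow_atTop_nhds_zero_of_lt_one (r := (1 / 2 : ℝ)) (by norm_num) (by norm_num)
      simpa using this.const_mul (2 * N * weight (-l) v)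
  exact tendsto_nhds_unique hconv ((Filter.tendsto_add_atTop_iff_nat 1).2 (hg t x v))

end Boltzmann

/-! ### Preservation of nonnegativity -/

namespace Boltzmann

variable {γ : ℝ} {b : ℝ → ℝ} {C l K T : ℝ}

/-- A primitive whose derivative is at least `-m` wherever it is nonpositive. -/
theorem neg_integral_le_of_primitive {ψ σ m : ℝ → ℝ} {c t : ℝ} (hc : 0 ≤ c) (ht : 0 ≤ t)
    (hσ : IntervalIntegrable σ volume 0 t) (hm : IntervalIntegrable m volume 0 t)
    (hm0 : ∀ s, 0 ≤ m s) (hψ : ∀ s ∈ Icc 0 t, ψ s = c + ∫ r in (0 : ℝ)..s, σ r)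
    (h : ∀ s ∈ Icc 0 t, ψ s ≤ 0 → -m s ≤ σ s) : -∫ s in (0 : ℝ)..t, m s ≤ ψ t := by
  have hm1 : 0 ≤ ∫ s in (0 : ℝ)..t, m s := intervalIntegral.integral_nonneg ht fun s _ => hm0 s
  rcases le_or_gt 0 (ψ t) with h0 | h0
  · linarith
  have hcont : ContinuousOn ψ (Icc 0 t) := by
    have h1 := intervalIntegral.continuousOn_primitive_interval' hσ (left_mem_uIcc)
    rw [uIcc_of_le ht] at h1
    exact (continuousOn_const.add h1).congr hψ
  have hS : IsCompact (Icc 0 t ∩ ψ ⁻¹' Ici 0) := by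
    refine isCompact_Icc.of_isClosed_subset ?_ inter_subset_left
    exact hcont.preimage_isClosed_of_isClosed isClosed_Icc isClosed_Ici
  have hne : (Icc 0 t ∩ ψ ⁻¹' Ici 0).Nonempty :=
    ⟨0, left_mem_Icc.2 ht, by
      rw [mem_preimage, hψ 0 (left_mem_Icc.2 ht), intervalIntegral.integral_same, add_zero]
      exact hc⟩
  have hmem := hS.sSup_mem hne
  -- The last time at which ψ ≥ 0; it is attained by continuity, and ψ(0) = c ≥ 0 makes the set
  -- nonempty. After t₀ the lower bound on σ is available throughout.
  set t₀ := sSup (Icc 0 t ∩ ψ ⁻¹' Ici 0) with ht₀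
  have hlast : ∀ s ∈ Ioc t₀ t, ψ s ≤ 0 := by
    intro s hs
    by_contra hcon
    have := le_csSup hS.bddAbove (show s ∈ Icc 0 t ∩ ψ ⁻¹' Ici 0 from
      ⟨⟨hmem.1.1.trans hs.1.le, hs.2⟩, (not_le.1 hcon).le⟩)
    exact absurd hs.1 (not_lt.2 this)
  have hu : uIcc 0 t₀ ⊆ uIcc 0 t := by
    rw [uIcc_of_le hmem.1.1, uIcc_of_le ht]; exact Icc_subset_Icc_right hmem.1.2
  have hu' : uIcc t₀ t ⊆ uIcc 0 t := by
    rw [uIcc_of_le hmem.1.2, uIcc_of_le ht]; exact Icc_subset_Icc_left hmem.1.1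
  have e1 := hψ t (right_mem_Icc.2 ht)
  have e2 := hψ t₀ hmem.1
  have e3 := intervalIntegral.integral_add_adjacent_intervals (hσ.mono_set hu) (hσ.mono_set hu')
  have e4 := intervalIntegral.integral_add_adjacent_intervals (hm.mono_set hu) (hm.mono_set hu')
  have e5 : 0 ≤ ∫ s in (0 : ℝ)..t₀, m s :=
    intervalIntegral.integral_nonneg hmem.1.1 fun s _ => hm0 s
  have e6 : ∫ s in t₀..t, -m s ≤ ∫ s in t₀..t, σ s := by
    refine intervalIntegral.integral_mono_on_of_le_Ioo hmem.1.2 (hm.mono_set hu').neg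
      (hσ.mono_set hu') fun s hs => ?_
    exact h s ⟨hmem.1.1.trans hs.1.le, hs.2.le⟩ (hlast s ⟨hs.1, hs.2.le⟩)
  rw [intervalIntegral.integral_neg] at e6
  have e7 : 0 ≤ ψ t₀ := hmem.2
  linarith

/-- A fixed point of the Duhamel map along a characteristic. -/
theorem fixedPoint_char (hb : IsCutoff b C) (hW : WeightBound γ b l K) (hK : 0 ≤ K)
    {A : ℝ} {g₀ : R3 → R3 → ℝ} {g : ℝ → R3 → R3 → ℝ} (hg : Admissible l A g)
    (hfix : mildMap γ b T g₀ g = g) {s t : ℝ} (hs : s ∈ Icc 0 T) (x v : R3) :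
    Real.exp (-nu γ b v * (t - s)) * (maxwellian v + g s (x - (t - s) • v) v) =
      Real.exp (-nu γ b v * t) * (maxwellian v + g₀ (x - t • v) v) +
      ∫ r in (0 : ℝ)..s, Real.exp (-nu γ b v * (t - r)) *
        (nu γ b v * maxwellian v + source γ b (g r (x - (t - r) • v)) v) := by
  have e1 : g s (x - (t - s) • v) v = Real.exp (-nu γ b v * s) * g₀ (x - t • v) v +
      ∫ r in (0 : ℝ)..s, Real.exp (-nu γ b v * (s - r)) *
        source γ b (g r (x - (t - r) • v)) v := by
    conv_lhs => rw [← hfix]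
    rw [mildMap_of_mem hs]
    have e : ∀ r : ℝ, x - (t - s) • v - (s - r) • v = x - (t - r) • v := fun r => by
      rw [sub_sub, ← add_smul]; congr 2; ring
    have e0 : x - (t - s) • v - s • v = x - t • v := by
      rw [sub_sub, ← add_smul]; congr 2; ring
    simp_rw [e, e0]
  have e2 : ∫ r in (0 : ℝ)..s, Real.exp (-nu γ b v * (t - r)) * nu γ b v * maxwellian v =
      (Real.exp (-nu γ b v * (t - s)) - Real.exp (-nu γ b v * t)) * maxwellian v := by
    rw [intervalIntegral.integral_mul_const]
    congr 1
    have d : ∀ r ∈ uIcc 0 s, HasDerivAt (fun r => Real.exp (-nu γ b v * (t - r)))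
        (Real.exp (-nu γ b v * (t - r)) * nu γ b v) r := by
      intro r _
      have h1 : HasDerivAt (fun r => -nu γ b v * (t - r)) (nu γ b v) r := by
        have := ((hasDerivAt_id r).const_sub t).const_mul (-nu γ b v)
        simpa using this
      exact h1.exp
    rw [intervalIntegral.integral_eq_sub_of_hasDerivAt d
      ((by fun_prop : Continuous _).intervalIntegrable _ _), sub_zero]
  have e3 : ∫ r in (0 : ℝ)..s, Real.exp (-nu γ b v * (t - r)) *
        source γ b (g r (x - (t - r) • v)) v = Real.exp (-nu γ b v * (t - s)) *
      ∫ r in (0 : ℝ)..s, Real.exp (-nu γ b v * (s - r)) *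
        source γ b (g r (x - (t - r) • v)) v := by
    rw [← intervalIntegral.integral_const_mul]
    refine intervalIntegral.integral_congr fun r _ => ?_
    rw [← mul_assoc, ← Real.exp_add]
    congr 2; ring
  simp_rw [mul_add (Real.exp (-nu γ b v * (t - _))), ← mul_assoc]
  rw [intervalIntegral.integral_add ((by fun_prop : Continuous _).intervalIntegrable _ _)
    (hg.intervalIntegrable_source hb hW hK _ _ _ _ _ _), e2, e3, e1]
  have e4 : Real.exp (-nu γ b v * (t - s)) * Real.exp (-nu γ b v * s) =
      Real.exp (-nu γ b v * t) := by
    rw [← Real.exp_add]; congr 1; ring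
  linear_combination (g₀ (x - t • v) v) * e4

/-- Along a characteristic, F = μ+g times e^{-ν(t-s)} is a primitive with nonnegative initial value,
and where it is nonpositive its derivative is bounded below by a quantity proportional to Z. Its
time integral is at most half of Z times the weight, by the same smallness condition as for the
contraction. -/
theorem fixedPoint_lower_bound (hb : IsCutoff b C) (hγ : -3 < γ) (hγ1 : γ ≤ 1)
    (hW : WeightBound γ b l K) (hK : 0 ≤ K) {A : ℝ}
    (hθ : 1 / 8 + 3 * A * K + (K + 3 * A * K) * T ≤ 1 / 2)
    {g₀ : R3 → R3 → ℝ} (h₀ : ∀ x v, 0 ≤ maxwellian v + g₀ x v)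
    {g : ℝ → R3 → R3 → ℝ} (hg : Admissible l A g) (hfix : mildMap γ b T g₀ g = g) {Z : ℝ}
    (hZ : 0 ≤ Z) (hF : ∀ t x v, -(Z * weight (-l) v) ≤ maxwellian v + g t x v) (t : ℝ) (x v : R3) :
    -(Z / 2 * weight (-l) v) ≤ maxwellian v + g t x v := by
  have hA := const_nonneg_of_abs_le (hg.le 0 0)
  have hν := nu_nonneg hb γ v
  have hZw := mul_nonneg hZ (weight_pos (-l) v).le
  by_cases ht : t ∈ Icc 0 T
  · have h1 := neg_integral_le_of_primitive
      (ψ := fun s => Real.exp (-nu γ b v * (t - s)) * (maxwellian v + g s (x - (t - s) • v) v))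
      (σ := fun r => Real.exp (-nu γ b v * (t - r)) *
        (nu γ b v * maxwellian v + source γ b (g r (x - (t - r) • v)) v))
      (m := fun s => Real.exp (-nu γ b v * (t - s)) *
        (((1 / 8 + 3 * A * K) * nu γ b v + (K + 3 * A * K)) * (Z * weight (-l) v)))
      (c := Real.exp (-nu γ b v * t) * (maxwellian v + g₀ (x - t • v) v)) (t := t)
      (mul_nonneg (Real.exp_pos _).le (h₀ _ _)) ht.1
      (by
        simp_rw [mul_add]
        exact ((by fun_prop : Continuous _).intervalIntegrable _ _).add
          (hg.intervalIntegrable_source hb hW hK _ _ _ _ _ _))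
      ((by fun_prop : Continuous _).intervalIntegrable _ _)
      (fun s => by positivity)
      (fun s hs => fixedPoint_char hb hW hK hg hfix ⟨hs.1, hs.2.trans ht.2⟩ x v)
      (fun s hs hneg => by
        have hneg' : maxwellian v + g s (x - (t - s) • v) v ≤ 0 := by
          by_contra hcon
          exact absurd hneg (not_le.2 (mul_pos (Real.exp_pos _) (not_le.1 hcon)))
        have := hW.nu_add_source_ge hb hγ hγ1 hK (measurable_comp_left hg.meas s _) (hg.le s _) hZ
          (hF s _) hneg'
        rw [← mul_neg]
        exact mul_le_mul_of_nonneg_left this (Real.exp_pos _).le)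
    have h2 := exp_nu_integral_le hb hK hA hθ ht hZw v (c := 3) (by norm_num) le_rfl (γ := γ)
    simp only [sub_self, mul_zero, Real.exp_zero, one_mul, zero_smul, sub_zero] at h1
    linarith
  · rw [← hfix, mildMap_of_notMem ht]
    have := maxwellian_pos v
    linarith

/-- Fixed points of the Duhamel map preserve nonnegativity. -/
theorem fixedPoint_nonneg (hb : IsCutoff b C) (hγ : -3 < γ) (hγ1 : γ ≤ 1)
    (hW : WeightBound γ b l K) (hK : 0 ≤ K) {A : ℝ}
    (hθ : 1 / 8 + 3 * A * K + (K + 3 * A * K) * T ≤ 1 / 2)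
    {g₀ : R3 → R3 → ℝ} (h₀ : ∀ x v, 0 ≤ maxwellian v + g₀ x v)
    {g : ℝ → R3 → R3 → ℝ} (hg : Admissible l A g) (hfix : mildMap γ b T g₀ g = g)
    (t : ℝ) (x v : R3) : 0 ≤ maxwellian v + g t x v := by
  have hA := const_nonneg_of_abs_le (hg.le 0 0)
  have h : ∀ n : ℕ, ∀ t x v, -(A * (1 / 2) ^ n * weight (-l) v) ≤ maxwellian v + g t x v := by
    intro n
    induction n with
    | zero =>
      intro t x v
      have := (abs_le.1 (hg.le t x v)).1
      have := maxwellian_pos v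
      rw [pow_zero, mul_one]; linarith
    | succ n ih =>
      intro t x v
      refine le_trans (le_of_eq ?_)
        (fixedPoint_lower_bound hb hγ hγ1 hW hK hθ h₀ hg hfix (by positivity) ih t x v)
      ring
  have hl : Filter.Tendsto (fun n : ℕ => -(A * weight (-l) v * (1 / 2) ^ n)) Filter.atTop
      (nhds 0) := by
    have := tendsto_pow_atTop_nhds_zero_of_lt_one (r := (1 / 2 : ℝ)) (by norm_num) (by norm_num)
    simpa using (this.const_mul (A * weight (-l) v)).neg
  exact le_of_tendsto' hl fun n => le_trans (le_of_eq (by ring)) (h n t x v)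

end Boltzmann

/-! ### Propagation of the L² norm in x -/

namespace Boltzmann

variable {γ : ℝ} {b : ℝ → ℝ} {C l K T : ℝ}

/-- Minkowski's integral inequality in `L²`. -/
theorem eLpNorm_two_lintegral_le {α β : Type*} [MeasurableSpace α] [MeasurableSpace β]
    (μ : Measure α) (ν : Measure β) [SFinite μ] [SFinite ν] {F : α × β → ℝ≥0∞}
    (hF : Measurable F) :
    eLpNorm (fun x => ∫⁻ p, F (x, p) ∂ν) 2 μ ≤ ∫⁻ p, eLpNorm (fun x => F (x, p)) 2 μ ∂ν := by
  have hN : ∀ f : α → ℝ≥0∞, eLpNorm f 2 μ = (∫⁻ x, f x ^ (2 : ℝ) ∂μ) ^ (1 / 2 : ℝ) := fun f => by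
    rw [eLpNorm_eq_lintegral_rpow_enorm_toReal (by norm_num) (by norm_num)]; simp
  have hI : Measurable fun x => ∫⁻ p, F (x, p) ∂ν := hF.lintegral_prod_right'
  have hFp : ∀ p, Measurable fun x => F (x, p) := fun p => hF.comp measurable_prodMk_right
  have hFx : ∀ x, Measurable fun p => F (x, p) := fun x => hF.comp measurable_prodMk_left
  have hNm : Measurable fun p => eLpNorm (fun x => F (x, p)) 2 μ := by
    simp_rw [hN]
    have : Measurable fun q : α × β => F q ^ (2 : ℝ) := hF.pow_const _
    exact (this.lintegral_prod_left').pow_const _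
  have hH : ∀ p q, ∫⁻ x, F (x, p) * F (x, q) ∂μ ≤
      eLpNorm (fun x => F (x, p)) 2 μ * eLpNorm (fun x => F (x, q)) 2 μ := fun p q => by
    rw [hN, hN]
    exact ENNReal.lintegral_mul_le_Lp_mul_Lq μ Real.HolderConjugate.two_two (hFp p).aemeasurable
      (hFp q).aemeasurable
  -- The square is written as a double integral over p and q, the integral in x is brought inside,
  -- and Cauchy–Schwarz is applied in x.
  have key : ∫⁻ x, (∫⁻ p, F (x, p) ∂ν) ^ (2 : ℝ) ∂μ ≤
      (∫⁻ p, eLpNorm (fun x => F (x, p)) 2 μ ∂ν) ^ (2 : ℝ) := by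
    have e : ∀ a : ℝ≥0∞, a ^ (2 : ℝ) = a * a := fun a => by
      rw [show (2 : ℝ) = ((2 : ℕ) : ℝ) by norm_num, ENNReal.rpow_natCast, sq]
    simp_rw [e]
    calc ∫⁻ x, (∫⁻ p, F (x, p) ∂ν) * ∫⁻ p, F (x, p) ∂ν ∂μ
        = ∫⁻ x, ∫⁻ p, F (x, p) * ∫⁻ q, F (x, q) ∂ν ∂ν ∂μ := by
          refine lintegral_congr fun x => ?_
          rw [lintegral_mul_const _ (hFx x)]
      _ = ∫⁻ p, ∫⁻ x, F (x, p) * ∫⁻ q, F (x, q) ∂ν ∂μ ∂ν :=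
          lintegral_lintegral_swap (hF.mul (hI.comp measurable_fst)).aemeasurable
      _ ≤ ∫⁻ p, eLpNorm (fun x => F (x, p)) 2 μ *
            ∫⁻ q, eLpNorm (fun x => F (x, q)) 2 μ ∂ν ∂ν := by
          refine lintegral_mono fun p => ?_
          calc ∫⁻ x, F (x, p) * ∫⁻ q, F (x, q) ∂ν ∂μ
              = ∫⁻ x, ∫⁻ q, F (x, p) * F (x, q) ∂ν ∂μ :=
                lintegral_congr fun x => (lintegral_const_mul _ (hFx x)).symm
            _ = ∫⁻ q, ∫⁻ x, F (x, p) * F (x, q) ∂μ ∂ν :=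
                lintegral_lintegral_swap (((hFp p).comp measurable_fst).mul hF).aemeasurable
            _ ≤ ∫⁻ q, eLpNorm (fun x => F (x, p)) 2 μ * eLpNorm (fun x => F (x, q)) 2 μ ∂ν :=
                lintegral_mono fun q => hH p q
            _ = _ := lintegral_const_mul _ hNm
      _ = _ := lintegral_mul_const _ hNm
  rw [hN]
  calc _ ≤ ((∫⁻ p, eLpNorm (fun x => F (x, p)) 2 μ ∂ν) ^ (2 : ℝ)) ^ (1 / 2 : ℝ) :=
        ENNReal.rpow_le_rpow key (by norm_num)
    _ = _ := by rw [← ENNReal.rpow_mul]; norm_num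

theorem eLpNorm_translate {f : R3 → ℝ} (hf : Measurable f) (a : R3) :
    eLpNorm (fun x => f (x - a)) 2 volume = eLpNorm f 2 volume :=
  eLpNorm_comp_measurePreserving hf.aestronglyMeasurable (measurePreserving_sub_right volume a)

/-- In a product of two values of f one is bounded in the sup norm by A and the other in L² by M.
The estimate is linear in M, which is why the L² norm of the data need not be small. -/
theorem eLpNorm_integrand_le (hb : IsCutoff b C) {A M : ℝ} (hM : 0 ≤ M) {f : R3 → R3 → ℝ}
    (hf : Measurable fun z : R3 × R3 => f z.1 z.2)
    (hA : ∀ x v, |f x v| ≤ A * weight (-l) v)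
    (h2 : ∀ v, eLpNorm (fun x => f x v) 2 volume ≤ ENNReal.ofReal (M * weight (-l) v))
    (v : R3) (p : R3 × S2) :
    eLpNorm (fun x => linearIntegrand γ b (f x) v p + collisionIntegrand γ b (f x) (f x) v p) 2
      volume ≤ ENNReal.ofReal (kernel γ b v p.1 p.2) * ENNReal.ofReal (M *
        (linearWeight l v p + A * quadraticWeight l v p)) := by
  have hA0 := const_nonneg_of_abs_le (hA 0)
  have hw := fun v => (weight_pos (-l) v).le
  have hm := fun v => (maxwellian_pos v).le
  have hfv : ∀ v, Measurable fun x => f x v := fun v => hf.comp measurable_prodMk_right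
  have hc : ∀ c w, 0 ≤ c → eLpNorm (fun x => c * f x w) 2 volume ≤
      ENNReal.ofReal (M * (c * weight (-l) w)) := fun c w hc => by
    have := eLpNorm_const_smul c (fun x => f x w) 2 (volume : Measure R3)
    simp only [Pi.smul_def, smul_eq_mul] at this
    rw [this, Real.enorm_eq_ofReal hc, mul_left_comm, ENNReal.ofReal_mul hc]
    exact mul_le_mul_right (h2 w) _
  have hq : ∀ w w', eLpNorm (fun x => f x w * f x w') 2 volume ≤
      ENNReal.ofReal (M * (A * (weight (-l) w * weight (-l) w'))) := fun w w' => by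
    rw [← mul_assoc A]
    refine le_trans (eLpNorm_mono fun x => ?_) (hc (A * weight (-l) w) w' (mul_nonneg hA0 (hw w)))
    rw [norm_mul, norm_mul, Real.norm_eq_abs (A * _), abs_of_nonneg (mul_nonneg hA0 (hw w))]
    exact mul_le_mul_of_nonneg_right (hA x w) (norm_nonneg _)
  set v' := vPost v p.1 p.2 with hv'
  set u' := uPost v p.1 p.2 with hu'
  have e : (fun x => linearIntegrand γ b (f x) v p + collisionIntegrand γ b (f x) (f x) v p) =
      fun x => kernel γ b v p.1 p.2 * ((maxwellian u' * f x v' + maxwellian v' * f x u' -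
        maxwellian v * f x p.1) + (f x u' * f x v' - f x p.1 * f x v)) := by
    funext x; simp only [linearIntegrand, collisionIntegrand, ← hv', ← hu']; ring
  have e2 := eLpNorm_const_smul (kernel γ b v p.1 p.2) (fun x => ((maxwellian u' * f x v' +
    maxwellian v' * f x u' - maxwellian v * f x p.1) + (f x u' * f x v' - f x p.1 * f x v))) 2
    (volume : Measure R3)
  simp only [Pi.smul_def, smul_eq_mul] at e2
  rw [e, e2, Real.enorm_eq_ofReal (kernel_nonneg hb γ v _ _)]
  refine mul_le_mul_right ?_ _
  have m1 : ∀ c w, AEStronglyMeasurable (fun x => c * f x w) volume := fun c w =>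
    ((hfv w).const_mul c).aestronglyMeasurable
  have m2 : ∀ w w', AEStronglyMeasurable (fun x => f x w * f x w') volume := fun w w' =>
    ((hfv w).mul (hfv w')).aestronglyMeasurable
  have s1 := eLpNorm_add_le (((m1 (maxwellian u') v').add (m1 (maxwellian v') u')).sub
    (m1 (maxwellian v) p.1)) ((m2 u' v').sub (m2 p.1 v)) (p := 2) (by norm_num)
  have s2 := eLpNorm_sub_le ((m1 (maxwellian u') v').add (m1 (maxwellian v') u'))
    (m1 (maxwellian v) p.1) (p := 2) (by norm_num)
  have s3 := eLpNorm_add_le (m1 (maxwellian u') v') (m1 (maxwellian v') u') (p := 2) (by norm_num)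
  have s4 := eLpNorm_sub_le (m2 u' v') (m2 p.1 v) (p := 2) (by norm_num)
  refine (s1.trans (add_le_add (s2.trans (add_le_add (s3.trans (add_le_add (hc _ _ (hm _))
    (hc _ _ (hm _)))) (hc _ _ (hm _)))) (s4.trans (add_le_add (hq _ _) (hq _ _))))).trans
    (le_of_eq ?_)
  have n1 : ∀ x y, 0 ≤ M * (maxwellian x * weight (-l) y) := fun x y =>
    mul_nonneg hM (mul_nonneg (hm _) (hw _))
  have n2 : ∀ x y, 0 ≤ M * (A * (weight (-l) x * weight (-l) y)) := fun x y =>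
    mul_nonneg hM (mul_nonneg hA0 (mul_nonneg (hw _) (hw _)))
  rw [← ENNReal.ofReal_add (n1 _ _) (n1 _ _), ← ENNReal.ofReal_add (add_nonneg (n1 _ _) (n1 _ _))
    (n1 _ _), ← ENNReal.ofReal_add (n2 _ _) (n2 _ _), ← ENNReal.ofReal_add (add_nonneg
    (add_nonneg (n1 _ _) (n1 _ _)) (n1 _ _)) (add_nonneg (n2 _ _) (n2 _ _))]
  congr 1
  unfold linearWeight quadraticWeight
  ring

theorem WeightBound.lintegral_sum_le (hb : IsCutoff b C) (h : WeightBound γ b l K) (hK : 0 ≤ K)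
    {A M : ℝ} (hA : 0 ≤ A) (hM : 0 ≤ M) (v : R3) :
    ∫⁻ p : R3 × S2, ENNReal.ofReal (kernel γ b v p.1 p.2) * ENNReal.ofReal (M *
        (linearWeight l v p + A * quadraticWeight l v p)) ∂duDω ≤
      ENNReal.ofReal (((1 / 8 + A * K) * nu γ b v + (K + A * K)) * (M * weight (-l) v)) := by
  have hl : ∫⁻ p : R3 × S2, ENNReal.ofReal (kernel γ b v p.1 p.2) *
    ENNReal.ofReal (linearWeight l v p) ∂duDω ≤ _ := h.linear v
  have hq : ∫⁻ p : R3 × S2, ENNReal.ofReal (kernel γ b v p.1 p.2) *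
    ENNReal.ofReal (quadraticWeight l v p) ∂duDω ≤ _ := h.quadratic v
  have q0 := quadraticCoeff_nonneg (γ := γ) (l := l) hb hK v
  have l0 := linearCoeff_nonneg (γ := γ) (l := l) hb hK v
  calc _ = ENNReal.ofReal M * (∫⁻ p : R3 × S2, ENNReal.ofReal (kernel γ b v p.1 p.2) *
            ENNReal.ofReal (linearWeight l v p) ∂duDω + ENNReal.ofReal A *
          ∫⁻ p : R3 × S2, ENNReal.ofReal (kernel γ b v p.1 p.2) *
            ENNReal.ofReal (quadraticWeight l v p) ∂duDω) := by
        rw [← lintegral_const_mul' _ _ ENNReal.ofReal_ne_top, ← lintegral_add_left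
          (measurable_slice hb.meas γ v (measurable_linearWeight l v)),
          ← lintegral_const_mul' _ _ ENNReal.ofReal_ne_top]
        refine lintegral_congr fun p => ?_
        rw [ENNReal.ofReal_mul hM, ENNReal.ofReal_add (linearWeight_nonneg l v p)
          (mul_nonneg hA (quadraticWeight_nonneg l v p)), ENNReal.ofReal_mul hA]
        ring
    _ ≤ ENNReal.ofReal M * (ENNReal.ofReal ((nu γ b v / 8 + K) * weight (-l) v) +
          ENNReal.ofReal A * ENNReal.ofReal (K * (nu γ b v + 1) * weight (-l) v)) :=
        mul_le_mul_right (add_le_add hl (mul_le_mul_right hq _)) _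
    _ = _ := by
        rw [← ENNReal.ofReal_mul hA, ← ENNReal.ofReal_add l0 (mul_nonneg hA q0),
          ← ENNReal.ofReal_mul hM]
        congr 1
        ring

/-- The `L²` bound of the Duhamel integral. -/
theorem eLpNorm_mildMap_le (hb : IsCutoff b C) (hW : WeightBound γ b l K) (hK : 0 ≤ K)
    {A M : ℝ} (hM : 0 ≤ M)
    (hθ : 1 / 8 + 3 * A * K + (K + 3 * A * K) * T ≤ 1 / 2)
    {g₀ : R3 → R3 → ℝ} (h₀m : Measurable fun z : R3 × R3 => g₀ z.1 z.2)
    (h₀ : ∀ v, eLpNorm (fun x => g₀ x v) 2 volume ≤ ENNReal.ofReal (M * weight (-l) v))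
    {g : ℝ → R3 → R3 → ℝ} (hg : Admissible l A g)
    (h2 : ∀ t v, eLpNorm (fun x => g t x v) 2 volume ≤ ENNReal.ofReal (2 * M * weight (-l) v))
    (t : ℝ) (v : R3) :
    eLpNorm (fun x => mildMap γ b T g₀ g t x v) 2 volume ≤
      ENNReal.ofReal (2 * M * weight (-l) v) := by
  have hA := const_nonneg_of_abs_le (hg.le 0 0)
  have hν := nu_nonneg hb γ v
  have hMw : 0 ≤ 2 * M * weight (-l) v := mul_nonneg (by linarith) (weight_pos _ _).le
  by_cases ht : t ∈ Icc 0 T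
  swap
  · simp [mildMap_of_notMem ht]
  obtain ⟨H, hH⟩ : ∃ H : R3 × (ℝ × (R3 × S2)) → ℝ, H = fun q => Real.exp (-nu γ b v * (t - q.2.1)) *
    (linearIntegrand γ b (g q.2.1 (q.1 - (t - q.2.1) • v)) v q.2.2 +
      collisionIntegrand γ b (g q.2.1 (q.1 - (t - q.2.1) • v)) (g q.2.1 (q.1 - (t - q.2.1) • v)) v
        q.2.2) := ⟨_, rfl⟩
  have hHm : Measurable H := by
    have hgm : Measurable fun q : (R3 × ℝ) × R3 => g q.1.2 (q.1.1 - (t - q.1.2) • v) q.2 :=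
      hg.meas.comp (f := fun q : (R3 × ℝ) × R3 => (q.1.2, q.1.1 - (t - q.1.2) • v, q.2))
        (by fun_prop)
    have m1 := (measurable_linearIntegrand (γ := γ) (f := fun a : R3 × ℝ =>
      g a.2 (a.1 - (t - a.2) • v)) (v := fun _ => v) hb hgm measurable_const).add
      (measurable_collisionIntegrand (γ := γ) (f := fun a : R3 × ℝ =>
      g a.2 (a.1 - (t - a.2) • v)) (g := fun a : R3 × ℝ =>
      g a.2 (a.1 - (t - a.2) • v)) (v := fun _ => v) hb hgm hgm measurable_const)
    have m2 := m1.comp (f := fun q : R3 × (ℝ × (R3 × S2)) => ((q.1, q.2.1), q.2.2)) (by fun_prop)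
    rw [hH]
    exact Measurable.mul (by fun_prop) m2
  -- Time and collision variables are joined in one measure, so that Minkowski's inequality is used
  -- once. For fixed v the shift along the characteristic is a translation in x and does not change
  -- the L² norm.
  obtain ⟨τ, hτ⟩ : ∃ τ, τ = (volume.restrict (Ioc (0 : ℝ) t)).prod duDω := ⟨_, rfl⟩
  have : SFinite τ := by rw [hτ]; infer_instance
  have hpt : ∀ x, ‖mildMap γ b T g₀ g t x v‖ₑ ≤
      ‖g₀ (x - t • v) v‖ₑ + ∫⁻ q, ‖H (x, q)‖ₑ ∂τ := by
    intro x
    rw [mildMap_of_mem ht]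
    refine (enorm_add_le _ _).trans (add_le_add ?_ ?_)
    · rw [enorm_mul]
      have : ‖Real.exp (-nu γ b v * t)‖ₑ ≤ 1 := by
        rw [Real.enorm_eq_ofReal (Real.exp_pos _).le, ENNReal.ofReal_le_one]
        exact Real.exp_le_one_iff.2 (by nlinarith [ht.1])
      exact mul_le_of_le_one_left bot_le this
    · rw [intervalIntegral.integral_of_le ht.1, hτ, lintegral_prod
        (fun q => ‖H (x, q)‖ₑ) (hHm.comp measurable_prodMk_left).enorm.aemeasurable]
      refine (enorm_integral_le_lintegral_enorm _).trans (lintegral_mono fun s => ?_)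
      have hgm := measurable_comp_left hg.meas s (x - (t - s) • v)
      have e : Real.exp (-nu γ b v * (t - s)) * source γ b (g s (x - (t - s) • v)) v =
          ∫ p, H (x, s, p) ∂duDω := by
        rw [hH]
        simp only
        rw [integral_const_mul, integral_add (hW.integrable_linearIntegrand hb hgm (hg.le _ _) v)
          (hW.integrable_collisionIntegrand hb hgm hgm (hg.le _ _) (hg.le _ _) v)]
        rfl
      simp only
      rw [e]
      exact enorm_integral_le_lintegral_enorm _
  have hslice : ∀ q : ℝ × (R3 × S2), eLpNorm (fun x => ‖H (x, q)‖ₑ) 2 volume ≤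
      ENNReal.ofReal (Real.exp (-nu γ b v * (t - q.1))) *
        (ENNReal.ofReal (kernel γ b v q.2.1 q.2.2) * ENNReal.ofReal (2 * M *
        (linearWeight l v q.2 + A * quadraticWeight l v q.2))) := by
    intro q
    rw [eLpNorm_enorm]
    have e2 := eLpNorm_const_smul (Real.exp (-nu γ b v * (t - q.1))) (fun x : R3 =>
      linearIntegrand γ b (g q.1 (x - (t - q.1) • v)) v q.2 +
      collisionIntegrand γ b (g q.1 (x - (t - q.1) • v)) (g q.1 (x - (t - q.1) • v)) v q.2) 2
      (volume : Measure R3)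
    simp only [Pi.smul_def, smul_eq_mul] at e2
    rw [hH]
    simp only
    rw [e2, Real.enorm_eq_ofReal (Real.exp_pos _).le]
    refine mul_le_mul_right ?_ _
    refine eLpNorm_integrand_le (f := fun x => g q.1 (x - (t - q.1) • v)) hb (by linarith)
      (hg.meas.comp (f := fun z : R3 × R3 => (q.1, z.1 - (t - q.1) • v, z.2)) (by fun_prop))
      (fun x w => hg.le _ _ _) (fun w => ?_) v q.2
    rw [eLpNorm_translate (f := fun x => g q.1 x w) (hg.meas.comp
      (f := fun x : R3 => (q.1, x, w)) (by fun_prop))]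
    exact h2 _ _
  have hsum := hW.lintegral_sum_le hb hK hA (show 0 ≤ 2 * M by linarith) v
  -- The explicit factor 1 matches the parameter c = 1 of `exp_nu_integral_le`. The data contribute
  -- M and the integral half of 2M, which reproduces 2M.
  set c := ((1 / 8 + 1 * A * K) * nu γ b v + (K + 1 * A * K)) * (2 * M * weight (-l) v) with hc
  have hc0 : 0 ≤ c := by positivity
  have hD : eLpNorm (fun x => ∫⁻ q, ‖H (x, q)‖ₑ ∂τ) 2 volume ≤
      ENNReal.ofReal (M * weight (-l) v) := by
    calc _ ≤ ∫⁻ q, eLpNorm (fun x => ‖H (x, q)‖ₑ) 2 volume ∂τ :=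
          eLpNorm_two_lintegral_le volume τ (F := fun z => ‖H z‖ₑ) hHm.enorm
      _ ≤ ∫⁻ q, ENNReal.ofReal (Real.exp (-nu γ b v * (t - q.1))) *
        (ENNReal.ofReal (kernel γ b v q.2.1 q.2.2) * ENNReal.ofReal (2 * M *
        (linearWeight l v q.2 + A * quadraticWeight l v q.2))) ∂τ := lintegral_mono hslice
      _ = ∫⁻ s in Ioc 0 t, ENNReal.ofReal (Real.exp (-nu γ b v * (t - s))) *
          ∫⁻ p : R3 × S2, ENNReal.ofReal (kernel γ b v p.1 p.2) * ENNReal.ofReal (2 * M *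
        (linearWeight l v p + A * quadraticWeight l v p)) ∂duDω := by
          have hm := measurable_slice hb.meas γ v (W := fun p => 2 * M *
            (linearWeight l v p + A * quadraticWeight l v p)) (((measurable_linearWeight l v).add
              ((measurable_quadraticWeight l v).const_mul _)).const_mul _)
          rw [hτ, lintegral_prod]
          · refine lintegral_congr fun s => ?_
            simp only
            rw [lintegral_const_mul _ hm]
          · exact (Measurable.mul (by fun_prop) (hm.comp measurable_snd)).aemeasurable
      _ ≤ ∫⁻ s in Ioc 0 t, ENNReal.ofReal (Real.exp (-nu γ b v * (t - s)) * c) := by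
          refine lintegral_mono fun s => ?_
          simp only
          rw [ENNReal.ofReal_mul (Real.exp_pos _).le, hc, one_mul]
          exact mul_le_mul_right hsum _
      _ = ENNReal.ofReal (∫ s in Ioc 0 t, Real.exp (-nu γ b v * (t - s)) * c) := by
          rw [ofReal_integral_eq_lintegral_ofReal]
          · exact (intervalIntegrable_iff_integrableOn_Ioc_of_le ht.1).1
              ((by fun_prop : Continuous _).intervalIntegrable _ _)
          · exact Filter.Eventually.of_forall fun s => by positivity
      _ ≤ _ := by
          apply ENNReal.ofReal_le_ofReal
          rw [← intervalIntegral.integral_of_le ht.1]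
          refine (exp_nu_integral_le hb hK hA hθ ht hMw v zero_le_one (by norm_num)).trans
            (le_of_eq (by ring))
  have hg₀ : eLpNorm (fun x => ‖g₀ (x - t • v) v‖ₑ) 2 volume ≤
      ENNReal.ofReal (M * weight (-l) v) := by
    rw [eLpNorm_enorm, eLpNorm_translate (f := fun x => g₀ x v) (h₀m.comp measurable_prodMk_right)]
    exact h₀ v
  have hm0 : Measurable fun x => ‖g₀ (x - t • v) v‖ₑ :=
    (h₀m.comp (f := fun x : R3 => (x - t • v, v)) (by fun_prop)).enorm
  have hI : Measurable fun x => ∫⁻ q, ‖H (x, q)‖ₑ ∂τ :=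
    (Measurable.enorm hHm).lintegral_prod_right'
  calc _ ≤ eLpNorm (fun x => ‖g₀ (x - t • v) v‖ₑ + ∫⁻ q, ‖H (x, q)‖ₑ ∂τ) 2 volume := by
        refine eLpNorm_mono_enorm fun x => ?_
        simpa using hpt x
    _ ≤ eLpNorm (fun x => ‖g₀ (x - t • v) v‖ₑ) 2 volume +
          eLpNorm (fun x => ∫⁻ q, ‖H (x, q)‖ₑ ∂τ) 2 volume :=
        eLpNorm_add_le (f := fun x => ‖g₀ (x - t • v) v‖ₑ) (g := fun x => ∫⁻ q, ‖H (x, q)‖ₑ ∂τ)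
          hm0.aestronglyMeasurable hI.aestronglyMeasurable (by norm_num)
    _ ≤ ENNReal.ofReal (M * weight (-l) v) + ENNReal.ofReal (M * weight (-l) v) :=
        add_le_add hg₀ hD
    _ = _ := by
        have := mul_nonneg hM (weight_pos (-l) v).le
        rw [← ENNReal.ofReal_add this this]; congr 1; ring

theorem eLpNorm_iterate_le (hb : IsCutoff b C) (hW : WeightBound γ b l K) (hK : 0 ≤ K)
    {A M : ℝ} (hM : 0 ≤ M)
    (hθ : 1 / 8 + 3 * A * K + (K + 3 * A * K) * T ≤ 1 / 2)
    {g₀ : R3 → R3 → ℝ} (h₀m : Measurable fun z : R3 × R3 => g₀ z.1 z.2)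
    (h₀ : ∀ v, eLpNorm (fun x => g₀ x v) 2 volume ≤ ENNReal.ofReal (M * weight (-l) v))
    (hA : ∀ n, Admissible l A (iterate γ b T g₀ n)) (n : ℕ) (t : ℝ) (v : R3) :
    eLpNorm (fun x => iterate γ b T g₀ n t x v) 2 volume ≤
      ENNReal.ofReal (2 * M * weight (-l) v) := by
  induction n generalizing t v with
  | zero => simp [iterate]
  | succ n ih =>
    rw [iterate_succ]
    exact eLpNorm_mildMap_le hb hW hK hM hθ h₀m h₀ (hA n) ih t v

/-- The uniform bound on the iterates passes to their pointwise limit by Fatou's lemma. -/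
theorem eLpNorm_limit_le (hb : IsCutoff b C) (hW : WeightBound γ b l K) (hK : 0 ≤ K)
    {A M : ℝ} (hM : 0 ≤ M)
    (hθ : 1 / 8 + 3 * A * K + (K + 3 * A * K) * T ≤ 1 / 2)
    {g₀ : R3 → R3 → ℝ} (h₀m : Measurable fun z : R3 × R3 => g₀ z.1 z.2)
    (h₀ : ∀ v, eLpNorm (fun x => g₀ x v) 2 volume ≤ ENNReal.ofReal (M * weight (-l) v))
    (hA : ∀ n, Admissible l A (iterate γ b T g₀ n)) {g : ℝ → R3 → R3 → ℝ}
    (hg : ∀ t x v, Filter.Tendsto (fun n => iterate γ b T g₀ n t x v) Filter.atTop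
      (nhds (g t x v))) (t : ℝ) (v : R3) :
    eLpNorm (fun x => g t x v) 2 volume ≤ ENNReal.ofReal (2 * M * weight (-l) v) := by
  have h1 := Lp.eLpNorm_lim_le_liminf_eLpNorm (p := 2) (μ := (volume : Measure R3))
    (f := fun n x => iterate γ b T g₀ n t x v)
    (fun n => ((hA n).meas.comp (f := fun x : R3 => (t, x, v)) (by fun_prop)).aestronglyMeasurable)
    (fun x => g t x v) (Filter.Eventually.of_forall fun x => hg t x v)
  refine h1.trans ?_
  refine Filter.liminf_le_of_le (by isBoundedDefault) fun c hc => ?_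
  obtain ⟨n, hn⟩ := hc.exists
  exact hn.trans (eLpNorm_iterate_le hb hW hK hM hθ h₀m h₀ hA n t v)

end Boltzmann

/-! ### Null sets along characteristics, and modifications of mild solutions -/

namespace Boltzmann

variable {γ : ℝ} {b : ℝ → ℝ} {C l K T : ℝ}

instance : (volume : Measure (R3 × R3)).IsAddHaarMeasure :=
  Measure.prod.instIsAddHaarMeasure _ _

instance : (volume : Measure ((R3 × R3) × R3)).IsAddHaarMeasure :=
  Measure.prod.instIsAddHaarMeasure _ _

theorem isLinearMap_vPost (ω : S2) : IsLinearMap ℝ fun q : R3 × R3 => vPost q.1 q.2 ω where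
  map_add p q := by
    simp only [vPost, Prod.fst_add, Prod.snd_add, inner_sub_left, inner_add_left]; module
  map_smul c q := by
    simp only [vPost, Prod.smul_fst, Prod.smul_snd, inner_sub_left, real_inner_smul_left]; module

theorem isLinearMap_uPost (ω : S2) : IsLinearMap ℝ fun q : R3 × R3 => uPost q.1 q.2 ω where
  map_add p q := by
    simp only [uPost, Prod.fst_add, Prod.snd_add, inner_sub_left, inner_add_left]; module
  map_smul c q := by
    simp only [uPost, Prod.smul_fst, Prod.smul_snd, inner_sub_left, real_inner_smul_left]; module

/-- Null sets of phase space are avoided by the arguments of the collision integrals along almost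
every characteristic. -/
theorem ae_shear_comp {f : R3 × R3 → R3} (hf : IsLinearMap ℝ f) (hd : ∀ w, f (w, w) = w)
    {N : Set (R3 × R3)} (hN : MeasurableSet N) (h0 : ∀ᵐ z : R3 × R3, z ∈ N) (a : ℝ) :
    ∀ᵐ q : (R3 × R3) × R3, (q.1.1 - a • q.1.2, f (q.1.2, q.2)) ∈ N := by
  have hL : IsLinearMap ℝ fun q : (R3 × R3) × R3 => (q.1.1 - a • q.1.2, f (q.1.2, q.2)) := by
    constructor
    · intro p q
      refine Prod.ext ?_ ?_
      · simp only [Prod.fst_add, Prod.snd_add]; module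
      · exact hf.map_add (p.1.2, p.2) (q.1.2, q.2)
    · intro c q
      refine Prod.ext ?_ ?_
      · simp only [Prod.smul_fst, Prod.smul_snd]; module
      · exact hf.map_smul c (q.1.2, q.2)
  -- The identity f(w,w) = w makes the linear map onto phase space surjective, and preimages of null
  -- sets under surjective linear maps are null; no Jacobian is computed.
  have hs : Function.Surjective (IsLinearMap.mk' _ hL) := by
    rintro ⟨y, w⟩
    refine ⟨((y + a • w, w), w), ?_⟩
    simp [hd]
  exact (ae_comp_linearMap_mem_iff (IsLinearMap.mk' _ hL) volume volume hs hN).2 h0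

theorem ae_shear {N : Set (R3 × R3)} (hN : MeasurableSet N) (h0 : ∀ᵐ z : R3 × R3, z ∈ N) (a : ℝ) :
    ∀ᵐ z : R3 × R3, (z.1 - a • z.2, z.2) ∈ N := by
  have hL : IsLinearMap ℝ fun z : R3 × R3 => (z.1 - a • z.2, z.2) := by
    constructor
    · intro p q
      refine Prod.ext ?_ rfl
      simp only [Prod.fst_add, Prod.snd_add]; module
    · intro c q
      refine Prod.ext ?_ rfl
      simp only [Prod.smul_fst, Prod.smul_snd]; module
  have hs : Function.Surjective (IsLinearMap.mk' _ hL) := by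
    rintro ⟨y, w⟩
    exact ⟨(y + a • w, w), by simp⟩
  exact (ae_comp_linearMap_mem_iff (IsLinearMap.mk' _ hL) volume volume hs hN).2 h0

theorem measurableSet_ae {α β : Type*} [MeasurableSpace α] [MeasurableSpace β] {ν : Measure β}
    [SFinite ν] {M : Set (α × β)} (hM : MeasurableSet M) :
    MeasurableSet {x | ∀ᵐ y ∂ν, (x, y) ∈ M} :=
  measurable_measure_prodMk_left hM.compl (measurableSet_singleton 0)

/-- A property of almost every point of phase space and time holds at the arguments of the
collision integrals along almost every characteristic. -/
theorem ae_characteristic {M : Set (ℝ × R3 × R3)} (hM : MeasurableSet M) {σ : Measure ℝ}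
    [SFinite σ] (h : ∀ᵐ s ∂σ, ∀ᵐ z : R3 × R3, (s, z) ∈ M) (t : ℝ) :
    ∀ᵐ z : R3 × R3, ∀ᵐ s ∂σ, ∀ᵐ p ∂duDω,
      (s, z.1 - (t - s) • z.2, vPost z.2 p.1 p.2) ∈ M ∧
      (s, z.1 - (t - s) • z.2, uPost z.2 p.1 p.2) ∈ M ∧
      (s, z.1 - (t - s) • z.2, p.1) ∈ M ∧ (s, z.1 - (t - s) • z.2, z.2) ∈ M := by
  set P : Set ((ℝ × (R3 × R3)) × (R3 × S2)) := {r |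
      (r.1.1, r.1.2.1 - (t - r.1.1) • r.1.2.2, vPost r.1.2.2 r.2.1 r.2.2) ∈ M ∧
      (r.1.1, r.1.2.1 - (t - r.1.1) • r.1.2.2, uPost r.1.2.2 r.2.1 r.2.2) ∈ M ∧
      (r.1.1, r.1.2.1 - (t - r.1.1) • r.1.2.2, r.2.1) ∈ M ∧
      (r.1.1, r.1.2.1 - (t - r.1.1) • r.1.2.2, r.1.2.2) ∈ M} with hP
  have hPm : MeasurableSet P := by
    refine MeasurableSet.inter ?_ (MeasurableSet.inter ?_ (MeasurableSet.inter ?_ ?_))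
    · exact hM.preimage (f := fun r : (ℝ × (R3 × R3)) × (R3 × S2) => (r.1.1, r.1.2.1 -
        (t - r.1.1) • r.1.2.2, vPost r.1.2.2 r.2.1 r.2.2)) (by fun_prop)
    · exact hM.preimage (f := fun r : (ℝ × (R3 × R3)) × (R3 × S2) => (r.1.1, r.1.2.1 -
        (t - r.1.1) • r.1.2.2, uPost r.1.2.2 r.2.1 r.2.2)) (by fun_prop)
    · exact hM.preimage (f := fun r : (ℝ × (R3 × R3)) × (R3 × S2) => (r.1.1, r.1.2.1 -
        (t - r.1.1) • r.1.2.2, r.2.1)) (by fun_prop)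
    · exact hM.preimage (f := fun r : (ℝ × (R3 × R3)) × (R3 × S2) => (r.1.1, r.1.2.1 -
        (t - r.1.1) • r.1.2.2, r.1.2.2)) (by fun_prop)
  change ∀ᵐ z : R3 × R3, ∀ᵐ s ∂σ, ∀ᵐ p ∂duDω, ((s, z), p) ∈ P
  rw [← Measure.ae_ae_comm (p := fun s z => ∀ᵐ p ∂duDω, ((s, z), p) ∈ P) (measurableSet_ae hPm)]
  filter_upwards [h] with s hs
  have hMs : MeasurableSet {z : R3 × R3 | (s, z) ∈ M} := hM.preimage measurable_prodMk_left
  -- For fixed s and ω all arguments of the collision integrals are linear in (x,v,u); the remaining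
  -- steps rearrange the "almost every" quantifiers by Fubini.
  have h1 : ∀ ω : S2, ∀ᵐ q : (R3 × R3) × R3, ((s, q.1), (q.2, ω)) ∈ P := by
    intro ω
    have a1 := ae_shear_comp (isLinearMap_vPost ω) (fun w => by simp [vPost]) hMs hs (t - s)
    have a2 := ae_shear_comp (isLinearMap_uPost ω) (fun w => by simp [uPost]) hMs hs (t - s)
    have a3 := ae_shear_comp (f := Prod.snd) ⟨fun _ _ => rfl, fun _ _ => rfl⟩ (fun w => rfl) hMs hs
      (t - s)
    have a4 := ae_shear_comp (f := Prod.fst) ⟨fun _ _ => rfl, fun _ _ => rfl⟩ (fun w => rfl) hMs hs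
      (t - s)
    filter_upwards [a1, a2, a3, a4] with q b1 b2 b3 b4
    exact ⟨b1, b2, b3, b4⟩
  have hm1 : MeasurableSet {r : S2 × ((R3 × R3) × R3) | ((s, r.2.1), (r.2.2, r.1)) ∈ P} :=
    hPm.preimage (f := fun r : S2 × ((R3 × R3) × R3) => ((s, r.2.1), (r.2.2, r.1))) (by fun_prop)
  have h2 : ∀ᵐ q : (R3 × R3) × R3, ∀ᵐ ω ∂(volume : Measure R3).toSphere,
      ((s, q.1), (q.2, ω)) ∈ P :=
    (Measure.ae_ae_comm (p := fun ω q => ((s, (q : (R3 × R3) × R3).1), (q.2, ω)) ∈ P) hm1).1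
      (Filter.Eventually.of_forall h1)
  filter_upwards [Measure.ae_ae_of_ae_prod h2] with z hz
  exact (Measure.ae_prod_mem_iff_ae_ae_mem (hPm.preimage measurable_prodMk_left)).2 hz

/-- Functions that agree almost everywhere have the same collision integrals along almost every
characteristic. -/
theorem ae_integrand_congr {f h : ℝ → R3 → R3 → ℝ} {a t : ℝ}
    (hfh : ∀ᵐ p ∂((volume.restrict (Icc (0 : ℝ) a)).prod (volume : Measure (R3 × R3))),
      f p.1 p.2.1 p.2.2 = h p.1 p.2.1 p.2.2) (ht : t ≤ a) :
    ∀ᵐ z : R3 × R3, ∀ᵐ s ∂(volume.restrict (Icc (0 : ℝ) t)),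
      linearIntegrand γ b (f s (z.1 - (t - s) • z.2)) z.2 =ᵐ[duDω]
        linearIntegrand γ b (h s (z.1 - (t - s) • z.2)) z.2 ∧
      collisionIntegrand γ b (f s (z.1 - (t - s) • z.2)) (f s (z.1 - (t - s) • z.2)) z.2 =ᵐ[duDω]
        collisionIntegrand γ b (h s (z.1 - (t - s) • z.2)) (h s (z.1 - (t - s) • z.2)) z.2 := by
  obtain ⟨M, hMsub, hMm, hM⟩ : ∃ M : Set (ℝ × R3 × R3),
      M ⊆ {p | f p.1 p.2.1 p.2.2 = h p.1 p.2.1 p.2.2} ∧ MeasurableSet M ∧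
      ∀ᵐ p ∂((volume.restrict (Icc (0 : ℝ) a)).prod (volume : Measure (R3 × R3))), p ∈ M := by
    obtain ⟨N, h1, h2, h3⟩ := exists_measurable_superset_of_null (ae_iff.1 hfh)
    refine ⟨Nᶜ, fun p hp => ?_, h2.compl, ?_⟩
    · by_contra hcon; exact hp (h1 hcon)
    · rw [ae_iff]; simpa using h3
  have h1 : ∀ᵐ s ∂(volume.restrict (Icc (0 : ℝ) t)), ∀ᵐ z : R3 × R3, (s, z) ∈ M :=
    ae_restrict_of_ae_restrict_of_subset (Icc_subset_Icc_right ht) (Measure.ae_ae_of_ae_prod hM)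
  filter_upwards [ae_characteristic hMm h1 t] with z hz
  filter_upwards [hz] with s hs
  constructor
  · filter_upwards [hs] with p hp
    have e1 := hMsub hp.1
    have e2 := hMsub hp.2.1
    have e3 := hMsub hp.2.2.1
    simp only [mem_ofPred_eq] at e1 e2 e3
    simp only [linearIntegrand, e1, e2, e3]
  · filter_upwards [hs] with p hp
    have e1 := hMsub hp.1
    have e2 := hMsub hp.2.1
    have e3 := hMsub hp.2.2.1
    have e4 := hMsub hp.2.2.2
    simp only [mem_ofPred_eq] at e1 e2 e3 e4
    simp only [collisionIntegrand, e1, e2, e3, e4]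

theorem Admissible.intervalIntegrable_linearK (hb : IsCutoff b C) (hW : WeightBound γ b l K)
    (hK : 0 ≤ K) {A : ℝ} {g : ℝ → R3 → R3 → ℝ} (hg : Admissible l A g) (ν t a a' : ℝ) (x v : R3) :
    IntervalIntegrable (fun s => Real.exp (-ν * (t - s)) *
      linearK γ b (g s (x - (t - s) • v)) v) volume a a' := by
  refine intervalIntegrable_exp_mul ?_ (fun s => hW.abs_linearK_le hb hK
    (measurable_comp_left hg.meas _ _) (hg.le _ _) v) _ _ _ _
  refine measurable_linearK (f := fun s => g s (x - (t - s) • v)) hb ?_ measurable_const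
  exact hg.meas.comp (f := fun q : ℝ × R3 => (q.1, x - (t - q.1) • v, q.2)) (by fun_prop)

theorem Admissible.intervalIntegrable_collision (hb : IsCutoff b C) (hW : WeightBound γ b l K)
    (hK : 0 ≤ K) {A : ℝ} {g : ℝ → R3 → R3 → ℝ} (hg : Admissible l A g) (ν t a a' : ℝ) (x v : R3) :
    IntervalIntegrable (fun s => Real.exp (-ν * (t - s)) *
      collision γ b (g s (x - (t - s) • v)) (g s (x - (t - s) • v)) v) volume a a' := by
  refine intervalIntegrable_exp_mul ?_ (fun s => hW.abs_collision_le hb hK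
    (measurable_comp_left hg.meas _ _) (measurable_comp_left hg.meas _ _) (hg.le _ _) (hg.le _ _) v)
    _ _ _ _
  have hm : Measurable fun q : ℝ × R3 => g q.1 (x - (t - q.1) • v) q.2 :=
    hg.meas.comp (f := fun q : ℝ × R3 => (q.1, x - (t - q.1) • v, q.2)) (by fun_prop)
  exact measurable_collision (f := fun s => g s (x - (t - s) • v))
    (g := fun s => g s (x - (t - s) • v)) hb hm hm measurable_const

theorem ae_initial_char {g₀ g₁ : R3 → R3 → ℝ} (h : ∀ᵐ z : R3 × R3, g₀ z.1 z.2 = g₁ z.1 z.2)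
    (t : ℝ) : ∀ᵐ z : R3 × R3, g₀ (z.1 - t • z.2) z.2 = g₁ (z.1 - t • z.2) z.2 := by
  obtain ⟨N, h1, h2, h3⟩ := exists_measurable_superset_of_null (ae_iff.1 h)
  have h4 : ∀ᵐ z : R3 × R3, z ∈ Nᶜ := by rw [ae_iff]; simpa using h3
  filter_upwards [ae_shear h2.compl h4 t] with z hz
  by_contra hcon
  exact hz (h1 hcon)

theorem Admissible.integral_source (hb : IsCutoff b C) (hW : WeightBound γ b l K)
    (hK : 0 ≤ K) {A : ℝ} {g : ℝ → R3 → R3 → ℝ} (hg : Admissible l A g) (t : ℝ) (x v : R3) :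
    (∫ s in (0 : ℝ)..t, Real.exp (-nu γ b v * (t - s)) * linearK γ b (g s (x - (t - s) • v)) v) +
      ∫ s in (0 : ℝ)..t, Real.exp (-nu γ b v * (t - s)) *
          collision γ b (g s (x - (t - s) • v)) (g s (x - (t - s) • v)) v =
    ∫ s in (0 : ℝ)..t, Real.exp (-nu γ b v * (t - s)) * source γ b (g s (x - (t - s) • v)) v := by
  rw [← intervalIntegral.integral_add (hg.intervalIntegrable_linearK hb hW hK _ _ _ _ _ _)
    (hg.intervalIntegrable_collision hb hW hK _ _ _ _ _ _)]
  simp only [source, mul_add]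

/-- Fixed points of the Duhamel map are mild solutions. -/
theorem isMildSolution_of_fixedPoint (hb : IsCutoff b C) (hW : WeightBound γ b l K) (hK : 0 ≤ K)
    {A : ℝ} {g₀ g₁ : R3 → R3 → ℝ} (h₀ : ∀ᵐ z : R3 × R3, g₀ z.1 z.2 = g₁ z.1 z.2)
    {g : ℝ → R3 → R3 → ℝ} (hg : Admissible l A g) (hfix : mildMap γ b T g₁ g = g) :
    IsMildSolution γ b T g₀ g := by
  intro t ht
  filter_upwards [ae_initial_char h₀ t] with z hz
  refine ⟨Filter.Eventually.of_forall fun s => ⟨?_, ?_⟩,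
    hg.intervalIntegrable_linearK hb hW hK _ _ _ _ _ _,
    hg.intervalIntegrable_collision hb hW hK _ _ _ _ _ _, ?_⟩
  · exact hW.integrable_linearIntegrand hb (measurable_comp_left hg.meas _ _) (hg.le _ _) _
  · exact hW.integrable_collisionIntegrand hb (measurable_comp_left hg.meas _ _)
      (measurable_comp_left hg.meas _ _) (hg.le _ _) (hg.le _ _) _
  · conv_lhs => rw [← hfix]
    rw [mildMap_of_mem ht, hz, add_assoc, hg.integral_source hb hW hK]

/-- A mild solution is the image under the Duhamel map of any of its modifications. -/
theorem IsMildSolution.eq_mildMap (hb : IsCutoff b C) (hW : WeightBound γ b l K) (hK : 0 ≤ K)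
    {A a : ℝ} {g₀ g₁ : R3 → R3 → ℝ} (h₀ : ∀ᵐ z : R3 × R3, g₀ z.1 z.2 = g₁ z.1 z.2)
    {h f : ℝ → R3 → R3 → ℝ} (hh : IsMildSolution γ b T g₀ h) (hf : Admissible l A f)
    (hfh : ∀ᵐ p ∂((volume.restrict (Icc (0 : ℝ) a)).prod (volume : Measure (R3 × R3))),
      f p.1 p.2.1 p.2.2 = h p.1 p.2.1 p.2.2) (ha : a ≤ T) {t : ℝ} (ht : t ∈ Icc 0 a) :
    ∀ᵐ z : R3 × R3, h t z.1 z.2 = mildMap γ b T g₁ f t z.1 z.2 := by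
  have htT : t ∈ Icc 0 T := ⟨ht.1, ht.2.trans ha⟩
  filter_upwards [hh t htT, ae_initial_char h₀ t, ae_integrand_congr (γ := γ) (b := b) hfh ht.2]
    with z hz h0 hc
  obtain ⟨-, -, -, hz⟩ := hz
  have hc' := ae_restrict_of_ae_restrict_of_subset Ioc_subset_Icc_self hc
  rw [mildMap_of_mem htT, hz, h0, add_assoc, ← hf.integral_source hb hW hK]
  congr 2
  · rw [intervalIntegral.integral_of_le ht.1, intervalIntegral.integral_of_le ht.1]
    refine integral_congr_ae ?_
    filter_upwards [hc'] with s hs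
    simp only [linearK, integral_congr_ae hs.1]
  · rw [intervalIntegral.integral_of_le ht.1, intervalIntegral.integral_of_le ht.1]
    refine integral_congr_ae ?_
    filter_upwards [hc'] with s hs
    simp only [collision, integral_congr_ae hs.2]

/-- Almost everywhere bounds become pointwise bounds after modification on a null set. -/
theorem exists_modification {h g : ℝ → R3 → R3 → ℝ} {a : ℝ}
    (hh : AEStronglyMeasurable (fun p : ℝ × R3 × R3 => h p.1 p.2.1 p.2.2)
      ((volume.restrict (Icc (0 : ℝ) a)).prod (volume : Measure (R3 × R3))))
    (hg : Measurable fun p : ℝ × R3 × R3 => g p.1 p.2.1 p.2.2) {d : ℝ → R3 → ℝ}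
    (hd : Measurable fun p : ℝ × R3 × R3 => d p.1 p.2.2) (hd0 : ∀ t v, 0 ≤ d t v)
    (hle : ∀ t ∈ Icc 0 a, ∀ᵐ z : R3 × R3, |h t z.1 z.2 - g t z.1 z.2| ≤ d t z.2) :
    ∃ f : ℝ → R3 → R3 → ℝ, (Measurable fun p : ℝ × R3 × R3 => f p.1 p.2.1 p.2.2) ∧
      (∀ t x v, |f t x v - g t x v| ≤ d t v) ∧
      ∀ᵐ p ∂((volume.restrict (Icc (0 : ℝ) a)).prod (volume : Measure (R3 × R3))),
        f p.1 p.2.1 p.2.2 = h p.1 p.2.1 p.2.2 := by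
  classical
  have hm := hh.stronglyMeasurable_mk.measurable
  set h' := hh.mk _ with hh'
  have hset : MeasurableSet {p : ℝ × R3 × R3 | |h' p - g p.1 p.2.1 p.2.2| ≤ d p.1 p.2.2} :=
    measurableSet_le ((hm.sub hg).abs) hd
  -- Wherever the bound fails the value of g is substituted, which satisfies it because d ≥ 0. By
  -- Fubini this happens on a null set of (t,x,v) only.
  refine ⟨fun t x v => if |h' (t, x, v) - g t x v| ≤ d t v then h' (t, x, v) else g t x v,
    Measurable.ite hset hm hg, fun t x v => ?_, ?_⟩
  · by_cases hc : |h' (t, x, v) - g t x v| ≤ d t v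
    · simp only [if_pos hc]; exact hc
    · simp only [if_neg hc, sub_self, abs_zero]; exact hd0 t v
  · have h1 : ∀ᵐ p ∂((volume.restrict (Icc (0 : ℝ) a)).prod (volume : Measure (R3 × R3))),
        p ∈ {p : ℝ × R3 × R3 | |h' p - g p.1 p.2.1 p.2.2| ≤ d p.1 p.2.2} := by
      rw [Measure.ae_prod_mem_iff_ae_ae_mem hset]
      filter_upwards [Measure.ae_ae_of_ae_prod hh.ae_eq_mk, ae_restrict_mem measurableSet_Icc]
        with t ht1 ht2
      filter_upwards [ht1, hle t ht2] with z hz1 hz2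
      rw [hz1] at hz2; exact hz2
    filter_upwards [h1, hh.ae_eq_mk] with p hp1 hp2
    rw [if_pos hp1, hp2]

end Boltzmann

/-! ### Uniqueness among mild solutions of arbitrary size -/

namespace Boltzmann

variable {γ : ℝ} {b : ℝ → ℝ} {C l k K T : ℝ}

theorem measurable_weight_snd (c l : ℝ) :
    Measurable fun p : ℝ × R3 × R3 => c * weight (-l) p.2.2 := by fun_prop

/-- Closeness of a mild solution to a fixed point of the Duhamel map improves by a factor. -/
theorem mildSolution_contraction (hb : IsCutoff b C) (hW : WeightBound γ b l K) (hK : 0 ≤ K)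
    {A D a : ℝ} (hD : 0 ≤ D)
    (hθ : 1 / 8 + 3 * (A + D) * K + (K + 3 * (A + D) * K) * T ≤ 1 / 2)
    {g₀ g₁ : R3 → R3 → ℝ} (h₀ : ∀ᵐ z : R3 × R3, g₀ z.1 z.2 = g₁ z.1 z.2)
    {g h : ℝ → R3 → R3 → ℝ} (hg : Admissible l A g) (hfix : mildMap γ b T g₁ g = g)
    (hh : IsMildSolution γ b T g₀ h)
    (hm : AEStronglyMeasurable (fun p : ℝ × R3 × R3 => h p.1 p.2.1 p.2.2)
      ((volume.restrict (Icc (0 : ℝ) a)).prod (volume : Measure (R3 × R3)))) (ha : a ≤ T)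
    (hle : ∀ t ∈ Icc 0 a, ∀ᵐ z : R3 × R3, |h t z.1 z.2 - g t z.1 z.2| ≤ D * weight (-l) z.2) :
    ∀ t ∈ Icc 0 a, ∀ᵐ z : R3 × R3, |h t z.1 z.2 - g t z.1 z.2| ≤ D / 2 * weight (-l) z.2 := by
  obtain ⟨f, hfm, hfd, hfh⟩ := exists_modification hm hg.meas (d := fun _ v => D * weight (-l) v)
    (measurable_weight_snd D l) (fun _ v => mul_nonneg hD (weight_pos _ _).le) hle
  have hf : Admissible l (A + D) f := ⟨hfm, fun t x v => by
    have h1 := abs_le.1 (hfd t x v)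
    have h2 := abs_le.1 (hg.le t x v)
    rw [abs_le]; constructor <;> linarith⟩
  intro t ht
  filter_upwards [hh.eq_mildMap hb hW hK h₀ hf hfh ha ht] with z hz
  rw [hz]
  conv_lhs => rw [← hfix]
  exact mildMap_contraction hb hW hK hθ hf (hg.mono (by linarith)) hfd t z.1 z.2

/-- A solution within D of g has, after modification, size at most A+D, where the Duhamel map still
contracts; the distance to g can therefore be halved indefinitely. -/
theorem mildSolution_eq_of_close (hb : IsCutoff b C) (hW : WeightBound γ b l K) (hK : 0 ≤ K)
    {A D a : ℝ} (hD : 0 ≤ D) (hT : 0 ≤ T)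
    (hθ : 1 / 8 + 3 * (A + D) * K + (K + 3 * (A + D) * K) * T ≤ 1 / 2)
    {g₀ g₁ : R3 → R3 → ℝ} (h₀ : ∀ᵐ z : R3 × R3, g₀ z.1 z.2 = g₁ z.1 z.2)
    {g h : ℝ → R3 → R3 → ℝ} (hg : Admissible l A g) (hfix : mildMap γ b T g₁ g = g)
    (hh : IsMildSolution γ b T g₀ h)
    (hm : AEStronglyMeasurable (fun p : ℝ × R3 × R3 => h p.1 p.2.1 p.2.2)
      ((volume.restrict (Icc (0 : ℝ) a)).prod (volume : Measure (R3 × R3)))) (ha : a ≤ T)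
    (hle : ∀ t ∈ Icc 0 a, ∀ᵐ z : R3 × R3, |h t z.1 z.2 - g t z.1 z.2| ≤ D * weight (-l) z.2) :
    ∀ t ∈ Icc 0 a, ∀ᵐ z : R3 × R3, h t z.1 z.2 = g t z.1 z.2 := by
  have key : ∀ n : ℕ, ∀ t ∈ Icc 0 a, ∀ᵐ z : R3 × R3,
      |h t z.1 z.2 - g t z.1 z.2| ≤ D * (1 / 2) ^ n * weight (-l) z.2 := by
    intro n
    induction n with
    | zero => simpa using hle
    | succ n ih =>
      have hDn : D * (1 / 2) ^ n ≤ D :=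
        mul_le_of_le_one_right hD (pow_le_one₀ (by norm_num) (by norm_num))
      have := mildSolution_contraction hb hW hK (D := D * (1 / 2) ^ n) (by positivity)
        (le_trans (by gcongr) hθ) h₀ hg hfix hh hm ha ih
      intro t ht
      filter_upwards [this t ht] with z hz
      refine hz.trans (le_of_eq ?_)
      ring
  intro t ht
  filter_upwards [ae_all_iff.2 fun n => key n t ht] with z hz
  have hl : Filter.Tendsto (fun n : ℕ => D * weight (-l) z.2 * (1 / 2) ^ n) Filter.atTop
      (nhds 0) := by
    have := tendsto_pow_atTop_nhds_zero_of_lt_one (r := (1 / 2 : ℝ)) (by norm_num) (by norm_num)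
    simpa using this.const_mul (D * weight (-l) z.2)
  have h1 : |h t z.1 z.2 - g t z.1 z.2| ≤ 0 :=
    ge_of_tendsto' hl fun n => (hz n).trans (le_of_eq (by ring))
  exact sub_eq_zero.1 (abs_nonpos_iff.1 h1)

/-- A mild solution that agrees with a fixed point of the Duhamel map up to time `a` departs from it
at most linearly in a weaker norm. -/
theorem mildSolution_extension (hb : IsCutoff b C) (hW : WeightBound γ b k K) (hK : 0 ≤ K)
    {A H a a' : ℝ} (hA : 0 ≤ A) (hH : 0 ≤ H)
    {g₀ g₁ : R3 → R3 → ℝ} (h₀ : ∀ᵐ z : R3 × R3, g₀ z.1 z.2 = g₁ z.1 z.2)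
    {g h : ℝ → R3 → R3 → ℝ} (hg : Admissible k A g) (hfix : mildMap γ b T g₁ g = g)
    (hh : IsMildSolution γ b T g₀ h)
    (hm : AEStronglyMeasurable (fun p : ℝ × R3 × R3 => h p.1 p.2.1 p.2.2)
      ((volume.restrict (Icc (0 : ℝ) a')).prod (volume : Measure (R3 × R3)))) (ha : a' ≤ T)
    (haa : a ≤ a')
    (hbd : ∀ t ∈ Icc 0 a', ∀ᵐ z : R3 × R3, |h t z.1 z.2| ≤ H * weight (-k) z.2)
    (heq : ∀ t ∈ Icc 0 a, ∀ᵐ z : R3 × R3, h t z.1 z.2 = g t z.1 z.2) :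
    ∀ t ∈ Icc 0 a', ∀ᵐ z : R3 × R3, |h t z.1 z.2 - g t z.1 z.2| ≤
      (a' - a) * (((1 / 8 + 2 * (H + 2 * A) * K) * K + (K + 2 * (H + 2 * A) * K)) * (H + A)) *
        weight (-(k - 1)) z.2 := by
  classical
  set A' := H + 2 * A with hA'
  have hA'0 : 0 ≤ A' := by positivity
  have hd0 : ∀ (t : ℝ) (v : R3), 0 ≤ if t ≤ a then 0 else (H + A) * weight (-k) v := fun t v => by
    have := (weight_pos (-k) v).le
    split_ifs <;> positivity
  -- The allowed deviation is 0 up to time a, so the modification equals g there everywhere and the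
  -- Duhamel difference collects only times in (a, a'].
  obtain ⟨f, hfm, hfd, hfh⟩ := exists_modification hm hg.meas
    (d := fun t v => if t ≤ a then 0 else (H + A) * weight (-k) v)
    (Measurable.ite (measurableSet_le measurable_fst measurable_const) measurable_const
      (measurable_weight_snd (H + A) k)) hd0 (fun t ht => by
      by_cases hta : t ≤ a
      · filter_upwards [heq t ⟨ht.1, hta⟩] with z hz
        rw [hz, sub_self, abs_zero, if_pos hta]
      · filter_upwards [hbd t ht] with z hz
        rw [if_neg hta, add_mul]
        exact (abs_sub _ _).trans (add_le_add hz (hg.le _ _ _)))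
  have hfd' : ∀ t x v, |f t x v - g t x v| ≤ (H + A) * weight (-k) v := fun t x v => by
    refine (hfd t x v).trans ?_
    have := (weight_pos (-k) v).le
    split_ifs
    · positivity
    · exact le_rfl
  have hf : Admissible k A' f := ⟨hfm, fun t x v => by
    have h1 := abs_le.1 (hfd' t x v)
    have h2 := abs_le.1 (hg.le t x v)
    rw [abs_le]; constructor <;> linarith⟩
  have hgA' : Admissible k A' g := hg.mono (by linarith)
  intro t ht
  filter_upwards [hh.eq_mildMap hb hW hK h₀ hf hfh ha ht] with z hz
  rw [hz]
  conv_lhs => rw [← hfix]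
  set v := z.2
  set c := (((1 / 8 + 2 * A' * K) * K + (K + 2 * A' * K)) * (H + A)) * weight (-(k - 1)) v with hc
  have hc0 : 0 ≤ c := mul_nonneg (by positivity) (weight_pos _ _).le
  have hν := nu_nonneg hb γ v
  have hcm : Measurable fun s : ℝ => if s ≤ a then 0 else c :=
    Measurable.ite measurableSet_Iic measurable_const measurable_const
  have hcle : ∀ s : ℝ, |if s ≤ a then 0 else c| ≤ c := fun s => by
    split_ifs
    · simpa using hc0
    · rw [abs_of_nonneg hc0]
  have hdiff := mildMap_sub_le (g₀ := g₁) (T := T) (x := z.1) (v := v) (t := t) hb hW hK hf hgA'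
    (m := fun s => if s ≤ a then 0 else c) ⟨ht.1, ht.2.trans ha⟩
    (intervalIntegrable_exp_mul hcm hcle _ _ _ _) (fun s hs => by
      by_cases hsa : s ≤ a
      · have e : f s = g s := by
          funext x w
          have := hfd s x w
          rw [if_pos hsa] at this
          exact sub_eq_zero.1 (abs_nonpos_iff.1 this)
        rw [e, sub_self, abs_zero, if_pos hsa]
      · rw [if_neg hsa]
        refine (hW.abs_source_sub_le hb hK (measurable_comp_left hfm _ _)
          (measurable_comp_left hg.meas _ _) (hf.le _ _) (hgA'.le _ _) (hfd' _ _) v).trans ?_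
        -- Over a short time interval the exponential gives no smallness for the term with ν.
        -- Instead ν ≤ K(1+|v|) is used, at the cost of one power of the weight, and the length a' -
        -- a becomes available as a factor.
        have e : weight (-(k - 1)) v = (1 + ‖v‖) * weight (-k) v := by
          rw [show -(k - 1) = 1 + -k by ring, weight_add, weight_one]
        rw [hc, e]
        have h1 : (1 / 8 + 2 * A' * K) * nu γ b v + (K + 2 * A' * K) ≤
            ((1 / 8 + 2 * A' * K) * K + (K + 2 * A' * K)) * (1 + ‖v‖) := by
          have h2 := mul_le_mul_of_nonneg_left (hW.nu_le v)
            (show 0 ≤ 1 / 8 + 2 * A' * K by positivity)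
          have h3 := mul_nonneg (show 0 ≤ K + 2 * A' * K by positivity) (norm_nonneg v)
          linarith
        have h4 : 0 ≤ (H + A) * weight (-k) v := mul_nonneg (by positivity) (weight_pos _ _).le
        refine (mul_le_mul_of_nonneg_right h1 h4).trans (le_of_eq (by ring)))
  refine hdiff.trans ?_
  rw [mul_assoc, ← hc]
  have hmono : ∫ s in (0 : ℝ)..t, Real.exp (-nu γ b v * (t - s)) * (if s ≤ a then 0 else c) ≤
      ∫ s in Ioc 0 t, (Ioi a).indicator (fun _ => c) s := by
    rw [intervalIntegral.integral_of_le ht.1]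
    have hi := (intervalIntegrable_iff_integrableOn_Ioc_of_le ht.1).1
      (intervalIntegrable_exp_mul hcm hcle (nu γ b v) t 0 t)
    refine setIntegral_mono_on hi ((integrable_const c).indicator measurableSet_Ioi)
      measurableSet_Ioc fun s hs => ?_
    have he : Real.exp (-nu γ b v * (t - s)) ≤ 1 :=
      Real.exp_le_one_iff.2 (by nlinarith [hs.2])
    by_cases hsa : s ≤ a
    · rw [if_pos hsa, indicator_of_notMem (by simpa using hsa), mul_zero]
    · rw [if_neg hsa, indicator_of_mem (by simpa using hsa)]
      exact mul_le_of_le_one_left hc0 he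
  refine hmono.trans ?_
  rw [setIntegral_indicator measurableSet_Ioi, setIntegral_const, smul_eq_mul]
  refine mul_le_mul_of_nonneg_right ?_ hc0
  have hsub : Ioc 0 t ∩ Ioi a ⊆ Ioc a a' := fun s hs => ⟨hs.2, hs.1.2.trans ht.2⟩
  have h5 := measureReal_mono (μ := (volume : Measure ℝ)) hsub (by simp)
  rwa [Real.volume_real_Ioc_of_le haa] at h5

/-- Uniqueness of mild solutions. -/
theorem mildSolution_unique (hb : IsCutoff b C) (hW : WeightBound γ b k K)
    (hW' : WeightBound γ b (k - 1) K) (hK : 0 ≤ K)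
    {A D H : ℝ} (hA : 0 ≤ A) (hD : 0 < D) (hH : 0 ≤ H) (hT : 0 ≤ T)
    (hθ : 1 / 8 + 3 * (A + D) * K + (K + 3 * (A + D) * K) * T ≤ 1 / 2)
    {g₀ g₁ : R3 → R3 → ℝ} (h₀ : ∀ᵐ z : R3 × R3, g₀ z.1 z.2 = g₁ z.1 z.2)
    {g h : ℝ → R3 → R3 → ℝ} (hg : Admissible k A g) (hfix : mildMap γ b T g₁ g = g)
    (hh : IsMildSolution γ b T g₀ h)
    (hm : AEStronglyMeasurable (fun p : ℝ × R3 × R3 => h p.1 p.2.1 p.2.2)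
      ((volume.restrict (Icc (0 : ℝ) T)).prod (volume : Measure (R3 × R3))))
    (hbd : ∀ t ∈ Icc 0 T, ∀ᵐ z : R3 × R3, |h t z.1 z.2| ≤ H * weight (-k) z.2) :
    ∀ t ∈ Icc 0 T, ∀ᵐ z : R3 × R3, h t z.1 z.2 = g t z.1 z.2 := by
  set M := ((1 / 8 + 2 * (H + 2 * A) * K) * K + (K + 2 * (H + 2 * A) * K)) * (H + A) with hM
  have hM0 : 0 ≤ M := by positivity
  -- The step is chosen so that δM ≤ D: within time δ of agreement h remains D-close to g in weight
  -- k-1. It depends on the size H of h but not on the time already covered.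
  set δ := D / (M + 1) with hδ
  have hδ0 : 0 < δ := by positivity
  have hδM : δ * M ≤ D := by
    rw [hδ, div_mul_eq_mul_div, div_le_iff₀ (by positivity)]
    nlinarith
  -- The offset -δ makes the interval empty for n = 0, so the induction needs no base argument.
  have key : ∀ n : ℕ, ∀ t ∈ Icc 0 (min (n * δ - δ) T), ∀ᵐ z : R3 × R3,
      h t z.1 z.2 = g t z.1 z.2 := by
    intro n
    induction n with
    | zero =>
      intro t ht
      have h1 := ht.1.trans (ht.2.trans (min_le_left _ _))
      norm_num at h1
      linarith
    | succ n ih =>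
      set a := min (n * δ - δ) T with ha
      set a' := min (((n + 1 : ℕ) : ℝ) * δ - δ) T with ha'
      have haT : a' ≤ T := min_le_right _ _
      have e : ((n + 1 : ℕ) : ℝ) * δ - δ = (n * δ - δ) + δ := by push_cast; ring
      have haa : a ≤ a' := min_le_min_right _ (by rw [e]; linarith)
      have hda : a' - a ≤ δ := by
        rw [ha, ha', e]
        rcases le_total (n * δ - δ) T with h1 | h1
        · rw [min_eq_left h1]; linarith [min_le_left (n * δ - δ + δ) T]
        · rw [min_eq_right h1]; linarith [min_le_right (n * δ - δ + δ) T]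
      have hm' : AEStronglyMeasurable (fun p : ℝ × R3 × R3 => h p.1 p.2.1 p.2.2)
          ((volume.restrict (Icc (0 : ℝ) a')).prod (volume : Measure (R3 × R3))) :=
        hm.mono_measure (Measure.prod_mono
          (Measure.restrict_mono (Icc_subset_Icc_right haT) le_rfl) le_rfl)
      have hext := mildSolution_extension hb hW hK hA hH h₀ hg hfix hh hm' haT haa
        (fun t ht => hbd t ⟨ht.1, ht.2.trans haT⟩) ih
      refine mildSolution_eq_of_close hb hW' hK hD.le hT hθ h₀
        (hg.weight_mono (by linarith)) hfix hh hm' haT fun t ht => ?_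
      filter_upwards [hext t ht] with z hz
      refine hz.trans (mul_le_mul_of_nonneg_right ?_ (weight_pos _ _).le)
      exact (mul_le_mul_of_nonneg_right hda hM0).trans hδM
  obtain ⟨n, hn⟩ := exists_nat_ge ((T + δ) / δ)
  rw [div_le_iff₀ hδ0] at hn
  have := key n
  rwa [min_eq_right (by linarith)] at this

end Boltzmann

/-! ### Mixed norms, representatives of the data, and the conclusion -/

namespace Boltzmann

variable {γ : ℝ} {b : ℝ → ℝ} {C l k K T : ℝ}

theorem ae_le_of_mixedNorm_le {p N : ℝ≥0∞} {f : R3 → R3 → ℝ} (h : mixedNorm ∞ p f ≤ N) :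
    ∀ᵐ v : R3, eLpNorm (fun x => f x v) p volume ≤ N := by
  rw [mixedNorm, eLpNorm_exponent_top] at h
  filter_upwards [enorm_ae_le_eLpNormEssSup (fun v => eLpNorm (fun x => f x v) p volume) volume]
    with v hv
  exact hv.trans h

theorem mixedNorm_le_of_forall {p N : ℝ≥0∞} {f : R3 → R3 → ℝ}
    (h : ∀ v : R3, eLpNorm (fun x => f x v) p volume ≤ N) : mixedNorm ∞ p f ≤ N := by
  rw [mixedNorm, eLpNorm_exponent_top]
  exact essSup_le_of_ae_le _ (Filter.Eventually.of_forall h)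

theorem eLpNorm_weight_mul (k : ℝ) (f : R3 → R3 → ℝ) (p : ℝ≥0∞) (v : R3) :
    eLpNorm (fun x => weight k v * f x v) p volume =
      ENNReal.ofReal (weight k v) * eLpNorm (fun x => f x v) p volume := by
  have := eLpNorm_const_smul (weight k v) (fun x => f x v) p (volume : Measure R3)
  simp only [Pi.smul_def, smul_eq_mul] at this
  rw [this, Real.enorm_eq_ofReal (weight_pos _ _).le]

theorem ofReal_weight_mul_cancel (k M : ℝ) (v : R3) :
    ENNReal.ofReal (weight k v) * ENNReal.ofReal (M * weight (-k) v) = ENNReal.ofReal M := by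
  have := weight_pos k v
  rw [← ENNReal.ofReal_mul this.le, weight_neg]
  congr 1
  field_simp

theorem weight_mul_le_iff (k M : ℝ) (v : R3) (E : ℝ≥0∞) :
    ENNReal.ofReal (weight k v) * E ≤ ENNReal.ofReal M ↔ E ≤ ENNReal.ofReal (M * weight (-k) v) := by
  have h := weight_pos k v
  have h0 : ENNReal.ofReal (weight k v) ≠ 0 := by simpa using h
  rw [← ofReal_weight_mul_cancel k M v,
    ENNReal.mul_le_mul_iff_right h0 ENNReal.ofReal_ne_top]

theorem normInf_le_of_forall {f : R3 → R3 → ℝ} {N : ℝ} (h : ∀ x v, |f x v| ≤ N * weight (-k) v) :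
    normInf k f ≤ ENNReal.ofReal N := by
  refine mixedNorm_le_of_forall fun v => ?_
  rw [eLpNorm_weight_mul, weight_mul_le_iff, eLpNorm_exponent_top]
  refine essSup_le_of_ae_le _ (Filter.Eventually.of_forall fun x => ?_)
  simp only [Real.enorm_eq_ofReal_abs]
  exact ENNReal.ofReal_le_ofReal (h x v)

theorem normL2_le_of_forall {f : R3 → R3 → ℝ} {M : ℝ}
    (h : ∀ v, eLpNorm (fun x => f x v) 2 volume ≤ ENNReal.ofReal (M * weight (-k) v)) :
    normL2 k f ≤ ENNReal.ofReal M := by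
  refine mixedNorm_le_of_forall fun v => ?_
  rw [eLpNorm_weight_mul, weight_mul_le_iff]
  exact h v

theorem ae_normL2 {f : R3 → R3 → ℝ} {M : ℝ} (h : normL2 k f ≤ ENNReal.ofReal M) :
    ∀ᵐ v : R3, eLpNorm (fun x => f x v) 2 volume ≤ ENNReal.ofReal (M * weight (-k) v) := by
  filter_upwards [ae_le_of_mixedNorm_le h] with v hv
  rwa [eLpNorm_weight_mul, weight_mul_le_iff] at hv

theorem ae_swap {p : R3 × R3 → Prop} (h : ∀ᵐ z, p z) : ∀ᵐ z : R3 × R3, p z.swap :=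
  (Measure.measurePreserving_swap (μ := (volume : Measure R3))
    (ν := (volume : Measure R3))).quasiMeasurePreserving.ae h

/-- The iterated essential supremum bounds almost every x for almost every v; joint measurability
turns this into a bound almost everywhere in phase space. The coordinates are swapped because v is
the outer variable of the norm but the second one of the product. -/
theorem ae_normInf {f : R3 → R3 → ℝ} (hf : AEStronglyMeasurable (fun z : R3 × R3 => f z.1 z.2))
    {N : ℝ} (hN : 0 ≤ N) (h : normInf k f ≤ ENNReal.ofReal N) :
    ∀ᵐ z : R3 × R3, |f z.1 z.2| ≤ N * weight (-k) z.2 := by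
  obtain ⟨f', hm, hff'⟩ := hf
  have hset : MeasurableSet {z : R3 × R3 | |f' z.swap| ≤ N * weight (-k) z.1} :=
    measurableSet_le (hm.measurable.comp measurable_swap).abs (by fun_prop)
  have h1 : ∀ᵐ z : R3 × R3, z ∈ {z : R3 × R3 | |f' z.swap| ≤ N * weight (-k) z.1} := by
    refine (Measure.ae_prod_mem_iff_ae_ae_mem hset).2 ?_
    filter_upwards [ae_le_of_mixedNorm_le h, Measure.ae_ae_of_ae_prod (ae_swap hff')] with v hv hv'
    rw [eLpNorm_weight_mul, weight_mul_le_iff, eLpNorm_exponent_top] at hv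
    filter_upwards [hv', enorm_ae_le_eLpNormEssSup (fun x => f x v) volume] with x hx hx'
    have := hx'.trans hv
    rw [Real.enorm_eq_ofReal_abs, ENNReal.ofReal_le_ofReal_iff
      (mul_nonneg hN (weight_pos _ _).le)] at this
    change f x v = f' (x, v) at hx
    rw [hx] at this
    exact this
  filter_upwards [ae_swap h1, hff'] with z hz hz'
  rw [hz']
  exact hz

/-- Initial data have a representative satisfying all the bounds everywhere. -/
theorem exists_representative {j : ℝ} {g₀ : R3 → R3 → ℝ}
    (hm : AEStronglyMeasurable (fun z : R3 × R3 => g₀ z.1 z.2))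
    (h0 : ∀ᵐ z : R3 × R3, 0 ≤ maxwellian z.2 + g₀ z.1 z.2) {N M : ℝ} (hN : 0 ≤ N)
    (hI : normInf k g₀ ≤ ENNReal.ofReal N) (h2 : normL2 j g₀ ≤ ENNReal.ofReal M) :
    ∃ g₁ : R3 → R3 → ℝ, (Measurable fun z : R3 × R3 => g₁ z.1 z.2) ∧
      (∀ᵐ z : R3 × R3, g₀ z.1 z.2 = g₁ z.1 z.2) ∧ (∀ x v, |g₁ x v| ≤ N * weight (-k) v) ∧
      (∀ v, eLpNorm (fun x => g₁ x v) 2 volume ≤ ENNReal.ofReal (M * weight (-j) v)) ∧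
      ∀ x v, 0 ≤ maxwellian v + g₁ x v := by
  classical
  have hbd := ae_normInf hm hN hI
  obtain ⟨f, hf, hgf⟩ := hm
  have hfm := hf.measurable
  set S : Set R3 := {v | eLpNorm (fun x => f (x, v)) 2 volume ≤ ENNReal.ofReal (M * weight (-j) v)}
    with hS
  have hSm : MeasurableSet S := by
    refine measurableSet_le ?_ (by fun_prop)
    simp_rw [eLpNorm_eq_lintegral_rpow_enorm_toReal (p := 2) (by norm_num) (by norm_num)]
    have : Measurable fun q : R3 × R3 => ‖f q‖ₑ ^ (2 : ℝ≥0∞).toReal := hfm.enorm.pow_const _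
    exact (this.lintegral_prod_left').pow_const _
  have hSae : ∀ᵐ v : R3, v ∈ S := by
    filter_upwards [ae_normL2 h2, Measure.ae_ae_of_ae_prod (ae_swap hgf)] with v hv hv'
    have hv' : (fun x => g₀ x v) =ᵐ[volume] fun x => f (x, v) := hv'
    rw [hS, mem_ofPred_eq, ← eLpNorm_congr_ae hv']
    exact hv
  -- The representative is put to 0 off G. The value 0 meets every requirement, the sign condition
  -- because μ > 0, and it can only decrease the L² norms of the slices.
  set G : Set (R3 × R3) := {z | |f z| ≤ N * weight (-k) z.2} ∩
    ({z | 0 ≤ maxwellian z.2 + f z} ∩ Prod.snd ⁻¹' S) with hG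
  have hGm : MeasurableSet G := (measurableSet_le hfm.abs (by fun_prop)).inter
    ((measurableSet_le measurable_const (by fun_prop)).inter (measurable_snd hSm))
  refine ⟨fun x v => if (x, v) ∈ G then f (x, v) else 0, Measurable.ite hGm hfm measurable_const,
    ?_, fun x v => ?_, fun v => ?_, fun x v => ?_⟩
  · have hS2 : ∀ᵐ z : R3 × R3, z.2 ∈ S := Measure.quasiMeasurePreserving_snd.ae hSae
    filter_upwards [hbd, hgf, h0, hS2] with z h1 h2 h3 h4
    rw [h2] at h1 h3
    have : z ∈ G := ⟨h1, h3, h4⟩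
    rw [if_pos this, h2]
  · by_cases h : (x, v) ∈ G
    · simp only [if_pos h]; exact h.1
    · simp only [if_neg h, abs_zero]; exact mul_nonneg hN (weight_pos _ _).le
  · by_cases hv : v ∈ S
    · refine le_trans (eLpNorm_mono fun x => ?_) hv
      by_cases h : (x, v) ∈ G
      · simp only [if_pos h, le_refl]
      · simp [if_neg h]
    · have : ∀ x : R3, (x, v) ∉ G := fun x hx => hv hx.2.2
      simp [this]
  · by_cases h : (x, v) ∈ G
    · simp only [if_pos h]; exact h.2.1
    · simp only [if_neg h, add_zero]; exact (maxwellian_pos v).le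

/-- Local existence and uniqueness for prescribed constants. -/
theorem exists_unique_mildSolution (hb : IsCutoff b C) (hγ : -3 < γ) (hγ1 : γ ≤ 1) {j ε : ℝ}
    (hK : 0 ≤ K) (hjk : j ≤ k) (hWk : WeightBound γ b k K) (hWj : WeightBound γ b j K)
    (hWk1 : WeightBound γ b (k - 1) K) (hT : 0 ≤ T) (hε : 0 < ε)
    (hθ : 1 / 8 + 9 * ε * K + (K + 9 * ε * K) * T ≤ 1 / 2) {g₀ : R3 → R3 → ℝ}
    (hm : AEStronglyMeasurable (fun z : R3 × R3 => g₀ z.1 z.2))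
    (h0 : ∀ᵐ z : R3 × R3, 0 ≤ maxwellian z.2 + g₀ z.1 z.2)
    (hI : normInf k g₀ < ENNReal.ofReal ε) (h2 : normL2 j g₀ < ∞) :
    ∃ g : ℝ → R3 → R3 → ℝ, MemX T k j g ∧ IsNonneg T g ∧ IsMildSolution γ b T g₀ g ∧
      supNormInf T k g + supNormL2 T j g ≤ 2 * (normInf k g₀ + normL2 j g₀) ∧
      ∀ h : ℝ → R3 → R3 → ℝ, MemX T k j h → IsMildSolution γ b T g₀ h →
        ∀ t ∈ Icc (0 : ℝ) T, ∀ᵐ z : R3 × R3, h t z.1 z.2 = g t z.1 z.2 := by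
  obtain ⟨N, hN, hNe⟩ : ∃ N : ℝ, 0 ≤ N ∧ normInf k g₀ = ENNReal.ofReal N :=
    ⟨_, ENNReal.toReal_nonneg, (ENNReal.ofReal_toReal hI.ne_top).symm⟩
  obtain ⟨M, hM, hMe⟩ : ∃ M : ℝ, 0 ≤ M ∧ normL2 j g₀ = ENNReal.ofReal M :=
    ⟨_, ENNReal.toReal_nonneg, (ENNReal.ofReal_toReal h2.ne).symm⟩
  have hNε : N < ε := by rwa [hNe, ENNReal.ofReal_lt_ofReal_iff hε] at hI
  -- Radius 2N < 2ε is needed for existence, and 2N + ε < 3ε for uniqueness, where ε is the admitted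
  -- distance of the competitor.
  have hθ' : ∀ A, A ≤ 3 * ε → 1 / 8 + 3 * A * K + (K + 3 * A * K) * T ≤ 1 / 2 := fun A hA => by
    refine le_trans ?_ hθ
    have : 3 * A * K ≤ 9 * ε * K := mul_le_mul_of_nonneg_right (by linarith) hK
    gcongr
  have hθN := hθ' (2 * N) (by linarith)
  obtain ⟨g₁, hm₁, hg₁, hb₁, hl₁, hn₁⟩ := exists_representative hm h0 hN hNe.le hMe.le
  obtain ⟨g, hg, hfix, hlim⟩ := exists_fixedPoint hb hWk hK hN hθN hm₁ hb₁
  have hL2 := eLpNorm_limit_le hb hWj hK hM hθN hm₁ hl₁ (fun n =>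
    (admissible_iterate hb hWk hK hN hθN hm₁ hb₁ n).weight_mono hjk) hlim
  have hsI : supNormInf T k g ≤ ENNReal.ofReal (2 * N) :=
    iSup₂_le fun t _ => normInf_le_of_forall (hg.le t)
  have hs2 : supNormL2 T j g ≤ ENNReal.ofReal (2 * M) :=
    iSup₂_le fun t _ => normL2_le_of_forall (hL2 t)
  refine ⟨g, ⟨hg.meas.aestronglyMeasurable, fun t _ => ?_, hsI.trans_lt ENNReal.ofReal_lt_top,
    hs2.trans_lt ENNReal.ofReal_lt_top⟩, fun t _ => Filter.Eventually.of_forall fun z =>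
      fixedPoint_nonneg hb hγ hγ1 hWk hK hθN hn₁ hg hfix t z.1 z.2,
    isMildSolution_of_fixedPoint hb hWk hK hg₁ hg hfix, ?_, fun h hX hh => ?_⟩
  · exact (hg.meas.comp measurable_prodMk_left).aestronglyMeasurable
  · refine (add_le_add hsI hs2).trans (le_of_eq ?_)
    rw [hNe, hMe, ENNReal.ofReal_mul (by norm_num), ENNReal.ofReal_mul (by norm_num), mul_add]
    simp
  · refine mildSolution_unique hb hWk hWk1 hK (mul_nonneg (by norm_num) hN) hε
      (H := (supNormInf T k h).toReal) ENNReal.toReal_nonneg hT (hθ' _ (by linarith)) hg₁ hg hfix hh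
      hX.aesm fun t ht => ?_
    refine ae_normInf (hX.aesm_slice t ht) ENNReal.toReal_nonneg ?_
    rw [ENNReal.ofReal_toReal hX.bound_inf.ne]
    exact le_iSup₂ (f := fun t (_ : t ∈ Icc (0 : ℝ) T) => normInf k (h t)) t ht

end Boltzmann

theorem theorem3p1 (γ : ℝ) (hγ : -3 < γ) (hγ' : γ ≤ 1)
    (b : ℝ → ℝ) (hb_meas : Measurable b) (C : ℝ) (hC : 0 < C)
    (hb : ∀ θ ∈ Set.Icc (0 : ℝ) Real.pi, 0 ≤ b θ ∧ b θ ≤ C * |Real.cos θ|) :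
    ∃ k₀ : ℝ, 0 < k₀ ∧ ∀ k j : ℝ, k₀ ≤ j → j ≤ k →
      ∃ ε₁ : ℝ, 0 < ε₁ ∧ ∃ T : ℝ, 0 < T ∧
        ∀ g₀ : Boltzmann.R3 → Boltzmann.R3 → ℝ,
          AEStronglyMeasurable (fun z : Boltzmann.R3 × Boltzmann.R3 => g₀ z.1 z.2) volume →
          (∀ᵐ z : Boltzmann.R3 × Boltzmann.R3, 0 ≤ Boltzmann.maxwellian z.2 + g₀ z.1 z.2) →
          Boltzmann.normInf k g₀ < ENNReal.ofReal ε₁ →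
          Boltzmann.normL2 j g₀ < ∞ →
          ∃ g : ℝ → Boltzmann.R3 → Boltzmann.R3 → ℝ,
            Boltzmann.MemX T k j g ∧
            Boltzmann.IsNonneg T g ∧
            Boltzmann.IsMildSolution γ b T g₀ g ∧
            Boltzmann.supNormInf T k g + Boltzmann.supNormL2 T j g
              ≤ 2 * (Boltzmann.normInf k g₀ + Boltzmann.normL2 j g₀) ∧
            ∀ h : ℝ → Boltzmann.R3 → Boltzmann.R3 → ℝ,
              Boltzmann.MemX T k j h → Boltzmann.IsNonneg T h →
              Boltzmann.IsMildSolution γ b T g₀ h →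
              ∀ t ∈ Set.Icc (0 : ℝ) T, ∀ᵐ z : Boltzmann.R3 × Boltzmann.R3,
                h t z.1 z.2 = g t z.1 z.2 := by
  have hcut : Boltzmann.IsCutoff b C :=
    ⟨hb_meas, hC, fun θ hθ => (hb θ hθ).1, fun θ hθ => (hb θ hθ).2⟩
  obtain ⟨l₀, hl₀, hl⟩ := Boltzmann.exists_weightBound hcut hγ hγ'
  -- The weighted bounds are needed with exponents k, j and k-1, the last for uniqueness; hence the
  -- margin 1.
  refine ⟨l₀ + 1, by linarith, fun k j hj hjk => ?_⟩
  obtain ⟨K₁, hK₁, hW₁⟩ := hl k (by linarith)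
  obtain ⟨K₂, hK₂, hW₂⟩ := hl j (by linarith)
  obtain ⟨K₃, hK₃, hW₃⟩ := hl (k - 1) (by linarith)
  set K := K₁ + K₂ + K₃ with hK
  have hK0 : 0 < K := by positivity
  -- With these values 9εK = 1/4 and (K + 1/4)T = 1/8, so the smallness condition reads 1/8 + 1/4 +
  -- 1/8 = 1/2, with equality.
  refine ⟨1 / (36 * K), by positivity, 1 / (8 * K + 2), by positivity,
    fun g₀ hm h0 hI h2 => ?_⟩
  obtain ⟨g, hX, hn, hs, hle, hu⟩ := Boltzmann.exists_unique_mildSolution hcut hγ hγ' hK0.le hjk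
    (hW₁.mono hcut (by linarith)) (hW₂.mono hcut (by linarith)) (hW₃.mono hcut (by linarith))
    (T := 1 / (8 * K + 2)) (by positivity) (ε := 1 / (36 * K)) (by positivity)
    (le_of_eq (by field_simp; ring)) hm h0 hI h2
  exact ⟨g, hX, hn, hs, hle, fun h hhX _ hh => hu h hhX hh⟩
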